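/- For $r>0$ let $\Delta_r=\{\lambda\in\mathbb C:|\lambda|<r\}$, $\Delta=\Delta_1$, and for $\varepsilon>0$ let $A=\{\lambda:1-\varepsilon<|\lambda|<1+\varepsilon\}$ and $R_{1+\varepsilon}=A\times\Delta\subset\mathbb C^2$. A test sequence consists of holomorphic functions $\phi_k:\Delta_{1+\varepsilon}\to\Delta$ $(k\ge1)$ converging uniformly on $\Delta_{1+\varepsilon}$ to some $\phi_0:\Delta_{1+\varepsilon}\to\Delta$, such that $\phi_k-\phi_0$ has no zeros on $\partial\Delta$ for $k$ large, and the variation of the argument of $\phi_k-\phi_0$ along $\partial\Delta$ stays bounded as $k\to\infty$. The graph of $\phi_k$ is denoted by $C_k$. The restriction of a meromorphic function $f$ to a graph over a part of the $\lambda$-plane is called well defined if no part of the graph is contained in the polar set of $f$. An analytic family of graphs over $\Delta_r$, parameterized by an open ball $\mathcal A$ of a complex Banach space, is a family of functions $\phi_\alpha:\Delta_r\to\Delta$, $\alpha\in\mathcal A$, with graphs $C_\alpha$, such that $\Phi(\alpha,\lambda)=(\lambda,\phi_\alpha(\lambda))$ is holomorphic on $\mathcal A\times\Delta_r$ and of generic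 rank $2$ (its differential is surjective on a dense subset), and such that $\phi_\alpha\ne\phi_\beta$ for $\alpha\neq\beta$. A pinched domain around the graph of $\psi:\Delta_r\to\Delta$, $r>1$, is a connected open set $\mathcal P\subset\mathbb C^2$ for which there is a finite set $\Lambda\subset\Delta$ such that $\mathcal P$ contains $(\lambda,\psi(\lambda))$ for all $\lambda\in\Delta_r\setminus\Lambda$, and such that for every $a\in\Lambda$ we have $(a,\psi(a))\notin\mathcal P$ and, for some integer $m\ge1$ and some $c,s>0$, $\mathcal P$ contains all $(\lambda,z)$ with $|\lambda-a|<s$, $|z-\psi(\lambda)|<s$ and $|z-\psi(\lambda)|<c|\lambda-a|^m$. **Theorem.** Let $\varepsilon>0$, let $f$ be a meromorphic function on $R_{1+\varepsilon}$ and let $(\phi_k)_{k\ge1}$ be a test sequence with limit $\phi_0$. Suppose that for every $k$ the restriction $f|_{C_k\cap R_{1+\varepsilon}}$ is well defined and extends to a meromorphic function on $C_k$, and that the number of poles of these extensions, counted with multiplicities, is bounded uniformly in $k$. Then for every $0<\varepsilon'<\varepsilon$ and every $\eta>0$ there is an analytic family $\{C_\alpha\}_{\alpha\in\mathcal A}$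 of graphs of functions $\phi_\alpha:\Delta_{1+\varepsilon'}\to\Delta$, parameterized by an open ball $\mathcal A$ centered at $0$ of an infinite-dimensional complex Banach space, with $|\phi_\alpha-\phi_0|<\eta$ on $\Delta_{1+\varepsilon'}$ for all $\alpha\in\mathcal A$, and with $\phi_{\alpha}=\phi_0$ on $\Delta_{1+\varepsilon'}$ for $\alpha=0$ in case the restriction of $f$ to $C_0\cap R_{1+\varepsilon}$ is well defined, such that: (i) for every $\alpha\in\mathcal A$ the restriction $f|_{C_\alpha\cap R_{1+\varepsilon}}$ is well defined and extends to a meromorphic function on $C_\alpha$, and the number of poles of these extensions, counted with multiplicities, is bounded uniformly in $\alpha$; (ii) the set $\mathcal P=\operatorname{int}\bigl(\bigcup_{\alpha\in\mathcal A}C_\alpha\bigr)$ is a pinched domain around the graph of $\phi_{\alpha}$, $\alpha=0$, and $f$ extends meromorphically, as a function of two variables, to $\mathcal P$: there is a meromorphic function on $\mathcal P$ that coincides with $f$ on $\mathcal P\cap R_{1+\varepsilon}$. -/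

import Mathlib

open Set Filter Topology Metric

namespace LeviPinch

/-- The annulus `{a < |l| < b}`. -/
def annulus (a b : ℝ) : Set ℂ := {l | a < ‖l‖ ∧ ‖l‖ < b}

/-- The ring domain `{1 - ε < |l| < 1 + ε} × {|z| < 1}`. -/
def ringDomain (ε : ℝ) : Set (ℂ × ℂ) := annulus (1 - ε) (1 + ε) ×ˢ ball 0 1

/-- The graph of `φ` over the disk `{|l| < r}`. -/
def graphOver (r : ℝ) (φ : ℂ → ℂ) : Set (ℂ × ℂ) := {p | p.1 ∈ ball 0 r ∧ p.2 = φ p.1}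

/-! Meromorphic functions of two variables are represented by functions `ℂ × ℂ → ℂ` that are
locally quotients of holomorphic functions; values on the zero set of a local denominator carry
no information (as in Mathlib's one-variable `MeromorphicAt`). -/

/-- Near `p`, `f` is the quotient `g / h` of two holomorphic germs, the germ `h` being nonzero. -/
def IsQuotientAt (f g h : ℂ × ℂ → ℂ) (p : ℂ × ℂ) : Prop :=
  AnalyticAt ℂ g p ∧ AnalyticAt ℂ h p ∧ (∃ᶠ q in 𝓝 p, h q ≠ 0) ∧
    ∀ᶠ q in 𝓝 p, h q ≠ 0 → f q = g q / h q

/-- `f` is a meromorphic function of two variables on `U`. -/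
def IsMeromorphicOnTwo (f : ℂ × ℂ → ℂ) (U : Set (ℂ × ℂ)) : Prop :=
  ∀ p ∈ U, ∃ g h, IsQuotientAt f g h p

/-- `f₁` and `f₂` define the same meromorphic function on `U`. -/
def SameMeromorphicOn (f₁ f₂ : ℂ × ℂ → ℂ) (U : Set (ℂ × ℂ)) : Prop :=
  ∀ p ∈ U, ∃ g h, IsQuotientAt f₁ g h p ∧ IsQuotientAt f₂ g h p

/-- The restriction of `f` to the graph of `φ` is well defined over `A`: no part of the graph
over `A` lies in the polar set of `f`, i.e. near each of its points `f` has a denominator that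
does not vanish identically on the graph. -/
def RestrictionWellDefined (f : ℂ × ℂ → ℂ) (φ : ℂ → ℂ) (A : Set ℂ) : Prop :=
  ∀ l₀ ∈ A, ∃ g h, IsQuotientAt f g h (l₀, φ l₀) ∧ ∃ᶠ l in 𝓝 l₀, h (l, φ l) ≠ 0

/-- The restriction of `f` to the graph of `φ` is well defined over `A` and, in the coordinate
`l`, coincides there with the meromorphic function `F` of one variable. -/
def IsRestriction (f : ℂ × ℂ → ℂ) (φ : ℂ → ℂ) (A : Set ℂ) (F : ℂ → ℂ) : Prop :=
  ∀ l₀ ∈ A, ∃ g h, IsQuotientAt f g h (l₀, φ l₀) ∧ (∃ᶠ l in 𝓝 l₀, h (l, φ l) ≠ 0) ∧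
    ∀ᶠ l in 𝓝[≠] l₀, F l * h (l, φ l) = g (l, φ l)

/-- The order of the pole of `F` at `l` (zero if there is no pole). -/
noncomputable def poleOrder (F : ℂ → ℂ) (l : ℂ) : ℕ := (-(meromorphicOrderAt F l).untop₀).toNat

/-- `F` has at most `N` poles in `U`, counted with multiplicities. -/
def PolesAtMost (F : ℂ → ℂ) (U : Set ℂ) (N : ℕ) : Prop :=
  ∀ S : Finset ℂ, (S : Set ℂ) ⊆ U → ∑ l ∈ S, poleOrder F l ≤ N

/-- The restriction of `f` to the part of the graph of `φ : {|l| < r} → ℂ` lying over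
`{1 - ε < |l| < 1 + ε}` is well defined and extends to a meromorphic function on the whole graph
which has at most `N` poles, counted with multiplicities. -/
def ExtendsAlongGraph (ε r : ℝ) (f : ℂ × ℂ → ℂ) (φ : ℂ → ℂ) (N : ℕ) : Prop :=
  ∃ F : ℂ → ℂ, MeromorphicOn F (ball 0 r) ∧
    IsRestriction f φ (annulus (1 - ε) (1 + ε) ∩ ball 0 r) F ∧ PolesAtMost F (ball 0 r) N

/-- The variation of the argument `∮ d arg g = Im ∮ g' / g` along the unit circle of a function
`g` that is holomorphic near the circle and has no zeros on it. -/
noncomputable def varArg (g : ℂ → ℂ) : ℝ := (∮ l in C(0, 1), deriv g l / g l).im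

/-- Test sequences of holomorphic functions from `{|l| < 1 + ε}` to the unit disk. -/
structure IsTestSequence (ε : ℝ) (φ : ℕ → ℂ → ℂ) (φ₀ : ℂ → ℂ) : Prop where
  holomorphic : ∀ k, DifferentiableOn ℂ (φ k) (ball 0 (1 + ε))
  mapsTo : ∀ k, MapsTo (φ k) (ball 0 (1 + ε)) (ball 0 1)
  mapsTo_limit : MapsTo φ₀ (ball 0 (1 + ε)) (ball 0 1)
  tendsto : TendstoUniformlyOn φ φ₀ atTop (ball 0 (1 + ε))
  ne_zero : ∀ᶠ k in atTop, ∀ l ∈ sphere (0 : ℂ) 1, φ k l - φ₀ l ≠ 0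
  varArg_bounded : ∃ V : ℝ, ∀ᶠ k in atTop, |varArg (fun l => φ k l - φ₀ l)| ≤ V

/-- `(φ α)`, for `α` in the ball of radius `ρ` of the Banach space `E`, is an analytic family of
holomorphic functions from `{|l| < r}` to the unit disk: the map `Φ (α, l) = (l, φ α l)` is
holomorphic and of generic rank two. Moreover different parameters give different graphs. -/
structure IsAnalyticFamily {E : Type} [NormedAddCommGroup E] [NormedSpace ℂ E]
    (ρ r : ℝ) (φ : E → ℂ → ℂ) : Prop where
  analytic : AnalyticOnNhd ℂ (fun p : E × ℂ => φ p.1 p.2) (ball 0 ρ ×ˢ ball 0 r)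
  mapsTo : ∀ α ∈ ball (0 : E) ρ, MapsTo (φ α) (ball 0 r) (ball 0 1)
  generic_rank : ball (0 : E) ρ ×ˢ ball (0 : ℂ) r ⊆ closure {p : E × ℂ |
    p ∈ ball (0 : E) ρ ×ˢ ball (0 : ℂ) r ∧
      Function.Surjective (fderiv ℂ (fun q : E × ℂ => (q.2, φ q.1 q.2)) p)}
  injective : ∀ α ∈ ball (0 : E) ρ, ∀ β ∈ ball (0 : E) ρ, EqOn (φ α) (φ β) (ball 0 r) → α = β

/-- The interior of the union of the graphs of a family of functions on `{|l| < r}`. -/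
def sweptSet {E : Type} [NormedAddCommGroup E] (ρ r : ℝ) (φ : E → ℂ → ℂ) : Set (ℂ × ℂ) :=
  interior (⋃ α ∈ ball (0 : E) ρ, graphOver r (φ α))

/-- `P` is a pinched domain around the graph of `ψ` over `{|l| < r}`, where `r > 1`: a domain
that contains the graph except for finitely many points, the pinches, lying over the open unit
disk, and that contains near each pinch a set
`{|z - ψ l| < c |l - a| ^ m}`, `m ≥ 1`. The pinches do not belong to `P`. -/
def IsPinchedDomain (r : ℝ) (ψ : ℂ → ℂ) (P : Set (ℂ × ℂ)) : Prop :=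
  IsOpen P ∧ IsConnected P ∧ ∃ Λ : Finset ℂ, (Λ : Set ℂ) ⊆ ball 0 1 ∧
    (∀ l ∈ ball (0 : ℂ) r, l ∉ Λ → (l, ψ l) ∈ P) ∧
    ∀ a ∈ Λ, (a, ψ a) ∉ P ∧ ∃ m : ℕ, 1 ≤ m ∧ ∃ c > 0, ∃ s > 0, ∀ l z : ℂ,
      ‖l - a‖ < s → ‖z - ψ l‖ < s → ‖z - ψ l‖ < c * ‖l - a‖ ^ m → (l, z) ∈ P

end LeviPinch

/-!
The idea is to blow up the graph of `φ₀` at finitely many points so strongly that the Taylor series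
of `f` along this graph, which is given over an annulus only, extends to the whole disc.

In the coordinate `w = z - φ₀ l` the function `f` has a pole of some order `m` along `w = 0`, and
over a suitable annulus inside the unit disc `w ^ m * f` is holomorphic near `w = 0`
(`exists_annulus_analyticOnNhd`); let `A n` be its Taylor coefficients in `w`. Along the graphs
`w = ψ k l`, where `ψ k = φ k - φ₀` tends to zero, `w ^ m * f` extends to a meromorphic function on
the disc with a bounded number of poles. By the argument principle `ψ k = Q k * v k`, where `Q k` is
a monic polynomial of bounded degree and `v k` is zero-free (`exists_isExpansion`). After passing to
an ultrafilter limit, the roots of `Q k` and the poles converge. By induction on `n` and the maximum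
principle, each `A n` extends meromorphically to the disc, with poles at the finitely many limit
points only (`IsExpansion.exists_numerator`).

The crucial point is that the order of the poles of `A n` at a limit point `a` grows at most
linearly in `n` (`exists_order_bound`). The roots that tend to `a` are divided into those that are
as fast as some root of `|v k a|` and those that are slower than every root. By Harnack's inequality
`v k` has nearly constant size on a circle about `a` whose radius is a suitable root `ρ` of `|v k a|`, and
there the lower order terms of the expansion are under control by induction. A Laurent coefficient
of the remainder, computed both on this circle and on a fixed one, shows that the leading
coefficient of `A n` times the product of the slow roots is smaller than a root of `|v k a|` if the
order of the pole is too large, which is impossible.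

Thus for `b = ∏ (l - a) ^ K` and large `K` the functions `b ^ (n + 1) * A n` are holomorphic on the
disc, and in the coordinate `y = w / b` the function `b * w ^ m * f` is holomorphic on a bidisc
(`exists_blowup`). This extends `f` to the pinched domain `|y - κ| < ρ`, which is swept out by the
graphs `y = κ + α l` with `α` in a ball of a Banach space of holomorphic functions. Here `κ = 0` if
`f` is well defined along the limit graph, when `m = 0`; otherwise `|κ| = 2 * ρ`, so that the pole
`y = 0` is avoided. The number of poles along the graphs is bounded by the order of `b` at the
pinches and, elsewhere, by an estimate of Jensen type over a compact set
(`exists_pole_bound_of_isCompact`).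

There remain graphs to which the restriction of `f` is not well defined. These are components of
the zero sets of local denominators, so there are countably many of them, and a generic point `p`
of the disc lies under no intersection of one of them with the graph of `φ₀`, unless it is this
graph (`exists_separating_point`). Adding `p` to the zeros of `b` makes all graphs of the family
pass through the point of the graph of `φ₀` over `p`, and thereby excludes the bad graphs.
-/

namespace LeviPinch

/-! ### Holomorphic functions of two variables -/

/-- Integration over the circle of radius `R` about `b`, as a functional on `C(sphere b R, ℂ)`. -/
noncomputable def sphereIntegral (b : ℂ) {R : ℝ} (hR : 0 ≤ R) : C(sphere b R, ℂ) →L[ℂ] ℂ :=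
  LinearMap.mkContinuous
    { toFun := fun u => ∫ θ in (0 : ℝ)..2 * Real.pi, deriv (circleMap b R) θ *
        u ⟨circleMap b R θ, circleMap_mem_sphere b hR θ⟩
      map_add' := by
        intro u v
        have hc : ∀ u : C(sphere b R, ℂ), Continuous fun θ : ℝ => deriv (circleMap b R) θ *
            u ⟨circleMap b R θ, circleMap_mem_sphere b hR θ⟩ := by
          intro u
          simp only [deriv_circleMap]
          refine Continuous.mul (by fun_prop) (u.continuous.comp ?_)
          exact (continuous_circleMap b R).subtype_mk _
        rw [← intervalIntegral.integral_add ((hc u).intervalIntegrable _ _)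
          ((hc v).intervalIntegrable _ _)]
        simp only [ContinuousMap.add_apply, mul_add]
      map_smul' := by
        intro c u
        simp only [ContinuousMap.smul_apply, smul_eq_mul, RingHom.id_apply]
        rw [← intervalIntegral.integral_const_mul]
        congr 1
        ext θ
        ring }
    (R * (2 * Real.pi)) (by
      intro u
      have h := intervalIntegral.norm_integral_le_of_norm_le_const (a := 0) (b := 2 * Real.pi)
        (f := fun θ => deriv (circleMap b R) θ *
          u ⟨circleMap b R θ, circleMap_mem_sphere b hR θ⟩) (C := R * ‖u‖) (by
          intro θ _
          rw [norm_mul]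
          refine mul_le_mul ?_ (u.norm_coe_le_norm _) (norm_nonneg _) hR
          simp [deriv_circleMap, abs_of_nonneg hR])
      refine h.trans (le_of_eq ?_)
      rw [sub_zero, abs_of_pos Real.two_pi_pos]
      ring)

lemma sphereIntegral_eq (b : ℂ) {R : ℝ} (hR : 0 ≤ R) (u : C(sphere b R, ℂ)) (f : ℂ → ℂ)
    (h : ∀ z : sphere b R, u z = f z) : sphereIntegral b hR u = ∮ z in C(b, R), f z := by
  simp only [sphereIntegral, LinearMap.mkContinuous_apply, LinearMap.coe_mk, AddHom.coe_mk,
    circleIntegral, smul_eq_mul]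
  simp only [h]

/-- **Osgood's lemma** at the centre of a polydisc: a continuous function that is holomorphic in
each variable is jointly analytic. Cauchy's formula in the first variable yields a holomorphic
curve in the Banach algebra of continuous functions on a circle of the second variable; it is
paired with the Cauchy kernel, which is a holomorphic curve in the same algebra. -/
theorem analyticAt_of_continuousOn_of_separately {g : ℂ × ℂ → ℂ} {a b : ℂ} {R : ℝ} (hR : 0 < R)
    (hc : ContinuousOn g (closedBall a R ×ˢ closedBall b R))
    (h1 : ∀ w ∈ closedBall b R, DifferentiableOn ℂ (fun l => g (l, w)) (ball a R))
    (h2 : ∀ l ∈ ball a R, DifferentiableOn ℂ (fun w => g (l, w)) (ball b R)) :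
    AnalyticAt ℂ g (a, b) := by
  classical
  have hcS : Continuous fun p : closedBall a R × sphere b R => g (p.1, p.2) := by
    have := continuousOn_iff_continuous_domRestrict.1 hc
    exact this.comp (f := fun p : closedBall a R × sphere b R =>
      (⟨(p.1, p.2), ⟨p.1.2, sphere_subset_closedBall p.2.2⟩⟩ :
        (closedBall a R ×ˢ closedBall b R : Set (ℂ × ℂ)))) (by fun_prop)
  let G : C(closedBall a R, C(sphere b R, ℂ)) := ContinuousMap.curry ⟨_, hcS⟩
  let u : ℂ → C(sphere b R, ℂ) := fun l => if h : l ∈ closedBall a R then G ⟨l, h⟩ else 0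
  have huval : ∀ l ∈ closedBall a R, ∀ z : sphere b R, u l z = g (l, z) := by
    intro l hl z
    simp only [u, hl, dif_pos]
    rfl
  have hu : ContinuousOn u (closedBall a R) := by
    rw [continuousOn_iff_continuous_domRestrict]
    convert G.continuous using 1
    ext l z
    have hl : (l : ℂ) ∈ closedBall a R := l.2
    simp only [u, Set.domRestrict_apply, dif_pos hl]
  have hci : CircleIntegrable u a R :=
    (hu.mono sphere_subset_closedBall).circleIntegrable hR.le
  -- Cauchy's integral of the curve `u`, an analytic curve that agrees with `u`
  let U : ℂ → C(sphere b R, ℂ) := fun l =>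
    (2 * Real.pi * Complex.I : ℂ)⁻¹ • ∮ z in C(a, R), (z - l)⁻¹ • u z
  have hU : AnalyticAt ℂ U a := by
    lift R to NNReal using hR.le
    exact (hasFPowerSeriesOn_cauchy_integral hci (by exact_mod_cast hR)).analyticAt
  have hUval : ∀ l ∈ ball a R, ∀ z : sphere b R, U l z = g (l, z) := by
    intro l hl z
    have hcl : CircleIntegrable (fun x => (x - l)⁻¹ • u x) a R := by
      refine ContinuousOn.circleIntegrable hR.le ?_
      refine ContinuousOn.fun_smul ?_ (hu.mono sphere_subset_closedBall)
      refine ContinuousOn.inv₀ (by fun_prop) ?_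
      intro x hx h0
      rw [sub_eq_zero.1 h0] at hx
      exact (ne_of_lt (mem_ball.1 hl)) (mem_sphere.1 hx)
    have e1 : U l z = (2 * Real.pi * Complex.I : ℂ)⁻¹ • ∮ x in C(a, R), (x - l)⁻¹ • g (x, z) := by
      simp only [U, ContinuousMap.smul_apply]
      congr 1
      have := (ContinuousMap.evalCLM ℂ z).intervalIntegral_comp_comm
        (μ := MeasureTheory.volume) (a := 0) (b := 2 * Real.pi)
        (f := fun θ => deriv (circleMap a R) θ • ((circleMap a R θ - l)⁻¹ •
          u (circleMap a R θ))) hcl.out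
      simp only [circleIntegral]
      rw [show (∫ θ in (0:ℝ)..2 * Real.pi, deriv (circleMap a R) θ • ((circleMap a R θ - l)⁻¹ •
          u (circleMap a R θ))) z = (ContinuousMap.evalCLM ℂ z) (∫ θ in (0:ℝ)..2 * Real.pi,
          deriv (circleMap a R) θ • ((circleMap a R θ - l)⁻¹ •
          u (circleMap a R θ))) from rfl, ← this]
      congr 1
      ext θ
      simp only [map_smul]
      congr 2
      exact huval _ (circleMap_mem_closedBall a hR.le θ) z
    rw [e1]
    refine DiffContOnCl.two_pi_i_inv_smul_circleIntegral_sub_inv_smul ?_ hl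
    have hz := sphere_subset_closedBall z.2
    refine ⟨h1 _ hz, ?_⟩
    rw [closure_ball a hR.ne']
    exact hc.comp (by fun_prop) fun l hl => ⟨hl, hz⟩
  -- the Cauchy kernel `1 / (z - w)`, as an inverse in the Banach algebra
  let ι : C(sphere b R, ℂ) := ⟨fun z => z, continuous_subtype_val⟩
  have hunit : ∀ w ∈ ball b R, IsUnit (ι - algebraMap ℂ C(sphere b R, ℂ) w) := by
    intro w hw
    rw [ContinuousMap.isUnit_iff_forall_ne_zero]
    rintro ⟨z, hz⟩ h0
    have : z = w := by simpa [ι, sub_eq_zero] using h0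
    subst this
    exact (ne_of_lt (mem_ball.1 hw)) (mem_sphere.1 hz)
  let k : ℂ → C(sphere b R, ℂ) := fun w => Ring.inverse (ι - algebraMap ℂ C(sphere b R, ℂ) w)
  have hk : AnalyticAt ℂ k b := by
    obtain ⟨x, hx⟩ := hunit b (mem_ball_self hR)
    refine AnalyticAt.fun_comp (f := fun w => ι - algebraMap ℂ C(sphere b R, ℂ) w) ?_ ?_
    · rw [← hx]
      exact analyticAt_inverse x
    · refine analyticAt_const.sub ?_
      exact (Algebra.linearMap ℂ C(sphere b R, ℂ)).toContinuousLinearMap.analyticAt b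
  have hkval : ∀ w ∈ ball b R, ∀ z : sphere b R, k w z = ((z : ℂ) - w)⁻¹ := by
    intro w hw z
    have := congrArg (fun v : C(sphere b R, ℂ) => v z) (Ring.mul_inverse_cancel _ (hunit w hw))
    simp only [ContinuousMap.mul_apply, ContinuousMap.sub_apply, ContinuousMap.one_apply] at this
    exact eq_inv_of_mul_eq_one_right this
  have key : ∀ p ∈ ball a R ×ˢ ball b R,
      (2 * Real.pi * Complex.I : ℂ)⁻¹ • sphereIntegral b hR.le (k p.2 * U p.1) = g p := by
    rintro ⟨l, w⟩ ⟨hl, hw⟩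
    rw [sphereIntegral_eq b hR.le _ (fun z => (z - w)⁻¹ • g (l, z))]
    · refine DiffContOnCl.two_pi_i_inv_smul_circleIntegral_sub_inv_smul
        (f := fun z => g (l, z)) ?_ hw
      refine ⟨h2 l hl, ?_⟩
      rw [closure_ball b hR.ne']
      exact hc.comp (by fun_prop) fun w hw => ⟨ball_subset_closedBall hl, hw⟩
    · intro z
      simp [hkval w hw z, hUval l hl z]
  have hev : (fun p : ℂ × ℂ => (2 * Real.pi * Complex.I : ℂ)⁻¹ •
      sphereIntegral b hR.le (k p.2 * U p.1)) =ᶠ[𝓝 (a, b)] g := by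
    filter_upwards [prod_mem_nhds (ball_mem_nhds a hR) (ball_mem_nhds b hR)] with p hp
    exact key p hp
  refine AnalyticAt.congr ?_ hev
  refine AnalyticAt.fun_const_smul ?_
  refine ((sphereIntegral b hR.le).analyticAt _).fun_comp ?_
  refine AnalyticAt.mul ?_ ?_
  · exact AnalyticAt.fun_comp (g := k) (f := fun p : ℂ × ℂ => p.2) hk analyticAt_snd
  · exact AnalyticAt.fun_comp (g := U) (f := fun p : ℂ × ℂ => p.1) hU analyticAt_fst

/-- **Osgood's lemma** on a product of open sets. -/
theorem analyticOnNhd_of_continuousOn_of_separately {g : ℂ × ℂ → ℂ} {U V : Set ℂ} (hU : IsOpen U)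
    (hV : IsOpen V) (hc : ContinuousOn g (U ×ˢ V))
    (h1 : ∀ w ∈ V, DifferentiableOn ℂ (fun l => g (l, w)) U)
    (h2 : ∀ l ∈ U, DifferentiableOn ℂ (fun w => g (l, w)) V) :
    AnalyticOnNhd ℂ g (U ×ˢ V) := by
  rintro ⟨a, b⟩ ⟨ha, hb⟩
  obtain ⟨r, hr, hrU⟩ := nhds_basis_closedBall.mem_iff.1 (hU.mem_nhds ha)
  obtain ⟨s, hs, hsV⟩ := nhds_basis_closedBall.mem_iff.1 (hV.mem_nhds hb)
  have hrm : closedBall a (min r s) ⊆ U :=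
    (closedBall_subset_closedBall (min_le_left _ _)).trans hrU
  have hsm : closedBall b (min r s) ⊆ V :=
    (closedBall_subset_closedBall (min_le_right _ _)).trans hsV
  refine analyticAt_of_continuousOn_of_separately (lt_min hr hs)
    (hc.mono (prod_mono hrm hsm)) ?_ ?_
  · exact fun w hw => (h1 w (hsm hw)).mono (ball_subset_closedBall.trans hrm)
  · exact fun l hl => (h2 l (hrm (ball_subset_closedBall hl))).mono
      (ball_subset_closedBall.trans hsm)

/-! ### Taylor expansion in the second variable -/

/-- The `m`-th remainder of the Taylor expansion of `h` in powers of the second variable, divided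
by the `m`-th power of that variable. -/
noncomputable def taylorTail (h : ℂ × ℂ → ℂ) : ℕ → ℂ × ℂ → ℂ
  | 0 => h
  | m + 1 => fun p => dslope (fun w => taylorTail h m (p.1, w)) 0 p.2

/-- The `m`-th Taylor coefficient of `h` in powers of the second variable. -/
noncomputable def taylorCoef (h : ℂ × ℂ → ℂ) (m : ℕ) (l : ℂ) : ℂ := taylorTail h m (l, 0)

lemma taylorTail_eq (h : ℂ × ℂ → ℂ) (m : ℕ) (l w : ℂ) :
    taylorTail h m (l, w) = taylorCoef h m l + w * taylorTail h (m + 1) (l, w) := by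
  have := sub_smul_dslope (fun w => taylorTail h m (l, w)) 0 w
  simp only [sub_zero, smul_eq_mul] at this
  simp only [taylorTail, taylorCoef, this]
  ring

lemma eq_sum_taylorCoef_add (h : ℂ × ℂ → ℂ) (m : ℕ) (l w : ℂ) :
    h (l, w) = ∑ j ∈ Finset.range m, taylorCoef h j l * w ^ j + w ^ m * taylorTail h m (l, w) := by
  induction m with
  | zero => simp [taylorTail]
  | succ m ih =>
    rw [ih, Finset.sum_range_succ, taylorTail_eq h m]
    ring

/-- Division by the second variable preserves joint analyticity. -/
lemma analyticOnNhd_dslope_snd {h : ℂ × ℂ → ℂ} {U : Set ℂ} {r : ℝ} (hU : IsOpen U) (hr : 0 < r)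
    (hh : AnalyticOnNhd ℂ h (U ×ˢ ball 0 r)) :
    AnalyticOnNhd ℂ (fun p : ℂ × ℂ => dslope (fun w => h (p.1, w)) 0 p.2) (U ×ˢ ball 0 r) := by
  have h0 : (0 : ℂ) ∈ ball (0 : ℂ) r := mem_ball_self hr
  have hline : ∀ l ∈ U, ∀ w ∈ ball (0 : ℂ) r, AnalyticAt ℂ (fun w => h (l, w)) w := fun l hl w hw =>
    (hh (l, w) ⟨hl, hw⟩).fun_comp (f := fun w => (l, w)) (analyticAt_const.prod analyticAt_id)
  have hder : ∀ l ∈ U, deriv (fun w => h (l, w)) 0 = fderiv ℂ h (l, 0) (0, 1) := by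
    intro l hl
    have h1 := (hh (l, 0) ⟨hl, h0⟩).differentiableAt.hasFDerivAt
    have h2 : HasDerivAt (fun w : ℂ => (l, w)) ((0 : ℂ), (1 : ℂ)) 0 :=
      (hasDerivAt_const _ _).prodMk (hasDerivAt_id _)
    exact (h1.comp_hasDerivAt (0 : ℂ) h2).deriv
  have hfd : ∀ l ∈ U, AnalyticAt ℂ (fun l => fderiv ℂ h (l, 0) (0, 1)) l := by
    intro l hl
    have h1 : AnalyticAt ℂ (fun l : ℂ => fderiv ℂ h (l, 0)) l :=
      (hh (l, 0) ⟨hl, h0⟩).fderiv.fun_comp (f := fun l : ℂ => (l, (0 : ℂ)))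
        (analyticAt_id.prod analyticAt_const)
    exact ((ContinuousLinearMap.apply ℂ ℂ ((0 : ℂ), (1 : ℂ))).analyticAt _).fun_comp h1
  refine analyticOnNhd_of_continuousOn_of_separately hU isOpen_ball ?_ ?_ ?_
  -- joint continuity: on `w = 0` it follows from strict differentiability of `h`
  · rintro ⟨l, w⟩ ⟨hl, hw⟩
    refine ContinuousAt.continuousWithinAt ?_
    by_cases hw0 : w = 0
    · subst hw0
      have hs := (hh (l, 0) ⟨hl, h0⟩).hasStrictFDerivAt.isLittleO
      have hval : dslope (fun w => h (l, w)) 0 0 = fderiv ℂ h (l, 0) (0, 1) := by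
        rw [dslope_same, hder l hl]
      rw [Metric.continuousAt_iff']
      intro ε hε
      have hs' := hs.def (half_pos hε)
      have ht : Tendsto (fun p : ℂ × ℂ => ((p.1, p.2), (p.1, (0 : ℂ)))) (𝓝 (l, 0))
          (𝓝 ((l, 0), (l, 0))) := by
        have : Continuous fun p : ℂ × ℂ => ((p.1, p.2), (p.1, (0 : ℂ))) := by fun_prop
        exact this.tendsto' _ _ rfl
      have hcont : ∀ᶠ p : ℂ × ℂ in 𝓝 (l, 0), p.1 ∈ U ∧
          dist (fderiv ℂ h (p.1, 0) (0, 1)) (fderiv ℂ h (l, 0) (0, 1)) < ε := by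
        have hc : ContinuousAt (fun p : ℂ × ℂ => fderiv ℂ h (p.1, 0) (0, 1)) (l, 0) :=
          ContinuousAt.comp' (g := fun l => fderiv ℂ h (l, 0) (0, 1)) (f := fun p : ℂ × ℂ => p.1)
            (hfd l hl).continuousAt continuousAt_fst
        have hf : ContinuousAt (fun p : ℂ × ℂ => p.1) (l, 0) := continuousAt_fst
        exact (hf.eventually (hU.mem_nhds hl)).and (Metric.continuousAt_iff'.1 hc ε hε)
      filter_upwards [ht.eventually hs', hcont] with p hp hp2
      simp only [hval]
      by_cases hpw : p.2 = 0
      · rw [hpw, dslope_same, hder _ hp2.1]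
        exact hp2.2
      · rw [dslope_of_ne _ hpw, slope_def_field, dist_eq_norm]
        have hpn : 0 < ‖p.2‖ := norm_pos_iff.2 hpw
        simp only [Prod.mk_sub_mk, sub_self, sub_zero] at hp ⊢
        have e1 : fderiv ℂ h (l, 0) (0, p.2) = p.2 * fderiv ℂ h (l, 0) (0, 1) := by
          rw [← smul_eq_mul, ← map_smul]
          simp
        rw [e1] at hp
        have e2 : ‖((0 : ℂ), p.2)‖ = ‖p.2‖ := by simp [Prod.norm_def]
        rw [e2] at hp
        have e3 : (h (p.1, p.2) - h (p.1, 0)) / p.2 - fderiv ℂ h (l, 0) (0, 1) =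
            (h (p.1, p.2) - h (p.1, 0) - p.2 * fderiv ℂ h (l, 0) (0, 1)) / p.2 := by
          field_simp
        rw [e3, norm_div, div_lt_iff₀ hpn]
        nlinarith
    · have hev : (fun p : ℂ × ℂ => dslope (fun w => h (p.1, w)) 0 p.2) =ᶠ[𝓝 (l, w)]
          fun p => (h p - h (p.1, 0)) / p.2 := by
        have : ∀ᶠ p : ℂ × ℂ in 𝓝 (l, w), p.2 ≠ 0 := continuousAt_snd.eventually_ne hw0
        filter_upwards [this] with p hp
        rw [dslope_of_ne _ hp, slope_def_field, sub_zero]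
      refine ContinuousAt.congr ?_ hev.symm
      refine ContinuousAt.div ?_ continuousAt_snd hw0
      refine (hh _ ⟨hl, hw⟩).continuousAt.sub ?_
      exact ContinuousAt.comp' (g := h) (f := fun p : ℂ × ℂ => (p.1, (0 : ℂ)))
        (hh (l, 0) ⟨hl, h0⟩).continuousAt (by fun_prop)
  · intro w hw l hl
    refine DifferentiableAt.differentiableWithinAt ?_
    by_cases hw0 : w = 0
    · subst hw0
      refine ((hfd l hl).differentiableAt).congr_of_eventuallyEq ?_
      filter_upwards [hU.mem_nhds hl] with x hx
      rw [dslope_same, hder x hx]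
    · simp only [dslope_of_ne _ hw0, slope_def_field, sub_zero]
      have hA : ∀ w ∈ ball (0 : ℂ) r, DifferentiableAt ℂ (fun l => h (l, w)) l := fun w hw =>
        ((hh (l, w) ⟨hl, hw⟩).fun_comp (f := fun l => (l, w))
          (analyticAt_id.prod analyticAt_const)).differentiableAt
      exact ((hA w hw).sub (hA 0 h0)).div_const w
  · intro l hl
    exact (Complex.differentiableOn_dslope (isOpen_ball.mem_nhds h0)).2
      fun w hw => (hline l hl w hw).differentiableAt.differentiableWithinAt

section Taylor

variable {h : ℂ × ℂ → ℂ} {U : Set ℂ} {r : ℝ}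

lemma analyticOnNhd_taylorTail (hU : IsOpen U) (hr : 0 < r)
    (hh : AnalyticOnNhd ℂ h (U ×ˢ ball 0 r)) (m : ℕ) :
    AnalyticOnNhd ℂ (taylorTail h m) (U ×ˢ ball 0 r) := by
  induction m with
  | zero => exact hh
  | succ m ih => exact analyticOnNhd_dslope_snd hU hr ih

lemma analyticOnNhd_taylorCoef (hU : IsOpen U) (hr : 0 < r)
    (hh : AnalyticOnNhd ℂ h (U ×ˢ ball 0 r)) (m : ℕ) :
    AnalyticOnNhd ℂ (taylorCoef h m) U := fun l hl =>
  (analyticOnNhd_taylorTail hU hr hh m (l, 0) ⟨hl, mem_ball_self hr⟩).fun_comp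
    (f := fun l => (l, (0 : ℂ))) (analyticAt_id.prod analyticAt_const)

lemma norm_taylorTail_le (hU : IsOpen U) (hr : 0 < r) (hh : AnalyticOnNhd ℂ h (U ×ˢ ball 0 r))
    {C : ℝ} (hC : ∀ p ∈ U ×ˢ ball (0 : ℂ) r, ‖h p‖ ≤ C) (m : ℕ) :
    ∀ p ∈ U ×ˢ ball (0 : ℂ) r, ‖taylorTail h m p‖ ≤ C * (3 / r) ^ m := by
  induction m with
  | zero => simpa [taylorTail] using hC
  | succ m ih =>
    rintro ⟨l, w⟩ ⟨hl, hw⟩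
    have hw' : ‖w‖ < r := by simpa using hw
    obtain ⟨s, hs1, hs2⟩ := exists_between (max_lt hw' (by linarith : 2 * r / 3 < r))
    have hs3 := lt_of_le_of_lt (le_max_left _ _) hs1
    have hs4 := lt_of_le_of_lt (le_max_right _ _) hs1
    have hs0 : 0 < s := lt_of_le_of_lt (norm_nonneg _) hs3
    have hcs : closedBall (0 : ℂ) s ⊆ ball 0 r := closedBall_subset_ball hs2
    have han : ∀ x ∈ ball (0 : ℂ) r,
        DifferentiableAt ℂ (fun w => taylorTail h (m + 1) (l, w)) x := fun x hx =>
      ((analyticOnNhd_taylorTail hU hr hh (m + 1) (l, x) ⟨hl, hx⟩).fun_comp (f := fun w => (l, w))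
        (analyticAt_const.prod analyticAt_id)).differentiableAt
    refine Complex.norm_le_of_forall_mem_frontier_norm_le (U := ball (0 : ℂ) s)
      (f := fun w => taylorTail h (m + 1) (l, w)) isBounded_ball ?_ ?_ (z := w) ?_
    · refine ⟨fun x hx => (han x (hcs (ball_subset_closedBall hx))).differentiableWithinAt, ?_⟩
      rw [closure_ball _ hs0.ne']
      exact fun x hx => (han x (hcs hx)).continuousAt.continuousWithinAt
    · intro x hx
      rw [frontier_ball _ hs0.ne'] at hx
      have hxn : ‖x‖ = s := by simpa using hx
      have e := taylorTail_eq h m l x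
      have e' : x * taylorTail h (m + 1) (l, x) =
          taylorTail h m (l, x) - taylorTail h m (l, 0) := by
        rw [e, taylorCoef]; ring
      have b1 := ih (l, x) ⟨hl, hcs (sphere_subset_closedBall hx)⟩
      have b2 := ih (l, 0) ⟨hl, mem_ball_self hr⟩
      have b3 : s * ‖taylorTail h (m + 1) (l, x)‖ ≤ 2 * (C * (3 / r) ^ m) := by
        rw [← hxn, ← norm_mul, e']
        refine (norm_sub_le _ _).trans ?_
        linarith
      have hB : 0 ≤ C * (3 / r) ^ m := (norm_nonneg _).trans b2
      have b4 : 2 * r / 3 * ‖taylorTail h (m + 1) (l, x)‖ ≤ 2 * (C * (3 / r) ^ m) :=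
        (mul_le_mul_of_nonneg_right hs4.le (norm_nonneg _)).trans b3
      have b5 : C * (3 / r) ^ (m + 1) = (2 * (C * (3 / r) ^ m)) / (2 * r / 3) := by
        rw [pow_succ]; field_simp
      rw [b5, le_div_iff₀ (by positivity)]
      linarith
    · rw [closure_ball _ hs0.ne']
      simpa using hs3.le

lemma norm_taylorCoef_le (hU : IsOpen U) (hr : 0 < r) (hh : AnalyticOnNhd ℂ h (U ×ˢ ball 0 r))
    {C : ℝ} (hC : ∀ p ∈ U ×ˢ ball (0 : ℂ) r, ‖h p‖ ≤ C) (m : ℕ) {l : ℂ} (hl : l ∈ U) :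
    ‖taylorCoef h m l‖ ≤ C * (3 / r) ^ m :=
  norm_taylorTail_le hU hr hh hC m (l, 0) ⟨hl, mem_ball_self hr⟩

end Taylor

/-- An analytic germ at a point has a polydisc on which it is analytic and bounded. -/
lemma exists_polydisc_of_analyticAt {h : ℂ × ℂ → ℂ} {l₀ w₀ : ℂ} (hh : AnalyticAt ℂ h (l₀, w₀))
    {S : Set (ℂ × ℂ)} (hS : S ∈ 𝓝 (l₀, w₀)) :
    ∃ r > 0, AnalyticOnNhd ℂ h (ball l₀ r ×ˢ ball w₀ r) ∧ ball l₀ r ×ˢ ball w₀ r ⊆ S ∧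
      ∃ C, ∀ p ∈ ball l₀ r ×ˢ ball w₀ r, ‖h p‖ ≤ C := by
  have hb : ∀ᶠ p in 𝓝 (l₀, w₀), ‖h p‖ ≤ ‖h (l₀, w₀)‖ + 1 :=
    (hh.continuousAt.norm.eventually_lt continuousAt_const
      (lt_add_one ‖h (l₀, w₀)‖)).mono fun p hp => hp.le
  obtain ⟨r, hr, hrS⟩ := Metric.mem_nhds_iff.1
    (inter_mem (inter_mem hh.eventually_analyticAt hb) hS)
  rw [← ball_prod_same] at hrS
  exact ⟨r, hr, fun p hp => (hrS hp).1.1, fun p hp => (hrS hp).2, _, fun p hp => (hrS hp).1.2⟩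

/-- A nonzero germ of two variables is a power of the second variable times a germ that does not
vanish identically on the first axis. -/
theorem exists_eq_snd_pow_mul {h : ℂ × ℂ → ℂ} {l₀ : ℂ} (hh : AnalyticAt ℂ h (l₀, 0))
    (hne : ∃ᶠ p in 𝓝 (l₀, 0), h p ≠ 0) :
    ∃ (m : ℕ) (h' : ℂ × ℂ → ℂ), AnalyticAt ℂ h' (l₀, 0) ∧
      (∀ᶠ p : ℂ × ℂ in 𝓝 (l₀, 0), h p = p.2 ^ m * h' p) ∧ ∃ᶠ l in 𝓝 l₀, h' (l, 0) ≠ 0 := by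
  classical
  obtain ⟨r, hr, han, -, C, hC⟩ := exists_polydisc_of_analyticAt hh univ_mem
  have hco := analyticOnNhd_taylorCoef isOpen_ball hr han
  have hl₀ : l₀ ∈ ball l₀ r := mem_ball_self hr
  have hex : ∃ m, ∃ᶠ l in 𝓝 l₀, taylorCoef h m l ≠ 0 := by
    by_contra! hcon
    have hz : ∀ m, ∀ l ∈ ball l₀ r, taylorCoef h m l = 0 := fun m =>
      (hco m).eqOn_zero_of_preconnected_of_eventuallyEq_zero
        (convex_ball _ _).isPreconnected hl₀ ((hcon m).mono fun x hx => hx)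
    refine hne ?_
    filter_upwards [prod_mem_nhds (ball_mem_nhds l₀ hr) (ball_mem_nhds (0 : ℂ)
      (by positivity : 0 < r / 3))] with p hp
    obtain ⟨l, w⟩ := p
    have hw : ‖w‖ < r / 3 := by simpa using hp.2
    have hb : ∀ m : ℕ, ‖h (l, w)‖ ≤ C * (‖w‖ * (3 / r)) ^ m := by
      intro m
      rw [eq_sum_taylorCoef_add h m l w, Finset.sum_eq_zero, zero_add, norm_mul, norm_pow, mul_pow]
      · have := norm_taylorTail_le isOpen_ball hr han hC m (l, w)
          ⟨hp.1, by simp only [mem_ball, dist_zero_right]; linarith⟩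
        calc ‖w‖ ^ m * ‖taylorTail h m (l, w)‖ ≤ ‖w‖ ^ m * (C * (3 / r) ^ m) := by gcongr
          _ = _ := by ring
      · intro j _
        rw [hz j l hp.1, zero_mul]
    have hlim : Tendsto (fun m : ℕ => C * (‖w‖ * (3 / r)) ^ m) atTop (𝓝 (C * 0)) := by
      refine (tendsto_pow_atTop_nhds_zero_of_lt_one (by positivity) ?_).const_mul C
      rw [mul_div_assoc', div_lt_one hr]
      linarith
    have := ge_of_tendsto' hlim hb
    rw [mul_zero] at this
    simpa using le_antisymm this (norm_nonneg _)
  refine ⟨Nat.find hex, taylorTail h (Nat.find hex), analyticOnNhd_taylorTail isOpen_ball hr han _ _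
    ⟨hl₀, mem_ball_self hr⟩, ?_, Nat.find_spec hex⟩
  filter_upwards [prod_mem_nhds (ball_mem_nhds l₀ hr) univ_mem] with p hp
  obtain ⟨l, w⟩ := p
  rw [eq_sum_taylorCoef_add h (Nat.find hex) l w, Finset.sum_eq_zero, zero_add]
  intro j hj
  have := Nat.find_min hex (Finset.mem_range.1 hj)
  have hz : EqOn (taylorCoef h j) 0 (ball l₀ r) :=
    (hco j).eqOn_zero_of_preconnected_of_eventuallyEq_zero
        (convex_ball _ _).isPreconnected hl₀ ((not_frequently.1 this).mono fun x hx => not_not.1 hx)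
  rw [hz hp.1, Pi.zero_apply, zero_mul]

/-! ### Germs of meromorphic functions of two variables -/

/-- By the identity theorem, a nonzero analytic germ is nonzero at all nearby points. -/
lemma eventually_frequently_ne_zero {h : ℂ × ℂ → ℂ} {p : ℂ × ℂ} (hh : AnalyticAt ℂ h p)
    (hne : ∃ᶠ q in 𝓝 p, h q ≠ 0) : ∀ᶠ q in 𝓝 p, ∃ᶠ q' in 𝓝 q, h q' ≠ 0 := by
  obtain ⟨r, hr, hrS⟩ := Metric.mem_nhds_iff.1 hh.eventually_analyticAt
  filter_upwards [ball_mem_nhds p hr] with q hq hcon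
  refine hne ?_
  have han : AnalyticOnNhd ℂ h (ball p r) := fun x hx => hrS hx
  have := han.eqOn_zero_of_preconnected_of_eventuallyEq_zero (convex_ball _ _).isPreconnected hq
    (hcon.mono fun x hx => not_not.1 hx)
  filter_upwards [ball_mem_nhds p hr] with x hx
  simpa using this hx

lemma frequently_mul_ne_zero {a b : ℂ × ℂ → ℂ} {p : ℂ × ℂ} (ha : AnalyticAt ℂ a p)
    (hb : AnalyticAt ℂ b p) (ha0 : ∃ᶠ q in 𝓝 p, a q ≠ 0) (hb0 : ∃ᶠ q in 𝓝 p, b q ≠ 0) :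
    ∃ᶠ q in 𝓝 p, a q * b q ≠ 0 := by
  have h1 := ha0.and_eventually
    (ha.eventually_analyticAt.and (eventually_frequently_ne_zero hb hb0))
  refine frequently_frequently_nhds.1 (h1.mono ?_)
  rintro q ⟨hq, hqa, hqb⟩
  exact (hqb.and_eventually (hqa.continuousAt.eventually_ne hq)).mono
    fun x hx => mul_ne_zero hx.2 hx.1

lemma eventually_eq_zero_of_mul {a b : ℂ × ℂ → ℂ} {p : ℂ × ℂ} (ha : AnalyticAt ℂ a p)
    (hb : AnalyticAt ℂ b p) (hb0 : ∃ᶠ q in 𝓝 p, b q ≠ 0) (hab : ∀ᶠ q in 𝓝 p, b q ≠ 0 → a q = 0) :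
    ∀ᶠ q in 𝓝 p, a q = 0 := by
  by_contra hcon
  refine frequently_mul_ne_zero ha hb (not_eventually.1 hcon) hb0 ?_
  filter_upwards [hab] with q hq
  simp only [ne_eq, mul_eq_zero, not_not]
  by_cases h : b q = 0
  · exact Or.inr h
  · exact Or.inl (hq h)

lemma IsQuotientAt.eventually {f g h : ℂ × ℂ → ℂ} {p : ℂ × ℂ} (H : IsQuotientAt f g h p) :
    ∀ᶠ q in 𝓝 p, IsQuotientAt f g h q := by
  filter_upwards [H.1.eventually_analyticAt, H.2.1.eventually_analyticAt,
    eventually_frequently_ne_zero H.2.1 H.2.2.1, eventually_eventually_nhds.2 H.2.2.2]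
    with q h1 h2 h3 h4
  exact ⟨h1, h2, h3, h4⟩

lemma IsQuotientAt.congr {f f' g h : ℂ × ℂ → ℂ} {p : ℂ × ℂ} (H : IsQuotientAt f g h p)
    (hff : f =ᶠ[𝓝 p] f') : IsQuotientAt f' g h p :=
  ⟨H.1, H.2.1, H.2.2.1, by filter_upwards [H.2.2.2, hff] with q hq hq' using by rwa [← hq']⟩

lemma isQuotientAt_of_analyticAt {f : ℂ × ℂ → ℂ} {p : ℂ × ℂ} (hf : AnalyticAt ℂ f p) :
    IsQuotientAt f f (fun _ => 1) p :=
  ⟨hf, analyticAt_const, (Eventually.of_forall fun _ => one_ne_zero).frequently,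
    Eventually.of_forall fun q _ => by simp⟩

lemma IsQuotientAt.mul_right {f g h k : ℂ × ℂ → ℂ} {p : ℂ × ℂ} (H : IsQuotientAt f g h p)
    (hk : AnalyticAt ℂ k p) (hk0 : ∃ᶠ q in 𝓝 p, k q ≠ 0) :
    IsQuotientAt f (fun q => g q * k q) (fun q => h q * k q) p := by
  refine ⟨H.1.mul hk, H.2.1.mul hk, frequently_mul_ne_zero H.2.1 hk H.2.2.1 hk0, ?_⟩
  filter_upwards [H.2.2.2] with q hq hne
  rw [hq (left_ne_zero_of_mul hne), mul_div_mul_right _ _ (right_ne_zero_of_mul hne)]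

/-- If two meromorphic germs agree on open sets accumulating at `p`, their representations are
proportional near `p`. -/
lemma IsQuotientAt.cross_mul {f g h f' g' h' : ℂ × ℂ → ℂ} {p : ℂ × ℂ} (H : IsQuotientAt f g h p)
    (H' : IsQuotientAt f' g' h' p) (hff : ∃ᶠ q in 𝓝 p, f =ᶠ[𝓝 q] f') :
    ∀ᶠ q in 𝓝 p, g q * h' q = g' q * h q := by
  obtain ⟨r, hr, hrS⟩ := Metric.mem_nhds_iff.1 (H.eventually.and H'.eventually)
  obtain ⟨q, hq, hqr⟩ := (hff.and_eventually (ball_mem_nhds p hr)).exists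
  have han : AnalyticOnNhd ℂ (fun q => g q * h' q - g' q * h q) (ball p r) := fun x hx =>
    ((hrS hx).1.1.mul (hrS hx).2.2.1).sub ((hrS hx).2.1.mul (hrS hx).1.2.1)
  obtain ⟨K, K'⟩ := hrS hqr
  have hz : ∀ᶠ x in 𝓝 q, g x * h' x - g' x * h x = 0 := by
    refine eventually_eq_zero_of_mul (han q hqr) (K.2.1.mul K'.2.1)
      (frequently_mul_ne_zero K.2.1 K'.2.1 K.2.2.1 K'.2.2.1) ?_
    filter_upwards [hq, K.2.2.2, K'.2.2.2] with x h1 h2 h3 hne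
    have n1 : h x ≠ 0 := left_ne_zero_of_mul hne
    have n2 : h' x ≠ 0 := right_ne_zero_of_mul hne
    have e := (h2 n1).symm.trans (h1.trans (h3 n2))
    rw [div_eq_div_iff n1 n2] at e
    rw [e, sub_self]
  have := han.eqOn_zero_of_preconnected_of_eventuallyEq_zero (convex_ball _ _).isPreconnected hqr hz
  filter_upwards [ball_mem_nhds p hr] with x hx
  exact sub_eq_zero.1 (this hx)

lemma IsQuotientAt.eventually_frequently_eventuallyEq {f g h f' g' h' : ℂ × ℂ → ℂ} {p : ℂ × ℂ}
    (H : IsQuotientAt f g h p) (H' : IsQuotientAt f' g' h' p)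
    (hff : ∃ᶠ q in 𝓝 p, f =ᶠ[𝓝 q] f') : ∀ᶠ q in 𝓝 p, ∃ᶠ q' in 𝓝 q, f =ᶠ[𝓝 q'] f' := by
  have hc := H.cross_mul H' hff
  filter_upwards [eventually_frequently_ne_zero (H.2.1.mul H'.2.1)
    (frequently_mul_ne_zero H.2.1 H'.2.1 H.2.2.1 H'.2.2.1), eventually_eventually_nhds.2 hc,
    H.eventually.and (eventually_eventually_nhds.2 H.eventually),
    H'.eventually.and (eventually_eventually_nhds.2 H'.eventually)] with q hq hqc hq1 hq2
  refine (hq.and_eventually (hqc.eventually_nhds.and (hq1.2.and hq2.2))).mono ?_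
  rintro x ⟨hx, hxc, hx1, hx2⟩
  have hx0 := (hx1.2.1.mul hx2.2.1).continuousAt.eventually_ne hx
  filter_upwards [hx0, hxc, hx1.2.2.2, hx2.2.2.2] with y hy hyc hy1 hy2
  have n1 : h y ≠ 0 := left_ne_zero_of_mul hy
  have n2 : h' y ≠ 0 := right_ne_zero_of_mul hy
  rw [hy1 n1, hy2 n2, div_eq_div_iff n1 n2, hyc]

/-- The **identity theorem** for meromorphic functions of two variables. -/
theorem frequently_eventuallyEq_of_isPreconnected {f f' : ℂ × ℂ → ℂ} {Ω : Set (ℂ × ℂ)}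
    (hΩ : IsPreconnected Ω) (hf : IsMeromorphicOnTwo f Ω) (hf' : IsMeromorphicOnTwo f' Ω)
    {p₀ : ℂ × ℂ} (hp₀ : p₀ ∈ Ω) (hff : f =ᶠ[𝓝 p₀] f') :
    ∀ p ∈ Ω, ∃ᶠ q in 𝓝 p, f =ᶠ[𝓝 q] f' := by
  have key : Ω ⊆ interior {p | ∃ᶠ q in 𝓝 p, f =ᶠ[𝓝 q] f'} := by
    have hin : ∀ p ∈ Ω, (∃ᶠ q in 𝓝 p, f =ᶠ[𝓝 q] f') →
        p ∈ interior {p | ∃ᶠ q in 𝓝 p, f =ᶠ[𝓝 q] f'} := by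
      intro p hp hfr
      obtain ⟨g, h, H⟩ := hf p hp
      obtain ⟨g', h', H'⟩ := hf' p hp
      exact mem_interior_iff_mem_nhds.2 (H.eventually_frequently_eventuallyEq H' hfr)
    refine hΩ.subset_of_closure_inter_subset isOpen_interior ?_ ?_
    · exact ⟨p₀, hp₀, hin p₀ hp₀ hff.eventually_nhds.frequently⟩
    · rintro p ⟨hpc, hp⟩
      refine hin p hp (frequently_frequently_nhds.1 ?_)
      exact (mem_closure_iff_frequently.1 hpc).mono fun q hq => interior_subset hq
  exact fun p hp => interior_subset (key hp)

lemma IsQuotientAt.exists_common {f g h f' g' h' : ℂ × ℂ → ℂ} {p : ℂ × ℂ}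
    (H : IsQuotientAt f g h p) (H' : IsQuotientAt f' g' h' p)
    (hff : ∃ᶠ q in 𝓝 p, f =ᶠ[𝓝 q] f') :
    ∃ g₁ h₁, IsQuotientAt f g₁ h₁ p ∧ IsQuotientAt f' g₁ h₁ p := by
  refine ⟨_, _, H.mul_right H'.2.1 H'.2.2.1, ?_⟩
  have K := H'.mul_right H.2.1 H.2.2.1
  have hc := H.cross_mul H' hff
  refine ⟨H.1.mul H'.2.1, H.2.1.mul H'.2.1,
    frequently_mul_ne_zero H.2.1 H'.2.1 H.2.2.1 H'.2.2.1, ?_⟩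
  filter_upwards [K.2.2.2, hc] with q hq hqc hne
  rw [hq (by rwa [mul_comm]), hqc, mul_comm (h' q)]

/-- The shear `(l, w) ↦ (l, w + φ l)` maps neighbourhoods onto neighbourhoods. -/
lemma map_shear_nhds {φ : ℂ → ℂ} {l w : ℂ} (hφ : ContinuousAt φ l) :
    Filter.map (fun p : ℂ × ℂ => (p.1, p.2 + φ p.1)) (𝓝 (l, w)) = 𝓝 (l, w + φ l) := by
  have hφ' : ∀ z, ContinuousAt (fun p : ℂ × ℂ => φ p.1) (l, z) := fun z =>
    ContinuousAt.comp' (f := fun p : ℂ × ℂ => p.1) hφ continuousAt_fst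
  refine le_antisymm ?_ ?_
  · exact continuousAt_fst.prodMk (continuousAt_snd.add (hφ' w))
  · have h2 : Tendsto (fun p : ℂ × ℂ => (p.1, p.2 - φ p.1)) (𝓝 (l, w + φ l)) (𝓝 (l, w)) := by
      have : ContinuousAt (fun p : ℂ × ℂ => (p.1, p.2 - φ p.1)) (l, w + φ l) :=
        continuousAt_fst.prodMk (continuousAt_snd.sub (hφ' _))
      simpa only [ContinuousAt, add_sub_cancel_right] using this
    calc 𝓝 (l, w + φ l) = Filter.map (fun p : ℂ × ℂ => (p.1, p.2 + φ p.1))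
          (Filter.map (fun p : ℂ × ℂ => (p.1, p.2 - φ p.1)) (𝓝 (l, w + φ l))) := by
          rw [Filter.map_map]
          convert Filter.map_id.symm using 2
          ext p <;> simp
      _ ≤ _ := Filter.map_mono h2

lemma analyticAt_shear {φ : ℂ → ℂ} {p : ℂ × ℂ} (hφ : AnalyticAt ℂ φ p.1) :
    AnalyticAt ℂ (fun p : ℂ × ℂ => (p.1, p.2 + φ p.1)) p :=
  analyticAt_fst.prod (analyticAt_snd.add (hφ.fun_comp (f := fun p : ℂ × ℂ => p.1) analyticAt_fst))

/-- Meromorphic germs in the coordinate `w = z - φ l`. -/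
lemma IsQuotientAt.shear {f g h : ℂ × ℂ → ℂ} {φ : ℂ → ℂ} {l w : ℂ} (hφ : AnalyticAt ℂ φ l)
    (H : IsQuotientAt f g h (l, w + φ l)) :
    IsQuotientAt (fun p => f (p.1, p.2 + φ p.1)) (fun p => g (p.1, p.2 + φ p.1))
      (fun p => h (p.1, p.2 + φ p.1)) (l, w) := by
  have hm := map_shear_nhds (w := w) hφ.continuousAt
  have ha := analyticAt_shear (p := (l, w)) hφ
  obtain ⟨h1, h2, h3, h4⟩ := H
  rw [← hm] at h3 h4
  exact ⟨AnalyticAt.fun_comp (g := g) (f := fun p : ℂ × ℂ => (p.1, p.2 + φ p.1)) h1 ha,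
    AnalyticAt.fun_comp (g := h) (f := fun p : ℂ × ℂ => (p.1, p.2 + φ p.1)) h2 ha, h3, h4⟩

section Graph

variable {h : ℂ × ℂ → ℂ} {φ : ℂ → ℂ} {l₀ : ℂ}

lemma analyticAt_along_graph (hh : AnalyticAt ℂ h (l₀, φ l₀)) (hφ : AnalyticAt ℂ φ l₀) :
    AnalyticAt ℂ (fun l => h (l, φ l)) l₀ :=
  hh.fun_comp (f := fun l => (l, φ l)) (analyticAt_id.prod hφ)

lemma tendsto_graph (hφ : ContinuousAt φ l₀) :
    Tendsto (fun l => (l, φ l)) (𝓝 l₀) (𝓝 (l₀, φ l₀)) :=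
  (continuousAt_id.prodMk hφ)

lemma eventually_ne_zero_along_graph (hh : AnalyticAt ℂ h (l₀, φ l₀)) (hφ : AnalyticAt ℂ φ l₀)
    (hne : ∃ᶠ l in 𝓝 l₀, h (l, φ l) ≠ 0) : ∀ᶠ l in 𝓝[≠] l₀, h (l, φ l) ≠ 0 :=
  (analyticAt_along_graph hh hφ).eventually_eq_zero_or_eventually_ne_zero.resolve_left fun h0 =>
    hne (h0.mono fun _ hx => not_not.2 hx)

end Graph

/-! ### Zeros and poles of functions of one variable -/

lemma eqOn_of_eventuallyEq_nhdsNE {g h : ℂ → ℂ} {x : ℂ} (hg : AnalyticAt ℂ g x)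
    (hh : AnalyticAt ℂ h x) (hgh : ∀ᶠ l in 𝓝[≠] x, g l = h l) : ∀ᶠ l in 𝓝 x, g l = h l :=
  (hg.frequently_eq_iff_eventually_eq hh).1 hgh.frequently

/-- A meromorphic function without poles is analytic after removal of its singularities. -/
lemma exists_analyticOnNhd_of_order_nonneg {g : ℂ → ℂ} {U : Set ℂ} (hg : MeromorphicOn g U)
    (ho : ∀ x ∈ U, 0 ≤ meromorphicOrderAt g x) :
    ∃ G : ℂ → ℂ, AnalyticOnNhd ℂ G U ∧ ∀ x ∈ U, ∀ᶠ l in 𝓝[≠] x, G l = g l := by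
  refine ⟨toMeromorphicNFOn g U, fun x hx => ?_, fun x hx =>
    hg.toMeromorphicNFOn_eq_self_on_nhdsNE hx⟩
  rw [← (meromorphicNFOn_toMeromorphicNFOn g U hx).meromorphicOrderAt_nonneg_iff_analyticAt,
    meromorphicOrderAt_congr (hg.toMeromorphicNFOn_eq_self_on_nhdsNE hx)]
  exact ho x hx

/-- Zeros of prescribed multiplicities can be divided out. -/
lemma exists_eq_prod_mul {h : ℂ → ℂ} {U : Set ℂ} (hh : AnalyticOnNhd ℂ h U) (S : Finset ℂ)
    (o : ℂ → ℕ) (ho : ∀ l ∈ S, l ∈ U → (o l : ℕ∞) ≤ analyticOrderAt h l) :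
    ∃ u : ℂ → ℂ, AnalyticOnNhd ℂ u U ∧ ∀ x ∈ U, h x = (∏ l ∈ S, (x - l) ^ o l) * u x := by
  classical
  let P : ℂ → ℂ := fun x => ∏ l ∈ S, (x - l) ^ o l
  have hPan : ∀ x, AnalyticAt ℂ P x := fun x => by
    refine Finset.analyticAt_fun_prod _ fun l _ => ?_
    exact (analyticAt_id.sub analyticAt_const).pow _
  have hP0 : ∀ x, ∀ᶠ y in 𝓝[≠] x, P y ≠ 0 := by
    intro x
    have : ∀ l ∈ S, ∀ᶠ y in 𝓝[≠] x, y ≠ l := by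
      intro l _
      by_cases hlx : l = x
      · subst hlx; exact eventually_mem_nhdsWithin
      · exact (eventually_ne_nhds (Ne.symm hlx)).filter_mono nhdsWithin_le_nhds
    filter_upwards [(Finset.eventually_all S).2 this] with y hy
    exact Finset.prod_ne_zero_iff.2 fun l hl => pow_ne_zero _ (sub_ne_zero.2 (hy l hl))
  -- every singularity of `h / P` is removable
  have hloc : ∀ x ∈ U, ∃ u, AnalyticAt ℂ u x ∧ ∀ᶠ y in 𝓝[≠] x, h y / P y = u y := by
    intro x hx
    by_cases hxS : x ∈ S
    · obtain ⟨g, hg, hgh⟩ := (natCast_le_analyticOrderAt (hh x hx)).1 (ho x hxS hx)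
      let P' : ℂ → ℂ := fun y => ∏ l ∈ S.erase x, (y - l) ^ o l
      have hP' : AnalyticAt ℂ P' x := Finset.analyticAt_fun_prod _ fun l _ =>
        (analyticAt_id.sub analyticAt_const).pow _
      have hP'0 : P' x ≠ 0 := Finset.prod_ne_zero_iff.2 fun l hl =>
        pow_ne_zero _ (sub_ne_zero.2 (Finset.ne_of_mem_erase hl).symm)
      refine ⟨fun y => g y / P' y, hg.div hP' hP'0, ?_⟩
      filter_upwards [nhdsWithin_le_nhds hgh, eventually_mem_nhdsWithin] with y hy hyx
      have e : P y = (y - x) ^ o x * P' y := (Finset.mul_prod_erase S _ hxS).symm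
      rw [hy, e, smul_eq_mul, mul_div_mul_left _ _ (pow_ne_zero _ (sub_ne_zero.2 hyx))]
    · refine ⟨fun y => h y / P y, (hh x hx).div (hPan x) ?_, Eventually.of_forall fun _ => rfl⟩
      exact Finset.prod_ne_zero_iff.2 fun l hl => pow_ne_zero _
        (sub_ne_zero.2 fun e => hxS (e ▸ hl))
  obtain ⟨u, hu, huh⟩ := exists_analyticOnNhd_of_order_nonneg (g := fun y => h y / P y) (U := U)
    (fun x hx => (hh x hx).meromorphicAt.div (hPan x).meromorphicAt) (by
      intro x hx
      obtain ⟨u, hu, hux⟩ := hloc x hx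
      rw [meromorphicOrderAt_congr hux]
      exact hu.meromorphicOrderAt_nonneg)
  refine ⟨u, hu, fun x hx => ?_⟩
  refine (eqOn_of_eventuallyEq_nhdsNE (hh x hx) ((hPan x).mul (hu x hx)) ?_).self_of_nhds
  filter_upwards [huh x hx, hP0 x] with y hy hy0
  rw [Pi.mul_apply, hy, mul_div_cancel₀ _ hy0]

lemma exists_fin_map_eq (s : Multiset ℂ) {N : ℕ} (hs : Multiset.card s = N) :
    ∃ c : Fin N → ℂ, Finset.univ.val.map c = s := by
  subst hs
  induction s using Quotient.inductionOn with
  | h L => exact ⟨fun i => L.get i, by rw [Fin.univ_val_map]; simp⟩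

/-- A product of powers of linear factors, padded to a prescribed number of factors. -/
lemma exists_fin_prod_eq (T : Finset ℂ) (o : ℂ → ℕ) {N : ℕ} (hN : ∑ l ∈ T, o l ≤ N) (d : ℂ) :
    ∃ c : Fin N → ℂ, (∀ i, c i ∈ T ∨ c i = d) ∧
      ∀ x, ∏ i, (x - c i) = (∏ l ∈ T, (x - l) ^ o l) * (x - d) ^ (N - ∑ l ∈ T, o l) := by
  classical
  let s : Multiset ℂ := ∑ l ∈ T, Multiset.replicate (o l) l +
    Multiset.replicate (N - ∑ l ∈ T, o l) d
  have hs : Multiset.card s = N := by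
    simp only [s, Multiset.card_add, Multiset.card_sum, Multiset.card_replicate]
    omega
  obtain ⟨c, hc⟩ := exists_fin_map_eq s hs
  refine ⟨c, fun i => ?_, fun x => ?_⟩
  · have : c i ∈ s := by
      rw [← hc]; exact Multiset.mem_map_of_mem c (Finset.mem_univ i)
    rcases Multiset.mem_add.1 this with h | h
    · obtain ⟨l, hl, hl'⟩ := Multiset.mem_sum.1 h
      rw [Multiset.eq_of_mem_replicate hl']
      exact Or.inl hl
    · exact Or.inr (Multiset.eq_of_mem_replicate h)
  · have e : ∏ i, (x - c i) = (s.map fun y => x - y).prod := by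
      rw [← hc, Multiset.map_map]; rfl
    rw [e]
    have e2 : ∀ T' : Finset ℂ, ((∑ l ∈ T', Multiset.replicate (o l) l).map fun y => x - y).prod =
        ∏ l ∈ T', (x - l) ^ o l := by
      intro T'
      induction T' using Finset.induction_on with
      | empty => simp
      | insert a T' ha ih =>
        rw [Finset.sum_insert ha, Finset.prod_insert ha, Multiset.map_add, Multiset.prod_add, ih]
        simp
    simp only [s, Multiset.map_add, Multiset.prod_add, e2, Multiset.map_replicate,
      Multiset.prod_replicate]

lemma finite_zeros_of_isCompact {h : ℂ → ℂ} {U K : Set ℂ} (hh : AnalyticOnNhd ℂ h U)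
    (hU : IsPreconnected U) (hK : IsCompact K) (hKU : K ⊆ U) {x₀ : ℂ} (hx₀ : x₀ ∈ U)
    (h0 : h x₀ ≠ 0) : {x | x ∈ K ∧ h x = 0}.Finite := by
  by_contra hinf
  obtain ⟨x, hxK, hx⟩ := Set.Infinite.exists_accPt_of_subset_isCompact hinf hK fun x hx => hx.1
  rw [accPt_iff_frequently_nhdsNE] at hx
  exact h0 (hh.eqOn_zero_of_preconnected_of_frequently_eq_zero hU (hKU hxK)
    (hx.mono fun y hy => hy.2) hx₀)

/-- A bound of Jensen type for the number of zeros near a point where the function is not small. -/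
lemma two_pow_sum_order_mul_le {h : ℂ → ℂ} {l₁ : ℂ} {r R c C : ℝ} (hr : 0 < r) (hR : 3 * r < R)
    (hh : AnalyticOnNhd ℂ h (ball l₁ R)) (hC : ∀ x ∈ ball l₁ R, ‖h x‖ ≤ C) (hc : c ≤ ‖h l₁‖)
    (S : Finset ℂ) (hS : (S : Set ℂ) ⊆ ball l₁ r) (o : ℂ → ℕ)
    (ho : ∀ l ∈ S, (o l : ℕ∞) ≤ analyticOrderAt h l) :
    2 ^ (∑ l ∈ S, o l) * c ≤ C := by
  obtain ⟨u, hu, huh⟩ := exists_eq_prod_mul hh S o fun l hl _ => ho l hl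
  set n := ∑ l ∈ S, o l with hn
  have h3 : 0 < 3 * r := by positivity
  have hcb : closedBall l₁ (3 * r) ⊆ ball l₁ R := closedBall_subset_ball hR
  have hl₁ : l₁ ∈ ball l₁ R := mem_ball_self (h3.trans hR)
  -- the maximum principle for the quotient of `h` by its zeros, on the disc of radius `3 * r`:
  -- on its boundary all factors are at least `2 * r`, at the centre they are at most `r`
  have hul : ‖u l₁‖ ≤ C / (2 * r) ^ n := by
    refine Complex.norm_le_of_forall_mem_frontier_norm_le (U := ball l₁ (3 * r)) isBounded_ball ?_
      ?_ (subset_closure (mem_ball_self h3))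
    · refine ⟨fun x hx =>
        (hu x (hcb (ball_subset_closedBall hx))).differentiableAt.differentiableWithinAt, ?_⟩
      rw [closure_ball _ h3.ne']
      exact fun x hx => (hu x (hcb hx)).continuousAt.continuousWithinAt
    · intro x hx
      rw [frontier_ball _ h3.ne'] at hx
      have hxU := hcb (sphere_subset_closedBall hx)
      have hp : (2 * r) ^ n ≤ ‖∏ l ∈ S, (x - l) ^ o l‖ := by
        rw [norm_prod, hn, ← Finset.prod_pow_eq_pow_sum]
        refine Finset.prod_le_prod (fun _ _ => by positivity) fun l hl => ?_
        rw [norm_pow]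
        refine pow_le_pow_left₀ (by positivity) ?_ _
        have h1 : dist l l₁ < r := hS hl
        have h2 : dist x l₁ = 3 * r := hx
        have h3 := dist_triangle x l l₁
        rw [← dist_eq_norm]
        linarith
      rw [le_div_iff₀ (by positivity)]
      calc ‖u x‖ * (2 * r) ^ n ≤ ‖u x‖ * ‖∏ l ∈ S, (x - l) ^ o l‖ := by gcongr
        _ = ‖h x‖ := by rw [huh x hxU, norm_mul, mul_comm]
        _ ≤ C := hC x hxU
  have hp : ‖∏ l ∈ S, (l₁ - l) ^ o l‖ ≤ r ^ n := by
    rw [norm_prod, hn, ← Finset.prod_pow_eq_pow_sum]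
    refine Finset.prod_le_prod (fun _ _ => by positivity) fun l hl => ?_
    rw [norm_pow]
    refine pow_le_pow_left₀ (by positivity) ?_ _
    have h1 : dist l l₁ < r := hS hl
    rw [← dist_eq_norm, dist_comm]
    exact h1.le
  have h1 : ‖h l₁‖ ≤ r ^ n * (C / (2 * r) ^ n) := by
    rw [huh l₁ hl₁, norm_mul]
    gcongr
  have h2 : r ^ n * (C / (2 * r) ^ n) = C / 2 ^ n := by
    rw [mul_pow]; field_simp
  rw [h2] at h1
  have := hc.trans h1
  rw [le_div_iff₀ (by positivity)] at this
  linarith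

/-- The **argument principle** on the unit disk, together with the factorization it counts. -/
theorem exists_factorization_varArg {ψ : ℂ → ℂ} {R : ℝ} (hR : 1 < R)
    (hψ : AnalyticOnNhd ℂ ψ (ball 0 R)) (h0 : ∀ x ∈ sphere (0 : ℂ) 1, ψ x ≠ 0) :
    ∃ (T : Finset ℂ) (o : ℂ → ℕ) (v : ℂ → ℂ), (T : Set ℂ) ⊆ ball 0 1 ∧
      AnalyticOnNhd ℂ v (ball 0 R) ∧ (∀ x ∈ closedBall (0 : ℂ) 1, v x ≠ 0) ∧
      (∀ x ∈ ball (0 : ℂ) R, ψ x = (∏ l ∈ T, (x - l) ^ o l) * v x) ∧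
      varArg ψ = 2 * Real.pi * ∑ l ∈ T, o l := by
  classical
  have h1R : closedBall (0 : ℂ) 1 ⊆ ball 0 R := closedBall_subset_ball hR
  have h1 : (1 : ℂ) ∈ sphere (0 : ℂ) 1 := by simp
  have hpre : IsPreconnected (ball (0 : ℂ) R) := (convex_ball _ _).isPreconnected
  have h1' := h1R (sphere_subset_closedBall h1)
  have hfin := finite_zeros_of_isCompact hψ hpre (isCompact_closedBall 0 1) h1R h1' (h0 1 h1)
  let T := hfin.toFinset
  let o : ℂ → ℕ := fun l => analyticOrderNatAt ψ l
  have hTb : (T : Set ℂ) ⊆ ball 0 1 := by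
    intro x hx
    obtain ⟨hx1, hx2⟩ := hfin.mem_toFinset.1 hx
    rcases (mem_closedBall.1 hx1).lt_or_eq with h | h
    · exact h
    · exact absurd hx2 (h0 x h)
  have htop : ∀ x ∈ ball (0 : ℂ) R, analyticOrderAt ψ x ≠ ⊤ := by
    intro x hx htop
    exact h0 1 h1 (hψ.eqOn_zero_of_preconnected_of_eventuallyEq_zero hpre hx
      (analyticOrderAt_eq_top.1 htop) h1')
  have hoc : ∀ l ∈ ball (0 : ℂ) R, (o l : ℕ∞) = analyticOrderAt ψ l := fun l hl =>
    Nat.cast_analyticOrderNatAt (htop l hl)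
  obtain ⟨v, hv, hvψ⟩ := exists_eq_prod_mul hψ T o fun l _ hl => (hoc l hl).le
  -- a zero of `v` in the disc would be a zero of `ψ` of larger order than was divided out
  have hv0 : ∀ x ∈ closedBall (0 : ℂ) 1, v x ≠ 0 := by
    intro x hx hvx
    by_cases hxT : x ∈ T
    · have hxR := h1R hx
      have hlt : ((o x + 1 : ℕ) : ℕ∞) ≤ analyticOrderAt ψ x := by
        rw [natCast_le_analyticOrderAt (hψ x hxR)]
        have hv1 : (1 : ℕ) ≤ analyticOrderAt v x := by
          rw [Nat.cast_one, Order.one_le_iff_ne_zero]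
          exact (hv x hxR).analyticOrderAt_ne_zero.2 hvx
        obtain ⟨g, hg, hgv⟩ := (natCast_le_analyticOrderAt (hv x hxR)).1 hv1
        refine ⟨fun y => (∏ l ∈ T.erase x, (y - l) ^ o l) * g y, ?_, ?_⟩
        · refine AnalyticAt.mul ?_ hg
          exact Finset.analyticAt_fun_prod _ fun l _ => (analyticAt_id.sub analyticAt_const).pow _
        · filter_upwards [hgv, isOpen_ball.mem_nhds hxR] with y hy hyR
          rw [hvψ y hyR, hy, ← Finset.mul_prod_erase T _ hxT]
          simp only [smul_eq_mul]
          ring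
      rw [← hoc x hxR] at hlt
      exact absurd (Nat.cast_le.1 hlt) (by omega)
    · refine hxT (hfin.mem_toFinset.2 ⟨hx, ?_⟩)
      rw [hvψ x (h1R hx), hvx, mul_zero]
  refine ⟨T, o, v, hTb, hv, hv0, hvψ, ?_⟩
  have hlog : ∀ x ∈ sphere (0 : ℂ) 1, deriv ψ x / ψ x =
      ∑ l ∈ T, (o l : ℂ) * (x - l)⁻¹ + deriv v x / v x := by
    intro x hx
    have hxR := h1R (sphere_subset_closedBall hx)
    have hne : ∀ l ∈ T, x - l ≠ 0 := by
      intro l hl e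
      have := hTb hl
      rw [← sub_eq_zero.1 e] at this
      exact (ne_of_lt (mem_ball.1 this)) (mem_sphere.1 hx)
    have hev : ψ =ᶠ[𝓝 x] fun x => (∏ l ∈ T, (x - l) ^ o l) * v x :=
      eventually_of_mem (isOpen_ball.mem_nhds hxR) hvψ
    have e1 : deriv ψ x / ψ x = logDeriv (fun x => (∏ l ∈ T, (x - l) ^ o l) * v x) x := by
      rw [logDeriv_apply, hev.deriv_eq, hev.self_of_nhds]
    rw [e1, logDeriv_mul x (Finset.prod_ne_zero_iff.2 fun l hl => pow_ne_zero _ (hne l hl))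
      (hv0 x (sphere_subset_closedBall hx)) (by fun_prop) (hv x hxR).differentiableAt,
      logDeriv_prod (f := fun l x => (x - l) ^ o l) (fun l hl => pow_ne_zero _ (hne l hl))
        (by fun_prop), logDeriv_apply]
    congr 1
    refine Finset.sum_congr rfl fun l _ => ?_
    have := logDeriv_fun_pow (f := fun x : ℂ => x - l) (x := x) (by fun_prop) (o l)
    rw [this, logDeriv_apply]
    simp [div_eq_mul_inv]
  have hci1 : ∀ l ∈ T, CircleIntegrable (fun x => (o l : ℂ) * (x - l)⁻¹) 0 1 := by
    intro l hl
    refine ContinuousOn.circleIntegrable zero_le_one ?_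
    refine continuousOn_const.mul (ContinuousOn.inv₀ (by fun_prop) ?_)
    intro x hx e
    have := hTb hl
    rw [← sub_eq_zero.1 e] at this
    exact (ne_of_lt (mem_ball.1 this)) (mem_sphere.1 hx)
  have hvv : ∀ x ∈ closedBall (0 : ℂ) 1, AnalyticAt ℂ (fun x => deriv v x / v x) x := fun x hx =>
    (hv x (h1R hx)).deriv.div (hv x (h1R hx)) (hv0 x hx)
  have hci2 : CircleIntegrable (fun x => deriv v x / v x) 0 1 :=
    ContinuousOn.circleIntegrable zero_le_one fun x hx =>
      (hvv x (sphere_subset_closedBall hx)).continuousAt.continuousWithinAt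
  have hcis : CircleIntegrable (fun x => ∑ l ∈ T, (o l : ℂ) * (x - l)⁻¹) 0 1 := by
    have := CircleIntegrable.sum T hci1
    convert this using 1
    ext x
    simp
  have hint : (∮ x in C(0, 1), deriv ψ x / ψ x) = (∑ l ∈ T, (o l : ℂ)) *
      (2 * Real.pi * Complex.I) := by
    rw [circleIntegral.integral_congr zero_le_one hlog, circleIntegral.integral_add
      hcis hci2, circleIntegral.integral_fun_sum hci1]
    have hz : (∮ x in C(0, 1), deriv v x / v x) = 0 := by
      refine DiffContOnCl.circleIntegral_eq_zero zero_le_one ⟨?_, ?_⟩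
      · exact fun x hx =>
          (hvv x (ball_subset_closedBall hx)).differentiableAt.differentiableWithinAt
      · rw [closure_ball _ one_ne_zero]
        exact fun x hx => (hvv x hx).continuousAt.continuousWithinAt
    rw [hz, add_zero, Finset.sum_mul]
    refine Finset.sum_congr rfl fun l hl => ?_
    rw [circleIntegral.integral_const_mul, circleIntegral.integral_sub_inv_of_mem_ball (hTb hl)]
  rw [varArg, hint]
  have : (∑ l ∈ T, (o l : ℂ)) * (2 * Real.pi * Complex.I) =
      ((2 * Real.pi * ∑ l ∈ T, (o l : ℝ) : ℝ) : ℂ) * Complex.I := by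
    push_cast; ring
  rw [this, Complex.mul_I_im, Complex.ofReal_re]
  push_cast
  rfl

/-- A meromorphic function with at most `N` poles is a quotient with a denominator that is a
product of `N` linear factors (the factor `x - d` being used for padding). -/
theorem exists_clear_poles {F : ℂ → ℂ} {U : Set ℂ} {N : ℕ} (hF : MeromorphicOn F U)
    (hN : PolesAtMost F U N) (d : ℂ) :
    ∃ (b : Fin N → ℂ) (H : ℂ → ℂ), (∀ i, b i ∈ U ∨ b i = d) ∧ AnalyticOnNhd ℂ H U ∧
      ∀ x ∈ U, ∀ᶠ l in 𝓝[≠] x, H l = (∏ i, (l - b i)) * F l := by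
  classical
  have hfin : {x | x ∈ U ∧ poleOrder F x ≠ 0}.Finite := by
    by_contra hinf
    obtain ⟨T, hT, hTc⟩ := Set.Infinite.exists_subset_card_eq hinf (N + 1)
    have h1 := hN T fun x hx => (hT hx).1
    have h2 : ∑ l ∈ T, 1 ≤ ∑ l ∈ T, poleOrder F l :=
      Finset.sum_le_sum fun l hl => Nat.one_le_iff_ne_zero.2 (hT hl).2
    simp only [Finset.sum_const, smul_eq_mul, mul_one, hTc] at h2
    omega
  let T := hfin.toFinset
  have hTU : (T : Set ℂ) ⊆ U := fun x hx => (hfin.mem_toFinset.1 hx).1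
  obtain ⟨b, hb, hbP⟩ := exists_fin_prod_eq T (poleOrder F) (hN T hTU) d
  have hPan : ∀ x, AnalyticAt ℂ (fun l => ∏ i, (l - b i)) x := fun x =>
    Finset.analyticAt_fun_prod _ fun i _ => analyticAt_id.sub analyticAt_const
  obtain ⟨H, hH, hHF⟩ := exists_analyticOnNhd_of_order_nonneg
    (g := fun l => (∏ i, (l - b i)) * F l) (U := U)
    (fun x hx => (hPan x).meromorphicAt.mul (hF x hx)) (by
      intro x hx
      have : ∃ P' : ℂ → ℂ, AnalyticAt ℂ P' x ∧
          ∀ l, ∏ i, (l - b i) = P' l * (l - x) ^ poleOrder F x := by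
        by_cases hxT : x ∈ T
        · refine ⟨fun l => (∏ y ∈ T.erase x, (l - y) ^ poleOrder F y) *
            (l - d) ^ (N - ∑ l ∈ T, poleOrder F l), ?_, fun l => ?_⟩
          · refine AnalyticAt.mul (Finset.analyticAt_fun_prod _ fun y _ => ?_) ?_
            · exact (analyticAt_id.sub analyticAt_const).pow _
            · exact (analyticAt_id.sub analyticAt_const).pow _
          · rw [hbP, ← Finset.mul_prod_erase T _ hxT]
            ring
        · have : poleOrder F x = 0 := by
            by_contra h
            exact hxT (hfin.mem_toFinset.2 ⟨hx, h⟩)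
          exact ⟨_, hPan x, fun l => by rw [this, pow_zero, mul_one]⟩
      obtain ⟨P', hP', hPP⟩ := this
      have e : (fun l => (∏ i, (l - b i)) * F l) =
          P' * ((fun l => (l - x) ^ poleOrder F x) * F) := by
        ext l
        simp only [Pi.mul_apply, hPP]
        ring
      have hpow : MeromorphicAt (fun l : ℂ => (l - x) ^ poleOrder F x) x :=
        AnalyticAt.meromorphicAt ((analyticAt_id.sub analyticAt_const).pow _)
      rw [e, meromorphicOrderAt_mul hP'.meromorphicAt (hpow.mul (hF x hx)),
        meromorphicOrderAt_mul hpow (hF x hx), fun_meromorphicOrderAt_pow_id_sub_const]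
      refine add_nonneg hP'.meromorphicOrderAt_nonneg ?_
      cases hord : meromorphicOrderAt F x with
      | top => simp
      | coe n =>
        rw [poleOrder, hord]
        have h1 : (0 : ℤ) ≤ ((-n).toNat : ℤ) + n := by omega
        exact_mod_cast h1)
  exact ⟨b, H, fun i => (hb i).imp_left fun h => hTU h, hH, hHF⟩

/-! ### Growth of the pole orders at a pinch -/

/-- **Harnack's inequality** for the logarithm of a zero-free function bounded by one. -/
lemma abs_log_norm_sub_le {v : ℂ → ℂ} {a : ℂ} {R : ℝ} (hR : 0 < R)
    (hv : AnalyticOnNhd ℂ v (ball a R)) (h0 : ∀ x ∈ ball a R, v x ≠ 0)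
    (h1 : ∀ x ∈ ball a R, ‖v x‖ ≤ 1) (ha : ‖v a‖ < 1) {x : ℂ} (hx : x ∈ ball a R) :
    |Real.log ‖v x‖ - Real.log ‖v a‖| ≤ 2 * (-Real.log ‖v a‖) * ‖x - a‖ / (R - ‖x - a‖) := by
  have hlog : DifferentiableOn ℂ (fun x => deriv v x / v x) (ball a R) := fun x hx =>
    ((hv x hx).deriv.div (hv x hx) (h0 x hx)).differentiableAt.differentiableWithinAt
  -- a holomorphic logarithm of `v`, to which the Borel–Carathéodory inequality applies
  obtain ⟨G, hG⟩ := hlog.isExactOn_ball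
  have haR : a ∈ ball a R := mem_ball_self hR
  have hconst : ∀ y ∈ ball a R, v y = v a * Complex.exp (G y - G a) := by
    have hd : ∀ y ∈ ball a R, HasDerivAt (fun y => v y * Complex.exp (-G y)) 0 y := by
      intro y hy
      have e1 := (hv y hy).differentiableAt.hasDerivAt
      have e2 : HasDerivAt (fun y => Complex.exp (-G y))
          (Complex.exp (-G y) * (-(deriv v y / v y))) y := (hG y hy).neg.cexp
      have := e1.mul e2
      convert! this using 1
      field_simp [h0 y hy]
      ring
    intro y hy
    have := (convex_ball a R).is_const_of_fderivWithin_eq_zero (𝕜 := ℂ)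
      (f := fun y => v y * Complex.exp (-G y))
      (fun z hz => (hd z hz).differentiableAt.differentiableWithinAt)
      (fun z hz => by
        rw [fderivWithin_of_isOpen isOpen_ball hz]
        have := (hd z hz).hasFDerivAt.fderiv
        rw [this]
        ext
        simp) hy haR
    rw [Complex.exp_sub, mul_div_assoc', eq_div_iff (Complex.exp_ne_zero _)]
    calc v y * Complex.exp (G a) = (v y * Complex.exp (-G y)) * Complex.exp (G y) *
          Complex.exp (G a) := by rw [mul_assoc (v y), ← Complex.exp_add]; simp
      _ = v a * Complex.exp (G y) * (Complex.exp (-G a) * Complex.exp (G a)) := by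
          rw [this]; ring
      _ = v a * Complex.exp (G y) := by rw [← Complex.exp_add]; simp
  have hlogn : ∀ y ∈ ball a R, (G y - G a).re = Real.log ‖v y‖ - Real.log ‖v a‖ := by
    intro y hy
    rw [hconst y hy, norm_mul, Complex.norm_exp, Real.log_mul (norm_ne_zero_iff.2 (h0 a haR))
      (Real.exp_ne_zero _), Real.log_exp]
    ring
  have hM : 0 < -Real.log ‖v a‖ := by
    have := Real.log_neg (norm_pos_iff.2 (h0 a haR)) ha
    linarith
  have hmem : ∀ z ∈ ball (0 : ℂ) R, a + z ∈ ball a R := by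
    intro z hz
    simpa [dist_eq_norm] using hz
  have hz : x - a ∈ ball (0 : ℂ) R := by simpa [dist_eq_norm] using hx
  have hBC := Complex.borelCaratheodory_zero (f := fun z => G (a + z) - G a) (R := R) hM
    (fun z hz => by
      have := (hG _ (hmem z hz)).comp_const_add a z
      exact (this.sub_const _).differentiableAt.differentiableWithinAt)
    (fun z hz => by
      have hy := hmem z hz
      show (G (a + z) - G a).re ≤ _
      rw [hlogn _ hy]
      have := Real.log_nonpos (norm_nonneg _) (h1 _ hy)
      linarith) hR hz (by simp)
  simp only [add_sub_cancel] at hBC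
  rw [← hlogn x hx]
  exact (Complex.abs_re_le_norm _).trans hBC

/-- A function on an annulus whose boundary values on the outer circle are close to the principal
part `w / (x - a)`: the value `w a` is a Laurent coefficient and is small when the function is
bounded on a small inner circle. -/
lemma norm_center_le {X w : ℂ → ℂ} {a : ℂ} {ρ R C₁ C₂ : ℝ} (hρ : 0 < ρ) (hρR : ρ ≤ R) (l : ℕ)
    (hX : ∀ x, ρ ≤ ‖x - a‖ → ‖x - a‖ ≤ R → DifferentiableAt ℂ X x)
    (hw : ∀ x ∈ closedBall a R, DifferentiableAt ℂ w x)
    (h1 : ∀ x ∈ sphere a ρ, ‖X x‖ ≤ C₁)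
    (h2 : ∀ x ∈ sphere a R, ‖X x * (x - a) ^ l - w x / (x - a)‖ ≤ C₂) :
    ‖w a‖ ≤ C₁ * ρ ^ (l + 1) + C₂ * R := by
  have hR : 0 < R := hρ.trans_le hρR
  -- deform the circle of integration for the Laurent coefficient of `X`
  have hann : (∮ x in C(a, R), X x * (x - a) ^ l) = ∮ x in C(a, ρ), X x * (x - a) ^ l := by
    refine Complex.circleIntegral_eq_of_differentiable_on_annulus_off_countable hρ hρR
      countable_empty ?_ ?_
    · rintro x ⟨hx1, hx2⟩
      rw [mem_closedBall, dist_eq_norm] at hx1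
      rw [mem_ball, dist_eq_norm, not_lt] at hx2
      exact ((hX x hx2 hx1).mul (by fun_prop)).continuousAt.continuousWithinAt
    · rintro x ⟨⟨hx1, hx2⟩, -⟩
      rw [mem_ball, dist_eq_norm] at hx1
      rw [mem_closedBall, dist_eq_norm, not_le] at hx2
      exact (hX x hx2.le hx1.le).mul (by fun_prop)
  have hcau : (∮ x in C(a, R), w x / (x - a)) = 2 * Real.pi * Complex.I * w a := by
    have := DifferentiableOn.circleIntegral_sub_inv_smul (f := w) (c := a) (R := R) (w := a)
      (fun x hx => (hw x hx).differentiableWithinAt) (mem_ball_self hR)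
    simp only [smul_eq_mul] at this
    rw [← this]
    congr 1
    ext x
    rw [div_eq_inv_mul]
  have hsph : ∀ x ∈ sphere a R, ‖x - a‖ = R := fun x hx => by
    rwa [mem_sphere, dist_eq_norm] at hx
  have hi1 : CircleIntegrable (fun x => X x * (x - a) ^ l) a R :=
    ContinuousOn.circleIntegrable hR.le fun x hx =>
      ((hX x (hρR.trans (hsph x hx).ge) (hsph x hx).le).mul
        (by fun_prop)).continuousAt.continuousWithinAt
  have hi2 : CircleIntegrable (fun x => w x / (x - a)) a R :=
    ContinuousOn.circleIntegrable hR.le fun x hx =>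
      ((hw x (sphere_subset_closedBall hx)).continuousAt.div (by fun_prop) (by
        rw [← norm_ne_zero_iff, hsph x hx]; exact hR.ne')).continuousWithinAt
  have b1 : ‖∮ x in C(a, R), X x * (x - a) ^ l‖ ≤ 2 * Real.pi * ρ * (C₁ * ρ ^ l) := by
    rw [hann]
    refine circleIntegral.norm_integral_le_of_norm_le_const hρ.le fun x hx => ?_
    have : ‖x - a‖ = ρ := by rwa [mem_sphere, dist_eq_norm] at hx
    rw [norm_mul, norm_pow, this]
    exact mul_le_mul_of_nonneg_right (h1 x hx) (by positivity)
  have b2 : ‖∮ x in C(a, R), (X x * (x - a) ^ l - w x / (x - a))‖ ≤ 2 * Real.pi * R * C₂ :=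
    circleIntegral.norm_integral_le_of_norm_le_const hR.le h2
  rw [circleIntegral.integral_sub hi1 hi2, hcau] at b2
  have b3 : ‖2 * Real.pi * Complex.I * w a‖ ≤
      2 * Real.pi * ρ * (C₁ * ρ ^ l) + 2 * Real.pi * R * C₂ := by
    have := norm_sub_norm_le (2 * Real.pi * Complex.I * w a) (∮ x in C(a, R), X x * (x - a) ^ l)
    rw [norm_sub_rev] at this
    linarith
  have b4 : ‖2 * Real.pi * Complex.I * w a‖ = 2 * Real.pi * ‖w a‖ := by
    simp [abs_of_pos Real.pi_pos]
  rw [b4] at b3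
  have h2π := Real.two_pi_pos
  have b5 : 2 * Real.pi * ‖w a‖ ≤ 2 * Real.pi * (C₁ * ρ ^ (l + 1) + C₂ * R) := by
    rw [pow_succ]; linarith
  exact le_of_mul_le_mul_left b5 h2π

/-- A family of points depending on `k` either approaches `a` as fast as some root of `t k`, or
more slowly than every root of `t k`. -/
lemma exists_fast_or_slow {ι : Type*} (𝒰 : Ultrafilter ι) {n : ℕ} (d : ι → Fin n → ℂ) (a : ℂ)
    (t : ι → ℝ) (ht1 : ∀ᶠ k in 𝒰, t k ≤ 1) :
    ∃ (I : Finset (Fin n)) (L : ℕ), 1 ≤ L ∧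
      (∀ L', L ≤ L' → ∀ᶠ k in 𝒰, ∀ i ∈ I, (2 * ‖d k i - a‖) ^ L' ≤ t k) ∧
      ∀ L', 1 ≤ L' → ∀ᶠ k in 𝒰, ∀ i ∉ I, t k < (2 * ‖d k i - a‖) ^ L' := by
  classical
  let P : Fin n → ℕ → Prop := fun i L => 1 ≤ L ∧ ∀ᶠ k in 𝒰, (2 * ‖d k i - a‖) ^ L ≤ t k
  let I : Finset (Fin n) := Finset.univ.filter fun i => ∃ L, P i L
  have hmono : ∀ i L L', P i L → L ≤ L' → ∀ᶠ k in 𝒰, (2 * ‖d k i - a‖) ^ L' ≤ t k := by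
    intro i L L' hP hL
    filter_upwards [hP.2, ht1] with k hk hk1
    have h1 : 2 * ‖d k i - a‖ ≤ 1 := by
      by_contra hcon
      have := one_lt_pow₀ (not_le.1 hcon) (n := L) (by have := hP.1; omega)
      linarith
    exact (pow_le_pow_of_le_one (by positivity) h1 hL).trans hk
  let Lf : Fin n → ℕ := fun i => if h : ∃ L, P i L then h.choose else 1
  refine ⟨I, 1 + ∑ i, Lf i, by omega, ?_, ?_⟩
  -- the fast points: along an ultrafilter, `I` does not depend on `k`
  · intro L' hL'
    refine (Finset.eventually_all I).2 fun i hi => ?_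
    have h : ∃ L, P i L := (Finset.mem_filter.1 hi).2
    refine hmono i _ L' h.choose_spec ?_
    have h1 : Lf i = h.choose := dif_pos h
    have h2 : Lf i ≤ ∑ i, Lf i := Finset.single_le_sum (fun _ _ => Nat.zero_le _)
      (Finset.mem_univ i)
    omega
  · intro L' hL'
    have : ∀ i ∈ Iᶜ, ∀ᶠ k in 𝒰, t k < (2 * ‖d k i - a‖) ^ L' := by
      intro i hi
      have hni : ¬∃ L, P i L := by
        intro h
        exact (Finset.mem_compl.1 hi) (Finset.mem_filter.2 ⟨Finset.mem_univ _, h⟩)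
      have hnot : ¬∀ᶠ k in 𝒰, (2 * ‖d k i - a‖) ^ L' ≤ t k := fun h => hni ⟨L', hL', h⟩
      have := Ultrafilter.eventually_not.2 hnot
      exact this.mono fun k hk => not_le.1 hk
    exact ((Finset.eventually_all _).2 this).mono fun k hk i hi => hk i (Finset.mem_compl.2 hi)

section Products

variable {n : ℕ} (d : Fin n → ℂ) (I : Finset (Fin n)) (a : ℂ)

lemma pow_le_norm_prod_of_fast {ρ : ℝ} (hρ : 0 ≤ ρ) (hd : ∀ i ∈ I, 2 * ‖d i - a‖ ≤ ρ) {x : ℂ}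
    (hx : ρ ≤ ‖x - a‖) : (ρ / 2) ^ I.card ≤ ‖∏ i ∈ I, (x - d i)‖ := by
  rw [norm_prod, ← Finset.prod_const]
  refine Finset.prod_le_prod (fun _ _ => by positivity) fun i hi => ?_
  have h1 := norm_sub_norm_le (x - a) (d i - a)
  rw [sub_sub_sub_cancel_right] at h1
  have := hd i hi
  linarith

lemma norm_prod_le_of_fast {ρ B : ℝ} (hB : 1 ≤ B) (hd : ∀ i ∈ I, 2 * ‖d i - a‖ ≤ ρ) {x : ℂ}
    (hx : ‖x - a‖ ≤ ρ) (hxB : ∀ i, ‖x - d i‖ ≤ B) :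
    ‖∏ i, (x - d i)‖ ≤ (2 * ρ) ^ I.card * B ^ n := by
  have hρ : 0 ≤ ρ := (norm_nonneg _).trans hx
  rw [← Finset.prod_mul_prod_compl I, norm_mul, norm_prod, norm_prod]
  refine mul_le_mul ?_ ?_ (by positivity) (by positivity)
  · rw [← Finset.prod_const]
    refine Finset.prod_le_prod (fun _ _ => norm_nonneg _) fun i hi => ?_
    have h1 := norm_sub_le (x - a) (d i - a)
    rw [sub_sub_sub_cancel_right] at h1
    have := hd i hi
    have := norm_nonneg (d i - a)
    linarith
  · calc ∏ i ∈ Iᶜ, ‖x - d i‖ ≤ ∏ i ∈ Iᶜ, B :=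
          Finset.prod_le_prod (fun _ _ => norm_nonneg _) fun i _ => hxB i
      _ = B ^ (Iᶜ).card := Finset.prod_const _
      _ ≤ B ^ n := pow_le_pow_right₀ hB (by simpa using Finset.card_le_univ (Iᶜ))

lemma pow_le_norm_prod_of_slow {t : ℝ} (ht : 0 ≤ t) {L : ℕ}
    (hd : ∀ i ∉ I, t < (2 * ‖d i - a‖) ^ L) :
    t ^ (Iᶜ).card ≤ (2 ^ (Iᶜ).card * ‖∏ i ∈ Iᶜ, (a - d i)‖) ^ L := by
  have e : 2 ^ (Iᶜ).card * ‖∏ i ∈ Iᶜ, (a - d i)‖ = ∏ i ∈ Iᶜ, (2 * ‖d i - a‖) := by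
    rw [norm_prod, Finset.prod_mul_distrib, Finset.prod_const]
    congr 1
    exact Finset.prod_congr rfl fun i _ => norm_sub_rev _ _
  rw [e, ← Finset.prod_pow, ← Finset.prod_const]
  exact Finset.prod_le_prod (fun _ _ => ht) fun i hi => (hd i (Finset.mem_compl.1 hi)).le

end Products

/-- Near a point where a meromorphic function has a pole of order at most `p`, the function is
bounded by a constant times the corresponding power of the distance. -/
lemma exists_norm_mul_pow_le {g : ℂ → ℂ} {a : ℂ} (hg : MeromorphicAt g a) {p : ℕ}
    (ho : -(p : ℤ) ≤ meromorphicOrderAt g a) :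
    ∃ C, 0 ≤ C ∧ ∀ᶠ x in 𝓝[≠] a, ‖g x‖ * ‖x - a‖ ^ p ≤ C := by
  have hpow : MeromorphicAt (fun x : ℂ => (x - a) ^ p) a :=
    AnalyticAt.meromorphicAt ((analyticAt_id.sub analyticAt_const).pow _)
  have h0 : 0 ≤ meromorphicOrderAt ((fun x : ℂ => (x - a) ^ p) * g) a := by
    rw [meromorphicOrderAt_mul hpow hg, fun_meromorphicOrderAt_pow_id_sub_const]
    cases hord : meromorphicOrderAt g a with
    | top => simp
    | coe m =>
      rw [hord] at ho
      have h1 : -(p : ℤ) ≤ m := by exact_mod_cast ho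
      have h2 : (0 : ℤ) ≤ (p : ℤ) + m := by omega
      exact_mod_cast h2
  obtain ⟨c, hc⟩ := tendsto_nhds_of_meromorphicOrderAt_nonneg (hpow.mul hg) h0
  refine ⟨‖c‖ + 1, by positivity, ?_⟩
  have := hc.norm.eventually_lt_const (lt_add_one ‖c‖)
  filter_upwards [this] with x hx
  rw [Pi.mul_apply, norm_mul, norm_pow] at hx
  linarith

/-- The estimate behind the growth bound, for a single disc. The factors of `P = ∏ (x - b i)` and
`Q = ∏ (x - c i)` with `i ∈ I`, `j ∈ J` vanish inside the circle of radius `ρ`, where `v` has size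
`ρ ^ L`; Taylor coefficients of order `j < n` have poles of order at most `K j + #I`, where
`K = #J + L`, and the coefficient of order `n` has the pole order `K n + #I + l + 1`. -/
lemma norm_leading_coeff_mul_le {M Z : ℕ} {b : Fin M → ℂ} {c : Fin Z → ℂ} {I : Finset (Fin M)}
    {J : Finset (Fin Z)} {a : ℂ} {R r ρ B CH CA Cn τ : ℝ} {H v u : ℂ → ℂ} {A : ℕ → ℂ → ℂ}
    {n l L : ℕ} (hρ : 0 < ρ) (hρr : ρ ≤ r) (hrR : r < R) (hB : 1 ≤ B) (hρ1 : ρ ≤ 1)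
    (hb : ∀ i, ∀ x ∈ ball a R, ‖x - b i‖ ≤ B) (hc : ∀ i, ∀ x ∈ ball a R, ‖x - c i‖ ≤ B)
    (hbI : ∀ i ∈ I, 2 * ‖b i - a‖ ≤ ρ) (hcJ : ∀ i ∈ J, 2 * ‖c i - a‖ ≤ ρ)
    (hH : AnalyticOnNhd ℂ H (ball a R)) (hv : AnalyticOnNhd ℂ v (ball a R))
    (hv0 : ∀ x ∈ ball a R, v x ≠ 0) (hHC : ∀ x ∈ ball a R, ‖H x‖ ≤ CH)
    (hA : ∀ j < n, ∀ x ∈ ball a R, x ≠ a → AnalyticAt ℂ (A j) x)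
    (hu : ∀ x ∈ closedBall a r, AnalyticAt ℂ u x)
    (hAu : ∀ x ∈ sphere a r, u x = (x - a) ^ ((J.card + L) * n + I.card + l + 1) * A n x)
    (hCA0 : 0 ≤ CA)
    (hCA : ∀ j < n, ∀ x ∈ sphere a ρ, ‖A j x‖ * ρ ^ ((J.card + L) * j + I.card) ≤ CA)
    (hvρ1 : ∀ x ∈ sphere a ρ, ‖v x‖ ≤ 2 * ρ ^ L) (hvρ2 : ∀ x ∈ sphere a ρ, ρ ^ L ≤ 2 * ‖v x‖)
    (hvr : ∀ x ∈ sphere a r, ‖v x‖ ≤ τ) (hCn0 : 0 ≤ Cn)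
    (hCn : ∀ x ∈ sphere a r, ‖H x - (∏ i, (x - b i)) *
      ∑ j ∈ Finset.range (n + 1), A j x * ((∏ i, (x - c i)) * v x) ^ j‖ ≤ Cn * ‖v x‖ ^ (n + 1)) :
    ‖u a‖ * (‖∏ i ∈ Iᶜ, (a - b i)‖ * ‖∏ i ∈ Jᶜ, (a - c i)‖ ^ n) ≤
      (CH + n * (2 ^ I.card * B ^ M * ((2 ^ J.card * B ^ Z * 2) ^ n * CA))) *
        2 ^ (I.card + n * J.card + n) * ρ +
      r ^ ((J.card + L) * n + I.card + l) * Cn / ((r / 2) ^ I.card * ((r / 2) ^ J.card) ^ n) *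
        τ * r := by
  classical
  have hr : 0 < r := hρ.trans_le hρr
  set K := J.card + L with hK
  set q := K * n + I.card with hq
  -- `X` is the remainder of order `n`, divided by `v ^ n` and the factors with roots near the centre
  -- and multiplied by `(x - a) ^ q`; for small `v`, `X * (x - a) ^ l` is close to `w / (x - a)`
  let S : ℂ → ℂ := fun x => ∑ j ∈ Finset.range n, A j x * ((∏ i, (x - c i)) * v x) ^ j
  let D : ℂ → ℂ := fun x => (∏ i ∈ I, (x - b i)) * (∏ i ∈ J, (x - c i)) ^ n * v x ^ n
  let X : ℂ → ℂ := fun x => (x - a) ^ q * ((H x - (∏ i, (x - b i)) * S x) / D x)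
  let w : ℂ → ℂ := fun x => (∏ i ∈ Iᶜ, (x - b i)) * (∏ i ∈ Jᶜ, (x - c i)) ^ n * u x
  have hrB : closedBall a r ⊆ ball a R := closedBall_subset_ball hrR
  have hPI : ∀ x, ρ ≤ ‖x - a‖ → (∏ i ∈ I, (x - b i)) ≠ 0 := fun x hx =>
    norm_pos_iff.1 ((by positivity : 0 < (ρ / 2) ^ I.card).trans_le
      (pow_le_norm_prod_of_fast b I a hρ.le hbI hx))
  have hQJ : ∀ x, ρ ≤ ‖x - a‖ → (∏ i ∈ J, (x - c i)) ≠ 0 := fun x hx =>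
    norm_pos_iff.1 ((by positivity : 0 < (ρ / 2) ^ J.card).trans_le
      (pow_le_norm_prod_of_fast c J a hρ.le hcJ hx))
  have hmem : ∀ x, ‖x - a‖ ≤ r → x ∈ ball a R := fun x hx =>
    hrB (by rwa [mem_closedBall, dist_eq_norm])
  have hD0 : ∀ x, ρ ≤ ‖x - a‖ → ‖x - a‖ ≤ r → D x ≠ 0 := fun x hx1 hx2 =>
    mul_ne_zero (mul_ne_zero (hPI x hx1) (pow_ne_zero _ (hQJ x hx1)))
      (pow_ne_zero _ (hv0 x (hmem x hx2)))
  have hX : ∀ x, ρ ≤ ‖x - a‖ → ‖x - a‖ ≤ r → DifferentiableAt ℂ X x := by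
    intro x hx1 hx2
    have hxR := hmem x hx2
    have hxa : x ≠ a := fun e => by
      rw [e, sub_self, norm_zero] at hx1
      exact absurd hx1 (not_le.2 hρ)
    have hvd := (hv x hxR).differentiableAt
    have hS : DifferentiableAt ℂ S x := by
      refine DifferentiableAt.fun_sum fun j hj => ?_
      have := (hA j (Finset.mem_range.1 hj) x hxR hxa).differentiableAt
      fun_prop
    have hDd : DifferentiableAt ℂ D x := by
      simp only [D]
      fun_prop
    have hHd := (hH x hxR).differentiableAt
    refine DifferentiableAt.mul (by fun_prop) (DifferentiableAt.div ?_ hDd (hD0 x hx1 hx2))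
    exact hHd.sub (DifferentiableAt.mul (by fun_prop) hS)
  have hw : ∀ x ∈ closedBall a r, DifferentiableAt ℂ w x := by
    intro x hx
    have := (hu x hx).differentiableAt
    simp only [w]
    fun_prop
  have hCH0 : 0 ≤ CH := (norm_nonneg _).trans (hHC a (mem_ball_self (hr.trans hrR)))
  set E : ℝ := 2 ^ J.card * B ^ Z * 2 with hE
  have hB0 : 0 < B := by linarith
  have hE1 : 1 ≤ E := by
    have h1 : (1 : ℝ) ≤ 2 ^ J.card := one_le_pow₀ (by norm_num)
    have h2 : (1 : ℝ) ≤ B ^ Z := one_le_pow₀ hB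
    have h3 : (1 : ℝ) ≤ 2 ^ J.card * B ^ Z := one_le_mul_of_one_le_of_one_le h1 h2
    rw [hE]; linarith
  set C₁ : ℝ := (CH + n * (2 ^ I.card * B ^ M * (E ^ n * CA))) *
    2 ^ (I.card + n * J.card + n) with hC₁
  -- on the small circle `D` has at least the size `ρ ^ q`, and the remainder is bounded:
  -- `A j` grows like `ρ ^ (-(K * j + #I))`, `Q * v` decays like `ρ ^ K`, and `P` decays like `ρ ^ #I`
  have h1 : ∀ x ∈ sphere a ρ, ‖X x‖ ≤ C₁ := by
    intro x hx
    have hxn : ‖x - a‖ = ρ := by rwa [mem_sphere, dist_eq_norm] at hx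
    have hxR := hmem x (hxn.le.trans hρr)
    have hP : ‖∏ i, (x - b i)‖ ≤ (2 * ρ) ^ I.card * B ^ M :=
      norm_prod_le_of_fast b I a hB hbI hxn.le fun i => hb i x hxR
    have hQ : ‖(∏ i, (x - c i)) * v x‖ ≤ E * ρ ^ K := by
      rw [norm_mul]
      calc _ ≤ ((2 * ρ) ^ J.card * B ^ Z) * (2 * ρ ^ L) :=
            mul_le_mul (norm_prod_le_of_fast c J a hB hcJ hxn.le fun i => hc i x hxR) (hvρ1 x hx)
              (norm_nonneg _) (by positivity)
        _ = E * ρ ^ K := by rw [hE, hK, mul_pow, pow_add]; ring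
    have hPS : ‖(∏ i, (x - b i)) * S x‖ ≤ n * (2 ^ I.card * B ^ M * (E ^ n * CA)) := by
      rw [Finset.mul_sum]
      refine (norm_sum_le _ _).trans ?_
      have : ∀ j ∈ Finset.range n, ‖(∏ i, (x - b i)) * (A j x * ((∏ i, (x - c i)) * v x) ^ j)‖ ≤
          2 ^ I.card * B ^ M * (E ^ n * CA) := by
        intro j hj
        have hj := Finset.mem_range.1 hj
        rw [norm_mul, norm_mul (A j x), norm_pow]
        calc _ ≤ ((2 * ρ) ^ I.card * B ^ M) * (‖A j x‖ * (E * ρ ^ K) ^ j) := by gcongr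
          _ = 2 ^ I.card * B ^ M * (E ^ j * (‖A j x‖ * ρ ^ (K * j + I.card))) := by
              rw [mul_pow, mul_pow, pow_add ρ (K * j), pow_mul ρ K j]; ring
          _ ≤ 2 ^ I.card * B ^ M * (E ^ n * CA) := by
              gcongr
              · exact hCA j hj x hx
      calc _ ≤ ∑ j ∈ Finset.range n, 2 ^ I.card * B ^ M * (E ^ n * CA) := Finset.sum_le_sum this
        _ = _ := by rw [Finset.sum_const, Finset.card_range, nsmul_eq_mul]
    have hnum : ‖H x - (∏ i, (x - b i)) * S x‖ ≤
        CH + n * (2 ^ I.card * B ^ M * (E ^ n * CA)) :=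
      (norm_sub_le _ _).trans (add_le_add (hHC x hxR) hPS)
    have hden : ρ ^ q ≤ 2 ^ (I.card + n * J.card + n) * ‖D x‖ := by
      have e1 := pow_le_norm_prod_of_fast b I a hρ.le hbI hxn.ge
      have e2 := pow_le_norm_prod_of_fast c J a hρ.le hcJ hxn.ge
      have e3 : ρ ^ L / 2 ≤ ‖v x‖ := by have := hvρ2 x hx; linarith
      simp only [D]
      rw [norm_mul, norm_mul, norm_pow, norm_pow]
      calc ρ ^ q = 2 ^ (I.card + n * J.card + n) *
            ((ρ / 2) ^ I.card * ((ρ / 2) ^ J.card) ^ n * (ρ ^ L / 2) ^ n) := by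
            rw [div_pow, div_pow, div_pow, div_pow, hq, hK]
            field_simp
            ring
        _ ≤ _ := by gcongr
    have hDpos : 0 < ‖D x‖ := norm_pos_iff.2 (hD0 x hxn.ge (hxn.le.trans hρr))
    simp only [X]
    rw [norm_mul, norm_pow, hxn, norm_div, mul_div_assoc', div_le_iff₀ hDpos]
    calc ρ ^ q * ‖H x - (∏ i, (x - b i)) * S x‖ ≤ (2 ^ (I.card + n * J.card + n) * ‖D x‖) *
          (CH + n * (2 ^ I.card * B ^ M * (E ^ n * CA))) := by gcongr
      _ = C₁ * ‖D x‖ := by rw [hC₁]; ring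
  set C₂ : ℝ := r ^ (q + l) * Cn / ((r / 2) ^ I.card * ((r / 2) ^ J.card) ^ n) * τ with hC₂
  -- on the large circle, the expansion of order `n + 1` compares `X * (x - a) ^ l` with `w / (x - a)`
  have h2 : ∀ x ∈ sphere a r, ‖X x * (x - a) ^ l - w x / (x - a)‖ ≤ C₂ := by
    intro x hx
    have hxn : ‖x - a‖ = r := by rwa [mem_sphere, dist_eq_norm] at hx
    have hxa : x - a ≠ 0 := norm_pos_iff.1 (hxn ▸ hr)
    have hxR := hmem x hxn.le
    have hDx := hD0 x (hρr.trans hxn.ge) hxn.le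
    have hsum : ∑ j ∈ Finset.range (n + 1), A j x * ((∏ i, (x - c i)) * v x) ^ j =
        S x + A n x * ((∏ i, (x - c i)) * v x) ^ n := Finset.sum_range_succ _ _
    have hCnx := hCn x hx
    rw [hsum] at hCnx
    have eP : ∏ i, (x - b i) = (∏ i ∈ I, (x - b i)) * ∏ i ∈ Iᶜ, (x - b i) :=
      (Finset.prod_mul_prod_compl I _).symm
    have eQ : ∏ i, (x - c i) = (∏ i ∈ J, (x - c i)) * ∏ i ∈ Jᶜ, (x - c i) :=
      (Finset.prod_mul_prod_compl J _).symm
    have key : X x * (x - a) ^ l - w x / (x - a) = (x - a) ^ (q + l) *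
        ((H x - (∏ i, (x - b i)) * (S x + A n x * ((∏ i, (x - c i)) * v x) ^ n)) / D x) := by
      have hw' : w x / (x - a) = (x - a) ^ (q + l) *
          ((∏ i ∈ Iᶜ, (x - b i)) * (∏ i ∈ Jᶜ, (x - c i)) ^ n * A n x) := by
        simp only [w]
        rw [hAu x hx, pow_succ, div_eq_iff hxa]
        ring
      have hD' : (∏ i ∈ Iᶜ, (x - b i)) * (∏ i ∈ Jᶜ, (x - c i)) ^ n * A n x =
          ((∏ i, (x - b i)) * (A n x * ((∏ i, (x - c i)) * v x) ^ n)) / D x := by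
        rw [eq_div_iff hDx, eP, eQ]
        simp only [D]
        ring
      rw [hw', hD']
      simp only [X]
      rw [pow_add]
      ring
    rw [key, norm_mul, norm_pow, norm_div, hxn, mul_div_assoc']
    have hDpos : 0 < ‖D x‖ := norm_pos_iff.2 hDx
    have hvpos : 0 < ‖v x‖ := norm_pos_iff.2 (hv0 x hxR)
    have hden : (r / 2) ^ I.card * ((r / 2) ^ J.card) ^ n * ‖v x‖ ^ n ≤ ‖D x‖ := by
      have e1 := pow_le_norm_prod_of_fast b I a hr.le (fun i hi => (hbI i hi).trans hρr) hxn.ge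
      have e2 := pow_le_norm_prod_of_fast c J a hr.le (fun i hi => (hcJ i hi).trans hρr) hxn.ge
      simp only [D]
      rw [norm_mul, norm_mul, norm_pow, norm_pow]
      gcongr
    calc _ ≤ r ^ (q + l) * (Cn * ‖v x‖ ^ (n + 1)) /
          ((r / 2) ^ I.card * ((r / 2) ^ J.card) ^ n * ‖v x‖ ^ n) := by gcongr
      _ = r ^ (q + l) * Cn / ((r / 2) ^ I.card * ((r / 2) ^ J.card) ^ n) * ‖v x‖ := by
          rw [pow_succ]
          field_simp
      _ ≤ C₂ := by
          rw [hC₂]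
          have := hvr x hx
          gcongr
  have hfin := norm_center_le hρ hρr l hX hw h1 h2
  have hC₁0 : 0 ≤ C₁ := by positivity
  have hρl : C₁ * ρ ^ (l + 1) ≤ C₁ * ρ := by
    refine mul_le_mul_of_nonneg_left ?_ hC₁0
    exact (pow_le_pow_of_le_one hρ.le hρ1 (by omega : 1 ≤ l + 1)).trans_eq (pow_one ρ)
  have hwa : ‖w a‖ = ‖u a‖ * (‖∏ i ∈ Iᶜ, (a - b i)‖ * ‖∏ i ∈ Jᶜ, (a - c i)‖ ^ n) := by
    simp only [w, norm_mul, norm_pow]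
    ring
  rw [← hwa]
  exact hfin.trans (add_le_add hρl le_rfl)

/-- Harnack's inequality at the scale `σ ^ 2`, where `‖v a‖ = σ ^ (2 * L)`: on this small circle
`v` is comparable to its value at the centre. -/
lemma norm_le_two_mul_of_mem_sphere {v : ℂ → ℂ} {a : ℂ} {R σ : ℝ} {L : ℕ} (hR : 0 < R)
    (hv : AnalyticOnNhd ℂ v (ball a R)) (h0 : ∀ x ∈ ball a R, v x ≠ 0)
    (h1 : ∀ x ∈ ball a R, ‖v x‖ ≤ 1) (hσ0 : 0 < σ) (ha : ‖v a‖ < 1)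
    (hva : ‖v a‖ = (σ ^ 2) ^ L) (hσR : 2 * σ ^ 2 ≤ R)
    (hσL : 8 * L * (-Real.log σ * σ ^ 2) ≤ R * Real.log 2) {x : ℂ} (hx : x ∈ sphere a (σ ^ 2)) :
    ‖v x‖ ≤ 2 * (σ ^ 2) ^ L ∧ (σ ^ 2) ^ L ≤ 2 * ‖v x‖ := by
  have hxn : ‖x - a‖ = σ ^ 2 := by rwa [mem_sphere, dist_eq_norm] at hx
  have hσ2 : 0 < σ ^ 2 := by positivity
  have hxR : x ∈ ball a R := by rw [mem_ball, dist_eq_norm, hxn]; linarith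
  have hlog : Real.log ‖v a‖ = 2 * L * Real.log σ := by
    rw [hva, ← pow_mul, Real.log_pow]; push_cast; ring
  have h := abs_log_norm_sub_le hR hv h0 h1 ha hxR
  have hlog0 : Real.log ‖v a‖ ≤ 0 := Real.log_nonpos (norm_nonneg _) ha.le
  have hle : 2 * (-Real.log ‖v a‖) * ‖x - a‖ / (R - ‖x - a‖) ≤ Real.log 2 := by
    rw [hxn, div_le_iff₀ (by linarith)]
    have hl2 : 0 < Real.log 2 := Real.log_pos (by norm_num)
    calc 2 * (-Real.log ‖v a‖) * σ ^ 2 = (8 * L * (-Real.log σ * σ ^ 2)) / 2 := by rw [hlog]; ring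
      _ ≤ (R * Real.log 2) / 2 := by linarith
      _ ≤ Real.log 2 * (R - σ ^ 2) := by nlinarith
  have hvx : 0 < ‖v x‖ := norm_pos_iff.2 (h0 x hxR)
  have hva0 : 0 < ‖v a‖ := norm_pos_iff.2 (h0 a (mem_ball_self hR))
  have h2 := abs_le.1 (h.trans hle)
  rw [← hva]
  constructor
  · rw [← Real.log_le_log_iff hvx (by positivity), Real.log_mul (by norm_num) hva0.ne']
    linarith [h2.2]
  · rw [← Real.log_le_log_iff hva0 (by positivity), Real.log_mul (by norm_num) hvx.ne']
    linarith [h2.1]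

/-- Harnack's inequality at a fixed scale: far from the centre, `v` is still at most the square
root of its value there. -/
lemma norm_le_pow_of_mem_sphere {v : ℂ → ℂ} {a : ℂ} {R r σ : ℝ} {L : ℕ} (hR : 0 < R)
    (hv : AnalyticOnNhd ℂ v (ball a R)) (h0 : ∀ x ∈ ball a R, v x ≠ 0)
    (h1 : ∀ x ∈ ball a R, ‖v x‖ ≤ 1) (hσ0 : 0 < σ) (ha : ‖v a‖ < 1)
    (hva : ‖v a‖ = (σ ^ 2) ^ L) (hrR : 8 * r ≤ R) {x : ℂ} (hx : x ∈ sphere a r) :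
    ‖v x‖ ≤ σ ^ L := by
  have hxn : ‖x - a‖ = r := by rwa [mem_sphere, dist_eq_norm] at hx
  have hr0 : 0 ≤ r := hxn ▸ norm_nonneg _
  have hxR : x ∈ ball a R := by rw [mem_ball, dist_eq_norm, hxn]; linarith
  have hlog : Real.log ‖v a‖ = 2 * Real.log (σ ^ L) := by
    rw [hva, ← pow_mul, mul_comm, pow_mul, Real.log_pow]; push_cast; ring
  have h := abs_log_norm_sub_le hR hv h0 h1 ha hxR
  have hlog0 : Real.log ‖v a‖ ≤ 0 := Real.log_nonpos (norm_nonneg _) ha.le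
  have hle : 2 * (-Real.log ‖v a‖) * ‖x - a‖ / (R - ‖x - a‖) ≤ -Real.log ‖v a‖ / 2 := by
    rw [hxn, div_le_iff₀ (by linarith)]
    nlinarith
  have hvx : 0 < ‖v x‖ := norm_pos_iff.2 (h0 x hxR)
  have h2 := (abs_le.1 (h.trans hle)).2
  rw [← Real.log_le_log_iff hvx (by positivity)]
  linarith

/-- The growth of the Taylor coefficients near a pinch: if functions `ψ = Q v`, with `v` zero-free
and tending to zero, and functions `H` with `H = P ∑ A j ψ ^ j` to every order in `v`, are given on
a disc, where `P` and `Q` are monic polynomials of bounded degree, then the order of the pole of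
`A n` at the centre grows at most linearly in `n`. -/
theorem exists_order_bound {ι : Type*} (𝒰 : Ultrafilter ι) {M Z : ℕ} {b : ι → Fin M → ℂ}
    {c : ι → Fin Z → ℂ} {a : ℂ} {R B CH : ℝ} {H v : ι → ℂ → ℂ} {A : ℕ → ℂ → ℂ} (hR : 0 < R)
    (hB : 1 ≤ B) (hb : ∀ k i, ∀ x ∈ ball a R, ‖x - b k i‖ ≤ B)
    (hc : ∀ k i, ∀ x ∈ ball a R, ‖x - c k i‖ ≤ B)
    (hH : ∀ k, AnalyticOnNhd ℂ (H k) (ball a R)) (hv : ∀ k, AnalyticOnNhd ℂ (v k) (ball a R))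
    (hv0 : ∀ k, ∀ x ∈ ball a R, v k x ≠ 0)
    (hvt : ∀ δ > 0, ∀ᶠ k in 𝒰, ∀ x ∈ ball a R, ‖v k x‖ ≤ δ)
    (hHC : ∀ᶠ k in 𝒰, ∀ x ∈ ball a R, ‖H k x‖ ≤ CH)
    (hAm : ∀ n, MeromorphicAt (A n) a)
    (hA : ∀ n, ∀ x ∈ ball a R, x ≠ a → AnalyticAt ℂ (A n) x)
    (happrox : ∀ n, ∀ r ∈ Ioo 0 R, ∃ C, ∀ᶠ k in 𝒰, ∀ x ∈ sphere a r,
      ‖H k x - (∏ i, (x - b k i)) *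
        ∑ j ∈ Finset.range n, A j x * ((∏ i, (x - c k i)) * v k x) ^ j‖ ≤ C * ‖v k x‖ ^ n) :
    ∃ K : ℕ, 1 ≤ K ∧ ∀ n : ℕ, -((K * (n + 1) : ℕ) : ℤ) ≤ meromorphicOrderAt (A n) a := by
  classical
  have haR : a ∈ ball a R := mem_ball_self hR
  have ht0 : ∀ k, 0 < ‖v k a‖ := fun k => norm_pos_iff.2 (hv0 k a haR)
  have ht1 : ∀ᶠ k in 𝒰, ‖v k a‖ ≤ 1 := (hvt 1 one_pos).mono fun k hk => hk a haR
  obtain ⟨I, L₁, hL₁, hI1, hI2⟩ := exists_fast_or_slow 𝒰 b a (fun k => ‖v k a‖) ht1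
  obtain ⟨J, L₂, hL₂, hJ1, hJ2⟩ := exists_fast_or_slow 𝒰 c a (fun k => ‖v k a‖) ht1
  set L := max L₁ L₂ with hLdef
  have hL : 1 ≤ L := hL₁.trans (le_max_left _ _)
  have hIL := hI1 L (le_max_left _ _)
  have hJL := hJ1 L (le_max_right _ _)
  -- the natural scale: `‖v k a‖ = (σ k ^ 2) ^ L`
  have hσex : ∀ k, ∃ σ : ℝ, 0 < σ ∧ ‖v k a‖ = (σ ^ 2) ^ L := fun k => by
    refine ⟨‖v k a‖ ^ ((2 * L : ℕ) : ℝ)⁻¹, Real.rpow_pos_of_pos (ht0 k) _, ?_⟩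
    rw [← pow_mul, Real.rpow_inv_natCast_pow (ht0 k).le (by omega)]
  choose σ hσ0 hσ using hσex
  have hσt : Tendsto σ 𝒰 (𝓝[>] 0) := by
    refine tendsto_nhdsWithin_iff.2 ⟨?_, Eventually.of_forall hσ0⟩
    rw [Metric.tendsto_nhds]
    intro δ hδ
    filter_upwards [hvt (((δ / 2) ^ 2) ^ L) (by positivity)] with k hk
    have h1 := hk a haR
    rw [hσ k] at h1
    have h2 := le_of_pow_le_pow_left₀ (by omega) (by positivity) h1
    have h3 := le_of_pow_le_pow_left₀ two_ne_zero (by positivity) h2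
    rw [Real.dist_eq, sub_zero, abs_of_pos (hσ0 k)]
    linarith
  have hσt0 : Tendsto σ 𝒰 (𝓝 0) := hσt.mono_right nhdsWithin_le_nhds
  have hsmall : ∀ (g : ℝ → ℝ), Tendsto g (𝓝[>] 0) (𝓝 0) → ∀ δ > 0, ∀ᶠ k in 𝒰, g (σ k) ≤ δ :=
    fun g hg δ hδ => ((hg.comp hσt).eventually (eventually_lt_nhds hδ)).mono fun k hk => hk.le
  have hlogt : Tendsto (fun s : ℝ => 8 * L * (-Real.log s * s ^ 2)) (𝓝[>] 0) (𝓝 0) := by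
    have h1 := tendsto_log_mul_rpow_nhdsGT_zero (r := 2) two_pos
    have h2 := h1.const_mul (-(8 * L : ℝ))
    rw [mul_zero] at h2
    refine h2.congr fun s => ?_
    rw [Real.rpow_two]; ring
  have hσp : ∀ p : ℕ, 1 ≤ p → Tendsto (fun s : ℝ => s ^ p) (𝓝[>] 0) (𝓝 0) := fun p hp => by
    have := ((continuous_pow p).tendsto (0 : ℝ)).mono_left (nhdsWithin_le_nhds (s := Ioi 0))
    rwa [zero_pow (by omega)] at this
  have main : ∀ n : ℕ, -(((J.card + L) * n + I.card : ℕ) : ℤ) ≤ meromorphicOrderAt (A n) a := by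
    intro n
    induction n using Nat.strong_induction_on with
    | _ n ih =>
    -- suppose that the pole order of `A n` is `(#J + L) * n + #I + l + 1`
    by_contra hcon
    obtain ⟨l, hl⟩ : ∃ l : ℕ, meromorphicOrderAt (A n) a =
        ((-(((J.card + L) * n + I.card + l + 1 : ℕ) : ℤ) : ℤ) : WithTop ℤ) := by
      cases hord : meromorphicOrderAt (A n) a with
      | top => rw [hord] at hcon; exact absurd le_top hcon
      | coe o =>
        rw [hord] at hcon
        have h1 : o < -(((J.card + L) * n + I.card : ℕ) : ℤ) := by
          by_contra h
          exact hcon (by exact_mod_cast not_lt.1 h)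
        refine ⟨(-o - (((J.card + L) * n + I.card : ℕ) : ℤ) - 1).toNat, ?_⟩
        congr 1
        push_cast
        push_cast at h1
        rw [Int.toNat_of_nonneg (by linarith)]
        ring
    obtain ⟨u, hu, hua, hAu⟩ := (meromorphicOrderAt_eq_int_iff (hAm n)).1 hl
    have hCex : ∀ j : Fin n, ∃ C, 0 ≤ C ∧ ∀ᶠ x in 𝓝[≠] a,
        ‖A j x‖ * ‖x - a‖ ^ ((J.card + L) * j + I.card) ≤ C := fun j =>
      exists_norm_mul_pow_le (hAm j) (ih j j.2)
    choose C hC0 hC using hCex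
    have hCall : ∀ᶠ x in 𝓝[≠] a, ∀ j : Fin n,
        ‖A j x‖ * ‖x - a‖ ^ ((J.card + L) * j + I.card) ≤ C j := eventually_all.2 hC
    have hall := (hAu.and hCall).and (hu.eventually_analyticAt.filter_mono nhdsWithin_le_nhds)
    obtain ⟨r₀, hr₀, hr₀s⟩ := Metric.mem_nhdsWithin_iff.1 hall
    set r := min (r₀ / 2) (R / 8) with hrdef
    have hr : 0 < r := by positivity
    have hrr₀ : r < r₀ := (min_le_left _ _).trans_lt (by linarith)
    have hrR8 : 8 * r ≤ R := by have := min_le_right (r₀ / 2) (R / 8); linarith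
    have hrR : r < R := by linarith
    have hgood : ∀ x, ‖x - a‖ ≤ r → x ≠ a → (A n x = (x - a) ^
        (-(((J.card + L) * n + I.card + l + 1 : ℕ) : ℤ)) • u x ∧ ∀ j : Fin n,
          ‖A j x‖ * ‖x - a‖ ^ ((J.card + L) * j + I.card) ≤ C j) ∧ AnalyticAt ℂ u x :=
      fun x hx hxa => hr₀s ⟨by rw [mem_ball, dist_eq_norm]; linarith, hxa⟩
    obtain ⟨Cn, hCn⟩ := happrox (n + 1) r ⟨hr, hrR⟩
    set CA := ∑ j, C j with hCA
    have hCA0 : 0 ≤ CA := Finset.sum_nonneg fun j _ => hC0 j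
    set Cm := max Cn 0
    -- the leading coefficient of `A n`, times the product of the slow roots, is `O(σ k)`
    obtain ⟨C₁, C₂, hbound⟩ : ∃ C₁ C₂ : ℝ, ∀ᶠ k in 𝒰,
        ‖u a‖ * (‖∏ i ∈ Iᶜ, (a - b k i)‖ * ‖∏ i ∈ Jᶜ, (a - c k i)‖ ^ n) ≤
          C₁ * σ k ^ 2 + C₂ * σ k ^ L * r := by
      refine ⟨(CH + n * (2 ^ I.card * B ^ M * ((2 ^ J.card * B ^ Z * 2) ^ n * CA))) *
        2 ^ (I.card + n * J.card + n), r ^ ((J.card + L) * n + I.card + l) * Cm /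
          ((r / 2) ^ I.card * ((r / 2) ^ J.card) ^ n), ?_⟩
      filter_upwards [hCn, hHC, hIL, hJL, hvt (1 / 2) (by norm_num),
        hsmall _ (hσp 2 one_le_two) r hr, hsmall _ (hσp 2 one_le_two) 1 one_pos,
        hsmall _ hlogt (R * Real.log 2) (mul_pos hR (Real.log_pos (by norm_num)))]
        with k hCnk hHk hIk hJk hvk hσr hσ1 hσl
      have hv1 : ∀ x ∈ ball a R, ‖v k x‖ ≤ 1 := fun x hx => (hvk x hx).trans (by norm_num)
      have hva1 : ‖v k a‖ < 1 := (hvk a haR).trans_lt (by norm_num)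
      have hρ0 : 0 < σ k ^ 2 := by have := hσ0 k; positivity
      have hsph := fun x (hx : x ∈ sphere a (σ k ^ 2)) =>
        norm_le_two_mul_of_mem_sphere hR (hv k) (hv0 k) hv1 (hσ0 k) hva1 (hσ k)
          (by linarith) hσl hx
      refine norm_leading_coeff_mul_le hρ0 hσr hrR hB hσ1 (hb k) (hc k) ?_ ?_ (hH k) (hv k)
        (hv0 k) hHk (fun j _ => hA j) ?_ ?_ hCA0 ?_ (fun x hx => (hsph x hx).1)
        (fun x hx => (hsph x hx).2)
        (fun x hx => norm_le_pow_of_mem_sphere hR (hv k) (hv0 k) hv1 (hσ0 k) hva1 (hσ k) hrR8 hx)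
        (le_max_right _ _) ?_
      · intro i hi
        exact le_of_pow_le_pow_left₀ (by omega) hρ0.le ((hIk i hi).trans_eq (hσ k))
      · intro i hi
        exact le_of_pow_le_pow_left₀ (by omega) hρ0.le ((hJk i hi).trans_eq (hσ k))
      · intro x hx
        rw [mem_closedBall, dist_eq_norm] at hx
        by_cases hxa : x = a
        · rwa [hxa]
        · exact (hgood x hx hxa).2
      · intro x hx
        rw [mem_sphere, dist_eq_norm] at hx
        have hxa : x - a ≠ 0 := norm_pos_iff.1 (hx ▸ hr)
        rw [(hgood x hx.le (sub_ne_zero.1 hxa)).1.1, zpow_neg, zpow_natCast, smul_eq_mul,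
          mul_inv_cancel_left₀ (pow_ne_zero _ hxa)]
      · intro j hj x hx
        rw [mem_sphere, dist_eq_norm] at hx
        have hxa : x - a ≠ 0 := norm_pos_iff.1 (hx ▸ hρ0)
        have := (hgood x (hx.le.trans hσr) (sub_ne_zero.1 hxa)).1.2 ⟨j, hj⟩
        rw [← hx]
        exact this.trans (Finset.single_le_sum (fun j _ => hC0 j) (Finset.mem_univ _))
      · intro x hx
        exact (hCnk x hx).trans (by gcongr; exact le_max_left _ _)
    -- the product of the slow roots is larger than every positive power of `σ k`
    set N := (Iᶜ).card + n * (Jᶜ).card with hN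
    set L' := 2 * L * (N + 1) with hL'
    have hL'1 : 1 ≤ L' := Nat.one_le_iff_ne_zero.2 (by positivity)
    set C₃ := (2 ^ N * ((|C₁| + |C₂| * r) / ‖u a‖)) ^ L' with hC₃
    have hua' : 0 < ‖u a‖ := norm_pos_iff.2 hua
    have hfin : ∀ᶠ k in 𝒰, 1 ≤ C₃ * σ k := by
      filter_upwards [hbound, hI2 L' hL'1, hJ2 L' hL'1, hsmall _ (hσp 1 le_rfl) 1 one_pos]
        with k hk hIk hJk hσ1
      rw [pow_one] at hσ1
      have hs0 := hσ0 k
      set β := ‖∏ i ∈ Iᶜ, (a - b k i)‖ * ‖∏ i ∈ Jᶜ, (a - c k i)‖ ^ n with hβ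
      have h1 := pow_le_norm_prod_of_slow (b k) I a (ht0 k).le hIk
      have h2 := pow_le_norm_prod_of_slow (c k) J a (ht0 k).le hJk
      have h3 : ‖v k a‖ ^ N ≤ (2 ^ N * β) ^ L' := by
        calc ‖v k a‖ ^ N = ‖v k a‖ ^ (Iᶜ).card * (‖v k a‖ ^ (Jᶜ).card) ^ n := by
              rw [hN, pow_add, mul_comm n, pow_mul]
          _ ≤ (2 ^ (Iᶜ).card * ‖∏ i ∈ Iᶜ, (a - b k i)‖) ^ L' *
              ((2 ^ (Jᶜ).card * ‖∏ i ∈ Jᶜ, (a - c k i)‖) ^ L') ^ n := by gcongr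
          _ = _ := by
              have e : ∀ X Y : ℝ, X ^ L' * (Y ^ L') ^ n = (X * Y ^ n) ^ L' := fun X Y => by
                rw [mul_pow, ← pow_mul, ← pow_mul, mul_comm L']
              have e' : (2 : ℝ) ^ N = 2 ^ (Iᶜ).card * (2 ^ (Jᶜ).card) ^ n := by
                rw [hN, pow_add, mul_comm n, pow_mul]
              rw [e, hβ, e', mul_pow (2 ^ (Jᶜ).card : ℝ) _ n]
              congr 1
              generalize (2 ^ (Jᶜ).card : ℝ) = y
              ring
      have h4 : β ≤ (|C₁| + |C₂| * r) / ‖u a‖ * σ k := by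
        rw [div_mul_eq_mul_div, le_div_iff₀ hua', mul_comm]
        have e1 : σ k ^ 2 ≤ σ k := (pow_le_pow_of_le_one hs0.le hσ1 one_le_two).trans_eq (pow_one _)
        have e2 : σ k ^ L ≤ σ k := (pow_le_pow_of_le_one hs0.le hσ1 hL).trans_eq (pow_one _)
        calc _ ≤ C₁ * σ k ^ 2 + C₂ * σ k ^ L * r := hk
          _ ≤ |C₁| * σ k + |C₂| * σ k * r := by
              gcongr
              · exact le_abs_self _
              · exact le_abs_self _
          _ = _ := by ring
      have h5 : ‖v k a‖ ^ N ≤ C₃ * (‖v k a‖ ^ N * σ k) := by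
        calc ‖v k a‖ ^ N ≤ (2 ^ N * β) ^ L' := h3
          _ ≤ (2 ^ N * ((|C₁| + |C₂| * r) / ‖u a‖ * σ k)) ^ L' := by gcongr
          _ = C₃ * σ k ^ L' := by rw [hC₃, ← mul_pow]; ring
          _ = C₃ * (‖v k a‖ ^ N * σ k ^ (2 * L)) := by
              rw [hσ k, hL']; ring
          _ ≤ C₃ * (‖v k a‖ ^ N * σ k) := by
              have : σ k ^ (2 * L) ≤ σ k :=
                (pow_le_pow_of_le_one hs0.le hσ1 (by omega : 1 ≤ 2 * L)).trans_eq (pow_one _)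
              gcongr
      have h6 : 0 < ‖v k a‖ ^ N := pow_pos (ht0 k) _
      by_contra h7
      nlinarith
    -- hence `1 ≤ C₃ * σ k` with `σ k → 0`, a contradiction
    have hlim : Tendsto (fun k => C₃ * σ k) 𝒰 (𝓝 0) := by
      simpa using hσt0.const_mul C₃
    obtain ⟨k, hk1, hk2⟩ := (hfin.and (hlim.eventually (eventually_lt_nhds one_pos))).exists
    exact absurd hk1 (not_le.2 hk2)
  refine ⟨J.card + L + I.card, by omega, fun n => le_trans ?_ (main n)⟩
  have : (J.card + L) * n + I.card ≤ (J.card + L + I.card) * (n + 1) := by nlinarith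
  exact_mod_cast neg_le_neg (Int.ofNat_le.2 this)

/-! ### Extension of the Taylor coefficients to the disc -/

lemma isOpen_annulus (a b : ℝ) : IsOpen (annulus a b) :=
  (isOpen_lt continuous_const continuous_norm).inter (isOpen_lt continuous_norm continuous_const)

lemma annulus_subset_ball (a b : ℝ) : annulus a b ⊆ ball 0 b := fun _ hx => by
  rw [mem_ball_zero_iff]; exact hx.2

/-- The maximum principle, with the bound given on an annulus at the boundary of the disc. -/
lemma norm_le_of_forall_mem_annulus {g : ℂ → ℂ} {s₁ s₂ C : ℝ} (hs : s₁ < s₂)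
    (hg : AnalyticOnNhd ℂ g (ball 0 s₂)) (hC : ∀ x ∈ annulus s₁ s₂, ‖g x‖ ≤ C) :
    ∀ x ∈ ball 0 s₂, ‖g x‖ ≤ C := by
  intro x hx
  rw [mem_ball_zero_iff] at hx
  obtain ⟨t, ht1, ht2⟩ := exists_between (max_lt hs hx)
  have ht0 : 0 < t := (norm_nonneg x).trans_lt ((le_max_right _ _).trans_lt ht1)
  have hsub : closedBall (0 : ℂ) t ⊆ ball 0 s₂ := closedBall_subset_ball ht2
  refine Complex.norm_le_of_forall_mem_frontier_norm_le (U := ball 0 t) isBounded_ball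
    ⟨(hg.differentiableOn.mono (ball_subset_closedBall.trans hsub)), ?_⟩ ?_ ?_
  · rw [closure_ball _ ht0.ne']
    exact hg.continuousOn.mono hsub
  · intro y hy
    rw [frontier_ball _ ht0.ne', mem_sphere_zero_iff_norm] at hy
    exact hC y ⟨by rw [hy]; exact (le_max_left _ _).trans_lt ht1, by rw [hy]; exact ht2⟩
  · refine subset_closure ?_
    rw [mem_ball_zero_iff]
    exact (le_max_right _ _).trans_lt ht1

/-- If functions that are holomorphic on a disc converge uniformly on an annulus at its boundary,
then the limit extends holomorphically to the disc. -/
lemma exists_analyticOnNhd_of_tendstoUniformlyOn {ι : Type*} {p : Filter ι} [p.NeBot]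
    {X : ι → ℂ → ℂ} {G : ℂ → ℂ} {s₁ s₂ : ℝ} (hs : s₁ < s₂)
    (hX : ∀ k, AnalyticOnNhd ℂ (X k) (ball 0 s₂))
    (hG : TendstoUniformlyOn X G p (annulus s₁ s₂)) :
    ∃ g, AnalyticOnNhd ℂ g (ball 0 s₂) ∧ EqOn g G (annulus s₁ s₂) := by
  have hcauchy : UniformCauchySeqOn X p (ball 0 s₂) := by
    intro u hu
    obtain ⟨δ, hδ, hδu⟩ := Metric.mem_uniformity_dist.1 hu
    have h := hG.uniformCauchySeqOn _ (dist_mem_uniformity (half_pos hδ))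
    filter_upwards [h] with m hm x hx
    refine hδu ?_
    rw [dist_eq_norm]
    refine (norm_le_of_forall_mem_annulus (g := fun x => X m.1 x - X m.2 x) hs
      ((hX m.1).sub (hX m.2)) (C := δ / 2) (fun y hy => ?_) x hx).trans_lt (half_lt_self hδ)
    have := hm y hy
    simp only [dist_eq_norm] at this
    exact this.le
  have hlim : ∀ x ∈ ball (0 : ℂ) s₂, ∃ y, Tendsto (fun k => X k x) p (𝓝 y) := fun x hx =>
    cauchy_map_iff_exists_tendsto.1 (hcauchy.cauchy_map hx)
  choose! g hg using hlim
  have hu := hcauchy.tendstoUniformlyOn_of_tendsto hg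
  refine ⟨g, ?_, fun x hx => ?_⟩
  · refine DifferentiableOn.analyticOnNhd ?_ isOpen_ball
    exact hu.tendstoLocallyUniformlyOn.differentiableOn
      (Eventually.of_forall fun k => (hX k).differentiableOn) isOpen_ball
  · exact tendsto_nhds_unique (hg x (annulus_subset_ball _ _ hx)) (hG.tendsto_at hx)

/-- Points converging along an ultrafilter stay away from a compact set that avoids their limits. -/
lemma exists_le_norm_sub {ι : Type*} {p : Filter ι} {n : ℕ} {b : ι → Fin n → ℂ} {b' : Fin n → ℂ}
    (hb : ∀ i, Tendsto (fun k => b k i) p (𝓝 (b' i))) {C : Set ℂ} (hC : IsCompact C)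
    (hCb : ∀ i, b' i ∉ C) : ∃ δ > 0, ∀ᶠ k in p, ∀ x ∈ C, ∀ i, δ ≤ ‖x - b k i‖ := by
  have h1 : ∀ i, ∃ δ > 0, ∀ᶠ k in p, ∀ x ∈ C, δ ≤ ‖x - b k i‖ := by
    intro i
    obtain ⟨d, hd, hdC⟩ := hC.exists_forall_le' (f := fun x => ‖x - b' i‖) (by fun_prop) (a := 0)
      fun x hx => norm_pos_iff.2 (sub_ne_zero.2 fun e => hCb i (e ▸ hx))
    refine ⟨d / 2, half_pos hd, ?_⟩
    filter_upwards [Metric.tendsto_nhds.1 (hb i) (d / 2) (half_pos hd)] with k hk x hx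
    rw [dist_eq_norm] at hk
    have h2 := norm_sub_le_norm_sub_add_norm_sub x (b k i) (b' i)
    have := hdC x hx
    linarith
  choose δ hδ hδC using h1
  obtain ⟨δ', hδ', hle⟩ : ∃ δ' > 0, ∀ i, δ' ≤ δ i := by
    rcases isEmpty_or_nonempty (Fin n) with h | h
    · exact ⟨1, one_pos, fun i => h.elim i⟩
    · obtain ⟨i₀, hi₀⟩ := Finite.exists_min δ
      exact ⟨δ i₀, hδ i₀, hi₀⟩
  refine ⟨δ', hδ', ?_⟩
  filter_upwards [eventually_all.2 hδC] with k hk x hx i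
  exact (hle i).trans (hk i x hx)

lemma norm_prod_sub_le {n : ℕ} {b : Fin n → ℂ} {x : ℂ} {B : ℝ} (h : ∀ i, ‖x - b i‖ ≤ B) :
    ‖∏ i, (x - b i)‖ ≤ B ^ n := by
  rw [norm_prod]
  calc ∏ i, ‖x - b i‖ ≤ ∏ _i : Fin n, B := Finset.prod_le_prod (fun _ _ => norm_nonneg _)
        fun i _ => h i
    _ = B ^ n := by simp

lemma pow_le_norm_prod_sub {n : ℕ} {b : Fin n → ℂ} {x : ℂ} {δ : ℝ} (hδ : 0 ≤ δ)
    (h : ∀ i, δ ≤ ‖x - b i‖) : δ ^ n ≤ ‖∏ i, (x - b i)‖ := by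
  rw [norm_prod]
  calc δ ^ n = ∏ _i : Fin n, δ := by simp
    _ ≤ ∏ i, ‖x - b i‖ := Finset.prod_le_prod (fun _ _ => hδ) fun i _ => h i

/-- Holomorphic functions `H k = P k * f (·, ψ k)` on the disc of radius `s₂`, where
`P k = ∏ (x - b k i)` and `ψ k = ∏ (x - c k i) * v k` with `v k` zero-free, and where `ψ k` tends
to zero along `𝒰`. Over the annulus `s₁ < |x| < s₂`, `f` is given by its Taylor coefficients `A n`
along `{w = 0}`, in the sense of asymptotic expansions. -/
structure IsExpansion {ι : Type*} (𝒰 : Filter ι) {M Z : ℕ} (s₁ s₂ : ℝ) (b : ι → Fin M → ℂ)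
    (c : ι → Fin Z → ℂ) (H v : ι → ℂ → ℂ) (A : ℕ → ℂ → ℂ) : Prop where
  norm_b_le : ∀ k i, ‖b k i‖ ≤ 5
  norm_c_le : ∀ k i, ‖c k i‖ ≤ 5
  analytic_H : ∀ k, AnalyticOnNhd ℂ (H k) (ball 0 s₂)
  analytic_v : ∀ k, AnalyticOnNhd ℂ (v k) (ball 0 s₂)
  v_ne_zero : ∀ k, ∀ x ∈ ball 0 s₂, v k x ≠ 0
  analytic_A : ∀ n, AnalyticOnNhd ℂ (A n) (annulus s₁ s₂)
  bounded_A : ∀ n, ∃ C, ∀ x ∈ annulus s₁ s₂, ‖A n x‖ ≤ C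
  small : ∀ δ > 0, ∀ᶠ k in 𝒰, ∀ x ∈ annulus s₁ s₂, ‖(∏ i, (x - c k i)) * v k x‖ ≤ δ
  approx : ∀ n, ∃ C, ∀ᶠ k in 𝒰, ∀ x ∈ annulus s₁ s₂, ‖H k x - (∏ i, (x - b k i)) *
    ∑ j ∈ Finset.range n, A j x * ((∏ i, (x - c k i)) * v k x) ^ j‖ ≤
      C * ‖(∏ i, (x - c k i)) * v k x‖ ^ n

section Expansion

variable {ι : Type*} {𝒰 : Filter ι} {M Z : ℕ} {s₁ s₂ : ℝ} {b : ι → Fin M → ℂ}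
  {c : ι → Fin Z → ℂ} {H v : ι → ℂ → ℂ} {A : ℕ → ℂ → ℂ}

lemma IsExpansion.mono (h : IsExpansion 𝒰 s₁ s₂ b c H v A) {s₁' s₂' : ℝ} (h1 : s₁ ≤ s₁')
    (h2 : s₂' ≤ s₂) : IsExpansion 𝒰 s₁' s₂' b c H v A := by
  have hA : annulus s₁' s₂' ⊆ annulus s₁ s₂ := fun x hx => ⟨h1.trans_lt hx.1, hx.2.trans_le h2⟩
  have hb := ball_subset_ball (x := (0 : ℂ)) h2
  refine ⟨h.norm_b_le, h.norm_c_le, fun k => (h.analytic_H k).mono hb,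
    fun k => (h.analytic_v k).mono hb, fun k x hx => h.v_ne_zero k x (hb hx),
    fun n => (h.analytic_A n).mono hA, fun n => ?_, fun δ hδ => ?_, fun n => ?_⟩
  · obtain ⟨C, hC⟩ := h.bounded_A n
    exact ⟨C, fun x hx => hC x (hA hx)⟩
  · exact (h.small δ hδ).mono fun k hk x hx => hk x (hA hx)
  · obtain ⟨C, hC⟩ := h.approx n
    exact ⟨C, hC.mono fun k hk x hx => hk x (hA hx)⟩

lemma IsExpansion.norm_sub_b_le (h : IsExpansion 𝒰 s₁ s₂ b c H v A) (hs : s₂ ≤ 1) (k i) {x : ℂ}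
    (hx : x ∈ ball (0 : ℂ) s₂) : ‖x - b k i‖ ≤ 6 := by
  have h1 := norm_sub_le x (b k i)
  have h2 := h.norm_b_le k i
  rw [mem_ball_zero_iff] at hx
  linarith

lemma IsExpansion.norm_sub_c_le (h : IsExpansion 𝒰 s₁ s₂ b c H v A) (hs : s₂ ≤ 1) (k i) {x : ℂ}
    (hx : x ∈ ball (0 : ℂ) s₂) : ‖x - c k i‖ ≤ 6 := by
  have h1 := norm_sub_le x (c k i)
  have h2 := h.norm_c_le k i
  rw [mem_ball_zero_iff] at hx
  linarith

lemma IsExpansion.approx' (h : IsExpansion 𝒰 s₁ s₂ b c H v A) (hs : s₂ ≤ 1) (n : ℕ) :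
    ∃ C, 0 ≤ C ∧ ∀ᶠ k in 𝒰, ∀ x ∈ annulus s₁ s₂, ‖H k x - (∏ i, (x - b k i)) *
      ∑ j ∈ Finset.range n, A j x * ((∏ i, (x - c k i)) * v k x) ^ j‖ ≤ C * ‖v k x‖ ^ n := by
  obtain ⟨C, hC⟩ := h.approx n
  refine ⟨max C 0 * (6 ^ Z) ^ n, by positivity, hC.mono fun k hk x hx => (hk x hx).trans ?_⟩
  have hQ := norm_prod_sub_le fun i => h.norm_sub_c_le hs k i (annulus_subset_ball _ _ hx)
  rw [norm_mul, mul_pow, mul_assoc]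
  gcongr
  exact le_max_left _ _

/-- The maximum principle for the remainders of the expansion, once the coefficients have been
extended to the disc after multiplication by the polynomial function `D`. -/
lemma IsExpansion.norm_remainder_le (h : IsExpansion 𝒰 s₁ s₂ b c H v A) (hs₁ : s₁ < s₂)
    (hs : s₂ ≤ 1) {D : ℂ → ℂ} (hD : AnalyticOnNhd ℂ D (ball 0 s₂))
    (hDb : ∃ C, ∀ x ∈ ball (0 : ℂ) s₂, ‖D x‖ ≤ C) (n : ℕ)
    {g : ℕ → ℂ → ℂ} (hg : ∀ j < n, AnalyticOnNhd ℂ (g j) (ball 0 s₂))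
    (hgA : ∀ j < n, ∀ x ∈ annulus s₁ s₂, g j x = D x * A j x) :
    ∃ C, ∀ᶠ k in 𝒰, ∀ x ∈ ball 0 s₂, ‖D x * H k x - (∏ i, (x - b k i)) *
      ∑ j ∈ Finset.range n, g j x * ((∏ i, (x - c k i)) * v k x) ^ j‖ ≤ C * ‖v k x‖ ^ n := by
  obtain ⟨C, hC0, hC⟩ := h.approx' hs n
  obtain ⟨CD, hCD⟩ := hDb
  refine ⟨max CD 0 * C, hC.mono fun k hk => ?_⟩
  set T : ℂ → ℂ := fun x => D x * H k x - (∏ i, (x - b k i)) *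
      ∑ j ∈ Finset.range n, g j x * ((∏ i, (x - c k i)) * v k x) ^ j with hT
  have hTan : AnalyticOnNhd ℂ (fun x => T x / v k x ^ n) (ball 0 s₂) := by
    intro x hx
    have hsum : AnalyticAt ℂ (fun x => ∑ j ∈ Finset.range n,
        g j x * ((∏ i, (x - c k i)) * v k x) ^ j) x := by
      refine Finset.analyticAt_fun_sum _ fun j hj => ?_
      refine (hg j (Finset.mem_range.1 hj) x hx).mul (AnalyticAt.pow (AnalyticAt.mul ?_
        (h.analytic_v k x hx)) j)
      exact Finset.analyticAt_fun_prod _ fun i _ => analyticAt_id.sub analyticAt_const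
    refine AnalyticAt.div (((hD x hx).mul (h.analytic_H k x hx)).sub (AnalyticAt.mul ?_ hsum))
      ((h.analytic_v k x hx).pow n) (pow_ne_zero _ (h.v_ne_zero k x hx))
    exact Finset.analyticAt_fun_prod _ fun i _ => analyticAt_id.sub analyticAt_const
  intro x hx
  have key := norm_le_of_forall_mem_annulus hs₁ hTan (C := max CD 0 * C) (fun y hy => ?_) x hx
  · rwa [norm_div, norm_pow, div_le_iff₀ (pow_pos (norm_pos_iff.2 (h.v_ne_zero k x hx)) _)] at key
  · have hyb := annulus_subset_ball _ _ hy
    rw [norm_div, norm_pow, div_le_iff₀ (pow_pos (norm_pos_iff.2 (h.v_ne_zero k y hyb)) _)]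
    have e : T y = D y * (H k y - (∏ i, (y - b k i)) *
        ∑ j ∈ Finset.range n, A j y * ((∏ i, (y - c k i)) * v k y) ^ j) := by
      rw [hT, mul_sub]
      simp only
      congr 1
      rw [mul_left_comm, Finset.mul_sum (Finset.range n) _ (D y)]
      congr 1
      refine Finset.sum_congr rfl fun j hj => ?_
      rw [hgA j (Finset.mem_range.1 hj) y hy, mul_assoc]
    rw [e, norm_mul, mul_assoc]
    exact mul_le_mul ((hCD y hyb).trans (le_max_left _ _)) (hk y hy) (norm_nonneg _)
      (le_max_right _ _)

end Expansion

lemma isCompact_closedAnnulus (s₁ s₂ : ℝ) : IsCompact {x : ℂ | s₁ ≤ ‖x‖ ∧ ‖x‖ ≤ s₂} := by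
  refine (isCompact_closedBall (0 : ℂ) s₂).of_isClosed_subset
    ((isClosed_le continuous_const continuous_norm).inter
      (isClosed_le continuous_norm continuous_const)) fun x hx => ?_
  rw [mem_closedBall_zero_iff]
  exact hx.2

section Limit

variable {ι : Type*} {𝒰 : Filter ι} {M Z : ℕ} {s₁ s₂ : ℝ} {b : ι → Fin M → ℂ}
  {c : ι → Fin Z → ℂ} {H v : ι → ℂ → ℂ} {A : ℕ → ℂ → ℂ} {b' : Fin M → ℂ} {c' : Fin Z → ℂ}

/-- If the roots of `Q k` stay away from the annulus then the zero-free factors `v k` tend to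
zero uniformly on the disc. -/
lemma IsExpansion.v_small (h : IsExpansion 𝒰 s₁ s₂ b c H v A) (hs₁ : s₁ < s₂)
    (hc : ∀ i, Tendsto (fun k => c k i) 𝒰 (𝓝 (c' i)))
    (hcs : ∀ i, ¬(s₁ ≤ ‖c' i‖ ∧ ‖c' i‖ ≤ s₂)) {δ : ℝ} (hδ : 0 < δ) :
    ∀ᶠ k in 𝒰, ∀ x ∈ ball 0 s₂, ‖v k x‖ ≤ δ := by
  obtain ⟨d, hd, hdc⟩ := exists_le_norm_sub hc (isCompact_closedAnnulus s₁ s₂) hcs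
  filter_upwards [hdc, h.small (d ^ Z * δ) (by positivity)] with k hk1 hk2
  refine norm_le_of_forall_mem_annulus hs₁ (h.analytic_v k) fun x hx => ?_
  have h1 := hk2 x hx
  have h2 := pow_le_norm_prod_sub hd.le (hk1 x ⟨hx.1.le, hx.2.le⟩)
  rw [norm_mul] at h1
  have h3 : d ^ Z * ‖v k x‖ ≤ d ^ Z * δ :=
    (mul_le_mul_of_nonneg_right h2 (norm_nonneg _)).trans h1
  exact le_of_mul_le_mul_left h3 (by positivity)

/-- The Taylor coefficients extend meromorphically to the disc, with poles only at limits of the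
roots: after multiplication by a power of `∏ (x - b' i) * ∏ (x - c' i)` the coefficient of order
`n` is the limit of holomorphic functions on the disc. -/
lemma IsExpansion.exists_numerator [𝒰.NeBot] (h : IsExpansion 𝒰 s₁ s₂ b c H v A) (hs₁ : s₁ < s₂)
    (hs : s₂ ≤ 1) (hb : ∀ i, Tendsto (fun k => b k i) 𝒰 (𝓝 (b' i)))
    (hc : ∀ i, Tendsto (fun k => c k i) 𝒰 (𝓝 (c' i)))
    (hcs : ∀ i, ¬(s₁ ≤ ‖c' i‖ ∧ ‖c' i‖ ≤ s₂)) (n : ℕ) :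
    ∃ (e : ℕ) (g : ℂ → ℂ), AnalyticOnNhd ℂ g (ball 0 s₂) ∧ ∀ x ∈ annulus s₁ s₂,
      g x = ((∏ i, (x - b' i)) * ∏ i, (x - c' i)) ^ e * A n x := by
  induction n using Nat.strong_induction_on with
  | _ n ih =>
  choose! e g hg hgA using ih
  set D : ℂ → ℂ := fun x => (∏ i, (x - b' i)) * ∏ i, (x - c' i) with hD
  have hDan : ∀ x, AnalyticAt ℂ D x := fun x => AnalyticAt.mul
    (Finset.analyticAt_fun_prod _ fun i _ => analyticAt_id.sub analyticAt_const)
    (Finset.analyticAt_fun_prod _ fun i _ => analyticAt_id.sub analyticAt_const)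
  have hDc : Continuous D := by fun_prop
  set E := ∑ j ∈ Finset.range n, e j with hE
  have hEj : ∀ j < n, e j ≤ E := fun j hj =>
    Finset.single_le_sum (fun _ _ => Nat.zero_le _) (Finset.mem_range.2 hj)
  set g' : ℕ → ℂ → ℂ := fun j x => D x ^ (E - e j) * g j x with hg'
  have hg'an : ∀ j < n, AnalyticOnNhd ℂ (g' j) (ball 0 s₂) := fun j hj x hx =>
    ((hDan x).pow _).mul (hg j hj x hx)
  have hg'A : ∀ j < n, ∀ x ∈ annulus s₁ s₂, g' j x = D x ^ E * A j x := fun j hj x hx => by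
    rw [hg']
    simp only
    rw [hgA j hj x hx, ← mul_assoc, ← pow_add, Nat.sub_add_cancel (hEj j hj)]
  -- the remainder of order `n`, multiplied by `D ^ E` to remove the poles of the lower coefficients,
  -- is holomorphic on the disc even after division by the zero-free `v k ^ n`
  let X : ι → ℂ → ℂ := fun k x => (D x ^ E * H k x - (∏ i, (x - b k i)) *
      ∑ j ∈ Finset.range n, g' j x * ((∏ i, (x - c k i)) * v k x) ^ j) / v k x ^ n
  have hXan : ∀ k, AnalyticOnNhd ℂ (X k) (ball 0 s₂) := by
    intro k x hx
    have hsum : AnalyticAt ℂ (fun x => ∑ j ∈ Finset.range n,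
        g' j x * ((∏ i, (x - c k i)) * v k x) ^ j) x := by
      refine Finset.analyticAt_fun_sum _ fun j hj => ?_
      refine (hg'an j (Finset.mem_range.1 hj) x hx).mul (AnalyticAt.pow (AnalyticAt.mul ?_
        (h.analytic_v k x hx)) j)
      exact Finset.analyticAt_fun_prod _ fun i _ => analyticAt_id.sub analyticAt_const
    refine AnalyticAt.div
      ((((hDan x).pow E).mul (h.analytic_H k x hx)).sub (AnalyticAt.mul ?_ hsum))
      ((h.analytic_v k x hx).pow n) (pow_ne_zero _ (h.v_ne_zero k x hx))
    exact Finset.analyticAt_fun_prod _ fun i _ => analyticAt_id.sub analyticAt_const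
  let G : ℂ → ℂ := fun x => (∏ i, (x - b' i)) * (∏ i, (x - c' i)) ^ n * (D x ^ E * A n x)
  obtain ⟨CD, hCD⟩ : ∃ C, ∀ x ∈ closedBall (0 : ℂ) s₂, ‖D x ^ E‖ ≤ C :=
    (isCompact_closedBall 0 s₂).exists_bound_of_continuousOn (hDc.pow E).continuousOn
  have hCD' : ∀ x ∈ annulus s₁ s₂, ‖D x ^ E‖ ≤ CD := fun x hx =>
    hCD x (ball_subset_closedBall (annulus_subset_ball _ _ hx))
  obtain ⟨CA, hCA⟩ := h.bounded_A n
  obtain ⟨Cn, hCn0, hCn⟩ := h.approx' hs (n + 1)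
  have hunif : TendstoUniformlyOn X G 𝒰 (annulus s₁ s₂) := by
    rw [Metric.tendstoUniformlyOn_iff]
    intro δ hδ
    -- the polynomials `P k * Q k ^ n` converge uniformly on bounded sets
    have hpoly : ∀ δ > 0, ∀ᶠ k in 𝒰, ∀ x ∈ closedBall (0 : ℂ) s₂,
        ‖(∏ i, (x - b k i)) * (∏ i, (x - c k i)) ^ n -
          (∏ i, (x - b' i)) * (∏ i, (x - c' i)) ^ n‖ < δ := by
      intro δ hδ
      let f : (Fin M → ℂ) × (Fin Z → ℂ) → ℂ → ℂ := fun p x =>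
        (∏ i, (x - p.1 i)) * (∏ i, (x - p.2 i)) ^ n
      have hf : Continuous f.uncurry := by
        simp only [f, Function.uncurry_def]
        fun_prop
      obtain ⟨V, hV, hVd⟩ := (isCompact_closedBall (0 : ℂ) s₂).mem_uniformity_of_prod
        (f := f) (s := univ) (q := (b', c')) hf.continuousOn (mem_univ _) (dist_mem_uniformity hδ)
      rw [nhdsWithin_univ] at hV
      have ht : Tendsto (fun k => (b k, c k)) 𝒰 (𝓝 (b', c')) :=
        (tendsto_pi_nhds.2 hb).prodMk_nhds (tendsto_pi_nhds.2 hc)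
      filter_upwards [ht hV] with k hk x hx
      have := hVd _ hk x hx
      rwa [← dist_eq_norm]
    set δ' := δ / (2 * (|CD| * |CA| + 1)) with hδ'
    have hδ'0 : 0 < δ' := by positivity
    set δ'' := δ / (2 * (|CD| * Cn + 1)) with hδ''
    have hδ''0 : 0 < δ'' := by positivity
    filter_upwards [hpoly δ' hδ'0, hCn, h.v_small hs₁ hc hcs hδ''0] with k hk1 hk2 hk3 x hx
    have hxb := annulus_subset_ball _ _ hx
    have hv0 := h.v_ne_zero k x hxb
    -- on the annulus `X k` is close to `P k * Q k ^ n * D ^ E * A n`, by the expansion of order `n + 1`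
    have e1 : X k x - (∏ i, (x - b k i)) * (∏ i, (x - c k i)) ^ n * (D x ^ E * A n x) =
        D x ^ E * ((H k x - (∏ i, (x - b k i)) *
          ∑ j ∈ Finset.range (n + 1), A j x * ((∏ i, (x - c k i)) * v k x) ^ j) / v k x ^ n) := by
      have hsum : ∑ j ∈ Finset.range n, g' j x * ((∏ i, (x - c k i)) * v k x) ^ j =
          D x ^ E * ∑ j ∈ Finset.range n, A j x * ((∏ i, (x - c k i)) * v k x) ^ j := by
        rw [Finset.mul_sum]
        refine Finset.sum_congr rfl fun j hj => ?_
        rw [hg'A j (Finset.mem_range.1 hj) x hx, mul_assoc]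
      simp only [X]
      rw [hsum, Finset.sum_range_succ, mul_div_assoc', eq_div_iff (pow_ne_zero _ hv0), sub_mul,
        div_mul_cancel₀ _ (pow_ne_zero _ hv0), mul_pow]
      ring
    have b1 : ‖X k x - (∏ i, (x - b k i)) * (∏ i, (x - c k i)) ^ n * (D x ^ E * A n x)‖ ≤
        |CD| * (Cn * δ'') := by
      rw [e1, norm_mul]
      refine mul_le_mul ((hCD' x hx).trans (le_abs_self _)) ?_ (norm_nonneg _) (abs_nonneg _)
      rw [norm_div, norm_pow, div_le_iff₀ (pow_pos (norm_pos_iff.2 hv0) _)]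
      refine (hk2 x hx).trans ?_
      rw [pow_succ, mul_comm (‖v k x‖ ^ n), ← mul_assoc]
      gcongr
      exact hk3 x hxb
    have b2 : ‖(∏ i, (x - b k i)) * (∏ i, (x - c k i)) ^ n * (D x ^ E * A n x) - G x‖ ≤
        δ' * (|CD| * |CA|) := by
      simp only [G]
      rw [← sub_mul, norm_mul, norm_mul (D x ^ E)]
      refine mul_le_mul (hk1 x (ball_subset_closedBall hxb)).le ?_ (by positivity) hδ'0.le
      exact mul_le_mul ((hCD' x hx).trans (le_abs_self _)) ((hCA x hx).trans (le_abs_self _))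
        (norm_nonneg _) (abs_nonneg _)
    rw [dist_comm, dist_eq_norm]
    have b3 : |CD| * (Cn * δ'') < δ / 2 := by
      rw [hδ'', mul_div_assoc', mul_div_assoc', div_lt_iff₀ (by positivity)]
      nlinarith
    have b4 : δ' * (|CD| * |CA|) ≤ δ / 2 := by
      rw [hδ', div_mul_eq_mul_div, div_le_iff₀ (by positivity)]
      nlinarith
    calc ‖X k x - G x‖ ≤ _ := norm_sub_le_norm_sub_add_norm_sub _
          ((∏ i, (x - b k i)) * (∏ i, (x - c k i)) ^ n * (D x ^ E * A n x)) _
      _ < δ := by linarith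
  obtain ⟨γ, hγ, hγG⟩ := exists_analyticOnNhd_of_tendstoUniformlyOn hs₁ hXan hunif
  refine ⟨n + 1 + E, fun x => (∏ i, (x - b' i)) ^ n * (∏ i, (x - c' i)) * γ x, ?_, ?_⟩
  · intro x hx
    refine AnalyticAt.mul (AnalyticAt.mul (AnalyticAt.pow ?_ n) ?_) (hγ x hx)
    · exact Finset.analyticAt_fun_prod _ fun i _ => analyticAt_id.sub analyticAt_const
    · exact Finset.analyticAt_fun_prod _ fun i _ => analyticAt_id.sub analyticAt_const
  · intro x hx
    simp only
    rw [hγG hx]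
    simp only [G, hD]
    rw [pow_add, mul_pow _ _ (n + 1)]
    ring

end Limit

/-- A finite set of radii leaves room for an annulus. -/
lemma exists_annulus_avoiding {s₁ s₂ : ℝ} (hs : s₁ < s₂) {T : Set ℝ} (hT : T.Finite) :
    ∃ s₁' s₂', s₁ < s₁' ∧ s₁' < s₂' ∧ s₂' < s₂ ∧ ∀ t ∈ T, ¬(s₁' ≤ t ∧ t ≤ s₂') := by
  obtain ⟨s, hs1, hsT⟩ := ((Ioo_infinite hs).sdiff hT).nonempty
  have hev : ∀ᶠ t in 𝓝 s, t ∈ Ioo s₁ s₂ ∩ Tᶜ :=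
    (isOpen_Ioo.inter hT.isClosed.isOpen_compl).mem_nhds ⟨hs1, hsT⟩
  obtain ⟨δ, hδ, hδT⟩ := Metric.eventually_nhds_iff_ball.1 hev
  have hmem : ∀ t, |t - s| < δ → t ∈ Ioo s₁ s₂ ∩ Tᶜ := fun t ht =>
    hδT t (by rwa [mem_ball, Real.dist_eq])
  have h2 : |δ / 2| < δ := by rw [abs_of_pos (half_pos hδ)]; linarith
  refine ⟨s - δ / 2, s + δ / 2, (hmem _ ?_).1.1, by linarith, (hmem _ ?_).1.2, fun t ht hst => ?_⟩
  · rwa [show s - δ / 2 - s = -(δ / 2) by ring, abs_neg]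
  · rwa [show s + δ / 2 - s = δ / 2 by ring]
  · exact (hmem t (by rw [abs_lt]; constructor <;> linarith [hst.1, hst.2])).2 ht

lemma exists_tendsto_of_norm_le {ι : Type*} (𝒰 : Ultrafilter ι) {b : ι → ℂ} {C : ℝ}
    (hb : ∀ k, ‖b k‖ ≤ C) : ∃ b', Tendsto b 𝒰 (𝓝 b') := by
  obtain ⟨b', -, h⟩ := (isCompact_closedBall (0 : ℂ) C).ultrafilter_le_nhds (𝒰.map b) (by
    rw [le_principal_iff]
    show ∀ᶠ k in (𝒰 : Filter ι), b k ∈ closedBall 0 C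
    exact Eventually.of_forall fun k => mem_closedBall_zero_iff.2 (hb k))
  exact ⟨b', h⟩

/-- The Taylor coefficients extend meromorphically to a disc, with finitely many poles, of an order
that grows at most linearly: the content of the theorem for one complex variable. -/
theorem IsExpansion.exists_pole_bound {ι : Type*} {𝒰 : Ultrafilter ι} {M Z : ℕ} {s₁ s₂ : ℝ}
    {b : ι → Fin M → ℂ} {c : ι → Fin Z → ℂ} {H v : ι → ℂ → ℂ} {A : ℕ → ℂ → ℂ}
    (h : IsExpansion (𝒰 : Filter ι) s₁ s₂ b c H v A) (hs₁ : s₁ < s₂) (hs : s₂ ≤ 1) :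
    ∃ s₁' s₂', s₁ < s₁' ∧ s₁' < s₂' ∧ s₂' < s₂ ∧ ∃ (Λ : Finset ℂ) (K : ℕ),
      (Λ : Set ℂ) ⊆ ball 0 s₁' ∧ 1 ≤ K ∧ ∀ n, ∃ g, AnalyticOnNhd ℂ g (ball 0 s₂') ∧
        ∀ x ∈ annulus s₁' s₂', g x = (∏ a ∈ Λ, (x - a)) ^ (K * (n + 1)) * A n x := by
  classical
  choose b' hb using fun i => exists_tendsto_of_norm_le 𝒰 fun k => h.norm_b_le k i
  choose c' hc using fun i => exists_tendsto_of_norm_le 𝒰 fun k => h.norm_c_le k i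
  set T : Finset ℂ := Finset.univ.image b' ∪ Finset.univ.image c' with hT
  obtain ⟨r₁, r₂, hr1, hr12, hr2, hrT⟩ := exists_annulus_avoiding hs₁
    (T := (fun x : ℂ => ‖x‖) '' (T : Set ℂ)) (T.finite_toSet.image _)
  have hTb : ∀ i, b' i ∈ T := fun i => Finset.mem_union_left _ (Finset.mem_image_of_mem _ (by simp))
  have hTc : ∀ i, c' i ∈ T := fun i =>
    Finset.mem_union_right _ (Finset.mem_image_of_mem _ (by simp))
  have hcs : ∀ i, ¬(r₁ ≤ ‖c' i‖ ∧ ‖c' i‖ ≤ r₂) := fun i => hrT _ ⟨_, hTc i, rfl⟩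
  have hE := h.mono hr1.le hr2.le
  have hr21 : r₂ ≤ 1 := hr2.le.trans hs
  refine ⟨r₁, r₂, hr1, hr12, hr2, ?_⟩
  -- an annulus free of limit roots; those inside it are the only possible poles
  set Λ := T.filter fun x => ‖x‖ < r₁ with hΛ
  set D : ℂ → ℂ := fun x => (∏ i, (x - b' i)) * ∏ i, (x - c' i) with hD
  have hDan : ∀ x, AnalyticAt ℂ D x := fun x => AnalyticAt.mul
    (Finset.analyticAt_fun_prod _ fun i _ => analyticAt_id.sub analyticAt_const)
    (Finset.analyticAt_fun_prod _ fun i _ => analyticAt_id.sub analyticAt_const)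
  have hDc : Continuous D := by fun_prop
  have hD0 : ∀ x ∈ ball (0 : ℂ) r₂, x ∉ Λ → D x ≠ 0 := by
    intro x hx hxΛ hDx
    have hxT : x ∈ T := by
      rcases mul_eq_zero.1 hDx with h0 | h0
      · obtain ⟨i, -, hi⟩ := Finset.prod_eq_zero_iff.1 h0
        exact sub_eq_zero.1 hi ▸ hTb i
      · obtain ⟨i, -, hi⟩ := Finset.prod_eq_zero_iff.1 h0
        exact sub_eq_zero.1 hi ▸ hTc i
    rw [mem_ball_zero_iff] at hx
    refine hxΛ (Finset.mem_filter.2 ⟨hxT, ?_⟩)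
    by_contra hcon
    exact hrT _ ⟨x, hxT, rfl⟩ ⟨not_lt.1 hcon, hx.le⟩
  have hann : ∀ x ∈ annulus r₁ r₂, D x ≠ 0 := fun x hx =>
    hD0 x (annulus_subset_ball _ _ hx) fun hxΛ =>
      absurd (Finset.mem_filter.1 hxΛ).2 (not_lt.2 hx.1.le)
  choose e g hg hgA using hE.exists_numerator hr12 hr21 hb hc hcs
  -- the meromorphic extensions of the Taylor coefficients
  set A' : ℕ → ℂ → ℂ := fun n x => g n x / D x ^ e n with hA'
  have hA'A : ∀ n, ∀ x ∈ annulus r₁ r₂, A' n x = A n x := fun n x hx => by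
    simp only [hA']
    rw [hgA n x hx, mul_div_cancel_left₀ _ (pow_ne_zero _ (hann x hx))]
  have hA'mer : ∀ n, MeromorphicOn (A' n) (ball 0 r₂) := fun n x hx =>
    (hg n x hx).meromorphicAt.div ((hDan x).pow _).meromorphicAt
  have hA'an : ∀ n, ∀ x ∈ ball (0 : ℂ) r₂, x ∉ Λ → AnalyticAt ℂ (A' n) x := fun n x hx hxΛ =>
    (hg n x hx).div ((hDan x).pow _) (pow_ne_zero _ (hD0 x hx hxΛ))
  have hDpow : ∀ E : ℕ, ∃ C, ∀ x ∈ ball (0 : ℂ) r₂, ‖D x ^ E‖ ≤ C := fun E => by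
    obtain ⟨C, hC⟩ := (isCompact_closedBall (0 : ℂ) r₂).exists_bound_of_continuousOn
      (hDc.pow E).continuousOn
    exact ⟨C, fun x hx => hC x (ball_subset_closedBall hx)⟩
  -- the local bound at each pole; its hypotheses follow from the maximum principle
  have hlocal : ∀ a ∈ Λ, ∃ K : ℕ, 1 ≤ K ∧
      ∀ n : ℕ, -((K * (n + 1) : ℕ) : ℤ) ≤ meromorphicOrderAt (A' n) a := by
    intro a ha
    have haball : a ∈ ball (0 : ℂ) r₂ := by
      rw [mem_ball_zero_iff]
      exact (Finset.mem_filter.1 ha).2.trans hr12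
    have hev : ∀ᶠ x in 𝓝 a, x ∈ ball (0 : ℂ) r₂ ∩ ((Λ.erase a : Finset ℂ) : Set ℂ)ᶜ :=
      (isOpen_ball.inter (Finset.finite_toSet _).isClosed.isOpen_compl).mem_nhds
        ⟨haball, by simp⟩
    obtain ⟨R, hR, hRb⟩ := Metric.eventually_nhds_iff_ball.1 hev
    have hRball : ball a R ⊆ ball 0 r₂ := fun x hx => (hRb x hx).1
    have hRΛ : ∀ x ∈ ball a R, x ≠ a → x ∉ Λ := fun x hx hxa hxΛ =>
      (hRb x hx).2 (Finset.mem_coe.2 (Finset.mem_erase.2 ⟨hxa, hxΛ⟩))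
    obtain ⟨CH, hCH⟩ := hE.norm_remainder_le hr12 hr21 (D := fun _ => 1)
      (fun _ _ => analyticAt_const) ⟨1, fun _ _ => by simp⟩ 0 (g := fun _ _ => 0)
      (by simp) (by simp)
    refine exists_order_bound 𝒰 (B := 6) (CH := CH) hR (by norm_num)
      (fun k i x hx => hE.norm_sub_b_le hr21 k i (hRball hx))
      (fun k i x hx => hE.norm_sub_c_le hr21 k i (hRball hx))
      (fun k => (hE.analytic_H k).mono hRball) (fun k => (hE.analytic_v k).mono hRball)
      (fun k x hx => hE.v_ne_zero k x (hRball hx))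
      (fun δ hδ => (hE.v_small hr12 hc hcs hδ).mono fun k hk x hx => hk x (hRball hx))
      (hCH.mono fun k hk x hx => by simpa using hk x (hRball hx))
      (fun n => hA'mer n a haball) (fun n x hx hxa => hA'an n x (hRball hx) (hRΛ x hx hxa)) ?_
    intro n r hr
    have hsph : ∀ x ∈ sphere a r, x ∈ ball a R ∧ x ≠ a := fun x hx =>
      ⟨sphere_subset_closedBall.trans (closedBall_subset_ball hr.2) hx,
        ne_of_mem_sphere hx hr.1.ne'⟩
    set E := ∑ j ∈ Finset.range n, e j with hEdef
    have hEj : ∀ j < n, e j ≤ E := fun j hj =>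
      Finset.single_le_sum (fun _ _ => Nat.zero_le _) (Finset.mem_range.2 hj)
    obtain ⟨C, hC⟩ := hE.norm_remainder_le hr12 hr21 (D := fun x => D x ^ E)
      (fun x _ => (hDan x).pow E) (hDpow E) n (g := fun j x => D x ^ (E - e j) * g j x)
      (fun j hj x hx => ((hDan x).pow _).mul (hg j x hx)) (fun j hj x hx => by
        rw [hgA j x hx, ← mul_assoc, ← pow_add, Nat.sub_add_cancel (hEj j hj)])
    obtain ⟨d, hd, hdD⟩ := (isCompact_sphere a r).exists_forall_le' (f := fun x => ‖D x ^ E‖)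
      (hDc.pow E).norm.continuousOn (a := 0) fun x hx =>
        norm_pos_iff.2 (pow_ne_zero _ (hD0 x (hRball (hsph x hx).1)
          (hRΛ x (hsph x hx).1 (hsph x hx).2)))
    refine ⟨C / d, hC.mono fun k hk x hx => ?_⟩
    have hx1 := hRball (hsph x hx).1
    have hDx := hD0 x hx1 (hRΛ x (hsph x hx).1 (hsph x hx).2)
    have e1 : D x ^ E * H k x - (∏ i, (x - b k i)) * ∑ j ∈ Finset.range n,
        D x ^ (E - e j) * g j x * ((∏ i, (x - c k i)) * v k x) ^ j = D x ^ E * (H k x -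
          (∏ i, (x - b k i)) * ∑ j ∈ Finset.range n, A' j x *
            ((∏ i, (x - c k i)) * v k x) ^ j) := by
      rw [mul_sub, mul_left_comm, Finset.mul_sum (Finset.range n) _ (D x ^ E)]
      congr 2
      refine Finset.sum_congr rfl fun j hj => ?_
      simp only [hA']
      have e2 : D x ^ E = D x ^ (E - e j) * D x ^ e j := by
        rw [← pow_add, Nat.sub_add_cancel (hEj j (Finset.mem_range.1 hj))]
      rw [e2, ← mul_assoc, mul_assoc (D x ^ (E - e j)) (D x ^ e j),
        mul_div_cancel₀ _ (pow_ne_zero _ hDx)]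
    have h1 := hk x hx1
    rw [e1, norm_mul] at h1
    rw [div_mul_eq_mul_div, le_div_iff₀ hd, mul_comm]
    exact (mul_le_mul_of_nonneg_right (hdD x hx) (norm_nonneg _)).trans h1
  choose! κ hκ1 hκ using hlocal
  set K := 1 + ∑ a ∈ Λ, κ a with hK
  refine ⟨Λ, K, fun x hx => ?_, by omega, fun n => ?_⟩
  · rw [mem_ball_zero_iff]
    exact (Finset.mem_filter.1 hx).2
  set Bf : ℂ → ℂ := fun x => ∏ a ∈ Λ, (x - a) with hBf
  have hBan : ∀ x, AnalyticAt ℂ Bf x := fun x =>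
    Finset.analyticAt_fun_prod _ fun i _ => analyticAt_id.sub analyticAt_const
  -- the powers of `∏ (x - a)` remove all the poles
  have hord : ∀ x ∈ ball (0 : ℂ) r₂,
      0 ≤ meromorphicOrderAt (fun x => Bf x ^ (K * (n + 1)) * A' n x) x := by
    intro x hx
    by_cases hxΛ : x ∈ Λ
    · have h1 : meromorphicOrderAt (fun x => Bf x ^ (K * (n + 1)) * A' n x) x =
          meromorphicOrderAt (fun x => Bf x ^ (K * (n + 1))) x + meromorphicOrderAt (A' n) x :=
        meromorphicOrderAt_mul ((hBan x).pow _).meromorphicAt (hA'mer n x hx)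
      have hBp : AnalyticAt ℂ (fun x => Bf x ^ (K * (n + 1))) x := (hBan x).pow _
      have h2 : ((K * (n + 1) : ℕ) : WithTop ℤ) ≤
          meromorphicOrderAt (fun x => Bf x ^ (K * (n + 1))) x := by
        have h3 : ((K * (n + 1) : ℕ) : ℕ∞) ≤ analyticOrderAt (fun x => Bf x ^ (K * (n + 1))) x := by
          rw [natCast_le_analyticOrderAt hBp]
          refine ⟨fun y => (∏ a ∈ Λ.erase x, (y - a)) ^ (K * (n + 1)), ?_,
            Eventually.of_forall fun y => ?_⟩
          · exact (Finset.analyticAt_fun_prod _ fun i _ =>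
              analyticAt_id.sub analyticAt_const).pow _
          · simp only [hBf]
            rw [← Finset.mul_prod_erase Λ _ hxΛ, mul_pow, smul_eq_mul]
        rw [AnalyticAt.meromorphicOrderAt_eq hBp]
        generalize analyticOrderAt (fun x => Bf x ^ (K * (n + 1))) x = o at h3
        cases o with
        | top => simp
        | coe o =>
          have h3' : K * (n + 1) ≤ o := by exact_mod_cast h3
          simpa using h3'
      have h4 : κ x * (n + 1) ≤ K * (n + 1) := by
        have := Finset.single_le_sum (f := κ) (fun _ _ => Nat.zero_le _) hxΛ
        exact Nat.mul_le_mul_right _ (by omega)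
      have h5 := hκ x hxΛ n
      rw [h1]
      calc (0 : WithTop ℤ) ≤ ((K * (n + 1) : ℕ) : WithTop ℤ) +
            ((-((κ x * (n + 1) : ℕ) : ℤ) : ℤ) : WithTop ℤ) := by
            have : (0 : ℤ) ≤ ((K * (n + 1) : ℕ) : ℤ) + -((κ x * (n + 1) : ℕ) : ℤ) := by
              have : ((κ x * (n + 1) : ℕ) : ℤ) ≤ ((K * (n + 1) : ℕ) : ℤ) := by exact_mod_cast h4
              linarith
            exact WithTop.coe_nonneg.2 this
        _ ≤ _ := add_le_add h2 h5
    · exact (((hBan x).pow _).mul (hA'an n x hx hxΛ)).meromorphicOrderAt_nonneg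
  obtain ⟨G, hG, hGeq⟩ := exists_analyticOnNhd_of_order_nonneg
    (fun x hx => (((hBan x).pow _).meromorphicAt).mul (hA'mer n x hx)) hord
  refine ⟨G, hG, fun x hx => ?_⟩
  have hxb := annulus_subset_ball _ _ hx
  have hxΛ : x ∉ Λ := fun hxΛ => absurd (Finset.mem_filter.1 hxΛ).2 (not_lt.2 hx.1.le)
  have := (eqOn_of_eventuallyEq_nhdsNE (hG x hxb)
    (((hBan x).pow _).mul (hA'an n x hxb hxΛ)) (hGeq x hxb)).self_of_nhds
  rw [this, ← hA'A n x hx]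
  rfl

/-! ### Graphs to which the restriction is not well defined -/

/-- Near a generic point of a graph that is contained in the zero set of `h`, the graph is all of
this zero set. -/
lemma eventually_zero_set_eq_graph {h : ℂ × ℂ → ℂ} {γ : ℂ → ℂ} {l₀ : ℂ} (hγ : AnalyticAt ℂ γ l₀)
    (hh : AnalyticAt ℂ h (l₀, γ l₀)) (hne : ∃ᶠ q in 𝓝 (l₀, γ l₀), h q ≠ 0) :
    ∀ᶠ l in 𝓝[≠] l₀, ∀ᶠ p in 𝓝 (l, γ l), h p = 0 → p.2 = γ p.1 := by
  have hmap : ∀ l, ContinuousAt γ l →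
      Filter.map (fun p : ℂ × ℂ => (p.1, p.2 + γ p.1)) (𝓝 (l, 0)) = 𝓝 (l, γ l) := fun l hl => by
    rw [map_shear_nhds hl, zero_add]
  have h1 : AnalyticAt ℂ (fun p : ℂ × ℂ => h (p.1, p.2 + γ p.1)) (l₀, 0) :=
    AnalyticAt.fun_comp (g := h) (f := fun p : ℂ × ℂ => (p.1, p.2 + γ p.1))
      (by simpa using hh) (analyticAt_shear hγ)
  rw [← hmap l₀ hγ.continuousAt, frequently_map] at hne
  obtain ⟨m, h', hh', heq, hfr⟩ := exists_eq_snd_pow_mul h1 hne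
  have hline : AnalyticAt ℂ (fun l : ℂ => h' (l, 0)) l₀ :=
    hh'.fun_comp (f := fun l => (l, (0 : ℂ))) (analyticAt_id.prod analyticAt_const)
  have hne' : ∀ᶠ l in 𝓝[≠] l₀, h' (l, 0) ≠ 0 :=
    hline.eventually_eq_zero_or_eventually_ne_zero.resolve_left fun h0 =>
      hfr (h0.mono fun _ hx => not_not.2 hx)
  have hev : ∀ᶠ l in 𝓝 l₀, (∀ᶠ p : ℂ × ℂ in 𝓝 (l, 0), h (p.1, p.2 + γ p.1) = p.2 ^ m * h' p) ∧
      AnalyticAt ℂ h' (l, 0) := by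
    have ht : Tendsto (fun l : ℂ => (l, (0 : ℂ))) (𝓝 l₀) (𝓝 (l₀, 0)) :=
      continuousAt_id.prodMk continuousAt_const
    exact ht.eventually ((eventually_eventually_nhds.2 heq).and hh'.eventually_analyticAt)
  filter_upwards [hne', hev.filter_mono nhdsWithin_le_nhds,
    hγ.eventually_analyticAt.filter_mono nhdsWithin_le_nhds] with l hl1 hl2 hl3
  rw [← hmap l hl3.continuousAt, eventually_map]
  filter_upwards [hl2.1, hl2.2.continuousAt.eventually_ne hl1] with p hp1 hp2 hp0
  rw [hp1] at hp0
  have h0 : p.2 = 0 := eq_zero_of_pow_eq_zero ((mul_eq_zero.1 hp0).resolve_right hp2)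
  rw [h0, zero_add]

/-- There are only countably many graphs to which the restriction of a meromorphic function is not
well defined, since locally they are components of zero sets of denominators. Hence a generic point
separates all of them from a given graph. -/
theorem exists_separating_point {f : ℂ × ℂ → ℂ} {Ω : Set (ℂ × ℂ)} (hf : IsMeromorphicOnTwo f Ω)
    {φ₀ : ℂ → ℂ} {r s : ℝ} (hφ₀ : AnalyticOnNhd ℂ φ₀ (ball 0 r)) (hs : 0 < s) (hsr : s < r)
    {A : Set ℂ} (hA : A ⊆ ball 0 r) :
    ∃ p ∈ ball (0 : ℂ) s, ∀ γ : ℂ → ℂ, AnalyticOnNhd ℂ γ (ball 0 r) → (∀ l ∈ A, (l, γ l) ∈ Ω) →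
      ¬RestrictionWellDefined f γ A → γ p = φ₀ p → EqOn γ φ₀ (ball 0 r) := by
  classical
  -- one denominator for each set of a countable basis
  have hden : ∀ U : Set (ℂ × ℂ), ∃ h : ℂ × ℂ → ℂ,
      (∃ g h', ∀ p ∈ U, IsQuotientAt f g h' p) → ∃ g, ∀ p ∈ U, IsQuotientAt f g h p := by
    intro U
    by_cases hU : ∃ g h', ∀ p ∈ U, IsQuotientAt f g h' p
    · obtain ⟨g, h, hgh⟩ := hU
      exact ⟨h, fun _ => ⟨g, hgh⟩⟩
    · exact ⟨fun _ => 0, fun h => absurd h hU⟩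
  choose den hden using hden
  let d := TopologicalSpace.denseSeq ℂ
  let I := TopologicalSpace.countableBasis (ℂ × ℂ) × ℕ × TopologicalSpace.countableBasis ℂ
  have hIc : Countable I := by
    have := (TopologicalSpace.countable_countableBasis (ℂ × ℂ)).to_subtype
    have := (TopologicalSpace.countable_countableBasis ℂ).to_subtype
    infer_instance
  -- the graphs that near a point over `d n` are the zero set of the chosen denominator;
  -- by the identity theorem, each of the countably many indices determines at most one of them
  let Γ : I → Set (ℂ → ℂ) := fun τ => {γ | AnalyticOnNhd ℂ γ (ball 0 r) ∧ d τ.2.1 ∈ ball (0 : ℂ) r ∧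
    (∀ᶠ l in 𝓝 (d τ.2.1), den τ.1 (l, γ l) = 0) ∧ γ (d τ.2.1) ∈ (τ.2.2 : Set ℂ) ∧
    ∀ᶠ l in 𝓝 (d τ.2.1), ∀ z ∈ (τ.2.2 : Set ℂ), den τ.1 (l, z) = 0 → z = γ l}
  have huniq : ∀ τ, ∀ γ ∈ Γ τ, ∀ γ' ∈ Γ τ, EqOn γ γ' (ball 0 r) := by
    rintro τ γ ⟨h1, h2, h3, h4, h5⟩ γ' ⟨h1', h2', h3', h4', h5'⟩
    have hV : IsOpen (τ.2.2 : Set ℂ) :=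
      TopologicalSpace.isOpen_of_mem_countableBasis τ.2.2.2
    refine h1.eqOn_of_preconnected_of_eventuallyEq h1' (convex_ball _ _).isPreconnected h2 ?_
    filter_upwards [h3, h5', (h1 _ h2).continuousAt (hV.mem_nhds h4)] with l hl1 hl2 hl3
    exact hl2 _ hl3 hl1
  -- every graph to which `f` does not restrict occurs among them
  have hbad : ∀ γ : ℂ → ℂ, AnalyticOnNhd ℂ γ (ball 0 r) → (∀ l ∈ A, (l, γ l) ∈ Ω) →
      ¬RestrictionWellDefined f γ A → ∃ τ, γ ∈ Γ τ := by
    intro γ hγ hγΩ hnot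
    simp only [RestrictionWellDefined, not_forall] at hnot
    obtain ⟨l₀, hl₀, hno⟩ := hnot
    obtain ⟨g, h, hgh⟩ := hf _ (hγΩ l₀ hl₀)
    obtain ⟨U, hUb, hlU, hU⟩ := (TopologicalSpace.isBasis_countableBasis (ℂ × ℂ)).mem_nhds_iff.1
      hgh.eventually
    obtain ⟨g', hg'⟩ := hden U ⟨g, h, fun p hp => hU hp⟩
    have hq := hg' _ hlU
    have hzero : ∀ᶠ l in 𝓝 l₀, den U (l, γ l) = 0 := by
      by_contra hcon
      exact hno ⟨g', den U, hq, not_eventually.1 hcon⟩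
    have hγ₀ := hγ l₀ (hA hl₀)
    have hev := ((eventually_zero_set_eq_graph hγ₀ hq.2.1 hq.2.2.1).and
      ((eventually_eventually_nhds.2 hzero).filter_mono nhdsWithin_le_nhds)).and
      (mem_nhdsWithin_of_mem_nhds (isOpen_ball.mem_nhds (hA hl₀)) :
        ∀ᶠ l in 𝓝[≠] l₀, l ∈ ball (0 : ℂ) r)
    obtain ⟨R, hR, hRs⟩ := Metric.mem_nhdsWithin_iff.1 hev
    have hne : (ball l₀ R ∩ {l₀}ᶜ).Nonempty :=
      (Filter.nonempty_of_mem (inter_mem_nhdsWithin ({l₀}ᶜ) (ball_mem_nhds l₀ hR))).mono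
        fun x hx => ⟨hx.2, hx.1⟩
    obtain ⟨n, hn⟩ := (TopologicalSpace.denseRange_denseSeq ℂ).exists_mem_open
      (isOpen_ball.inter isOpen_compl_singleton) hne
    obtain ⟨⟨hn1, hn2⟩, hn3⟩ := hRs hn
    rw [nhds_prod_eq, eventually_prod_iff] at hn1
    obtain ⟨pa, hpa, pb, hpb, hpab⟩ := hn1
    obtain ⟨V, hVb, hlV, hV⟩ := (TopologicalSpace.isBasis_countableBasis ℂ).mem_nhds_iff.1 hpb
    exact ⟨(⟨U, hUb⟩, n, ⟨V, hVb⟩), hγ, hn3, hn2, hlV,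
      hpa.mono fun l hl z hz h0 => hpab hl (hV hz) h0⟩
  -- the points over which one of these graphs meets that of `φ₀`
  have hN : (⋃ τ, {l | l ∈ closedBall (0 : ℂ) s ∧ ∃ γ ∈ Γ τ, ¬EqOn γ φ₀ (ball 0 r) ∧
      γ l = φ₀ l}).Countable := by
    refine countable_iUnion fun τ => Set.Finite.countable ?_
    by_cases hτ : ∃ γ ∈ Γ τ, ¬EqOn γ φ₀ (ball 0 r)
    · obtain ⟨γ, hγ, hne⟩ := hτ
      obtain ⟨x, hx, hxne⟩ : ∃ x ∈ ball (0 : ℂ) r, γ x ≠ φ₀ x := by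
        simpa [EqOn] using hne
      have hsub : closedBall (0 : ℂ) s ⊆ ball 0 r := closedBall_subset_ball hsr
      refine (finite_zeros_of_isCompact (hγ.1.sub hφ₀) (convex_ball _ _).isPreconnected
        (isCompact_closedBall 0 s) hsub hx (sub_ne_zero.2 hxne)).subset ?_
      rintro l ⟨hl, γ', hγ', -, hl0⟩
      refine ⟨hl, ?_⟩
      simp only [Pi.sub_apply]
      rw [huniq τ γ hγ γ' hγ' (hsub hl), hl0, sub_self]
    · refine Set.finite_empty.subset ?_
      rintro l ⟨-, γ, hγ, hne, -⟩
      exact hτ ⟨γ, hγ, hne⟩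
  obtain ⟨p, hp, hpN⟩ := (hN.dense_compl ℝ).exists_mem_open isOpen_ball
    (nonempty_ball.2 hs : (ball (0 : ℂ) s).Nonempty)
  refine ⟨p, hpN, fun γ hγ hγΩ hnot hγp => ?_⟩
  by_contra hne
  obtain ⟨τ, hτ⟩ := hbad γ hγ hγΩ hnot
  exact hp (mem_iUnion.2 ⟨τ, ball_subset_closedBall hpN, γ, hτ, hne, hγp⟩)

/-! ### A Banach space of holomorphic functions -/

section PowerSeries

variable {E : Type*} [NormedAddCommGroup E] [NormedSpace ℂ E] {e : ℕ → E →L[ℂ] ℂ} {R : ℝ} {l : ℂ}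

/-- The evaluation at `l` of the power series `∑ e n α * (l / R) ^ n` with the coefficients
`e n α`, as a functional of `α`. -/
noncomputable def powerEval (e : ℕ → E →L[ℂ] ℂ) (R : ℝ) (l : ℂ) : E →L[ℂ] ℂ :=
  ∑' n, (l / R) ^ n • e n

lemma norm_div_lt_one (hl : l ∈ ball (0 : ℂ) R) : ‖l / R‖ < 1 := by
  rw [mem_ball_zero_iff] at hl
  have hR : 0 < R := (norm_nonneg _).trans_lt hl
  rw [norm_div, Complex.norm_real, Real.norm_of_nonneg hR.le, div_lt_one hR]
  exact hl

lemma hasSum_powerEval (he : ∀ n, ‖e n‖ ≤ 1) (hl : l ∈ ball (0 : ℂ) R) (α : E) :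
    HasSum (fun n => (l / R) ^ n * e n α) (powerEval e R l α) := by
  have hs : Summable fun n => (l / R) ^ n • e n := by
    refine Summable.of_norm_bounded
      (summable_geometric_of_lt_one (norm_nonneg _) (norm_div_lt_one hl)) fun n => ?_
    rw [norm_smul, norm_pow]
    exact mul_le_of_le_one_right (by positivity) (he n)
  have h := ContinuousLinearMap.hasSum (ContinuousLinearMap.apply ℂ ℂ α) hs.hasSum
  simp only [ContinuousLinearMap.apply_apply, smul_apply, smul_eq_mul] at h
  exact h

lemma norm_powerEval_le (he : ∀ n, ‖e n‖ ≤ 1) (hE : ∀ α, HasSum (fun n => ‖e n α‖) ‖α‖)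
    (hl : l ∈ ball (0 : ℂ) R) (α : E) : ‖powerEval e R l α‖ ≤ ‖α‖ := by
  rw [← (hasSum_powerEval he hl α).tsum_eq]
  refine tsum_of_norm_bounded (hE α) fun n => ?_
  rw [norm_mul, norm_pow]
  exact mul_le_of_le_one_left (norm_nonneg _)
    (pow_le_one₀ (norm_nonneg _) (norm_div_lt_one hl).le)

lemma analyticOnNhd_powerEval (he : ∀ n, ‖e n‖ ≤ 1) :
    AnalyticOnNhd ℂ (powerEval e R) (ball 0 R) := by
  refine DifferentiableOn.analyticOnNhd (fun l hl => ?_) isOpen_ball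
  rw [mem_ball_zero_iff] at hl
  obtain ⟨t, hlt, htR⟩ := exists_between hl
  have ht0 : 0 < t := (norm_nonneg _).trans_lt hlt
  have hR0 : 0 < R := ht0.trans htR
  have hd : DifferentiableOn ℂ (powerEval e R) (ball 0 t) := by
    refine Complex.differentiableOn_tsum_of_summable_norm (u := fun n => (t / R) ^ n)
      (summable_geometric_of_lt_one (by positivity) ((div_lt_one hR0).2 htR)) (fun n => ?_)
      isOpen_ball fun n w hw => ?_
    · fun_prop
    · rw [mem_ball_zero_iff] at hw
      rw [norm_smul, norm_pow, norm_div, Complex.norm_real, Real.norm_of_nonneg hR0.le]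
      calc _ ≤ (t / R) ^ n * 1 := by
            gcongr
            exact he n
        _ = _ := mul_one _
  exact (hd.differentiableAt
    (isOpen_ball.mem_nhds (mem_ball_zero_iff.2 hlt))).differentiableWithinAt

lemma eq_zero_of_powerEval_eq_zero (he : ∀ n, ‖e n‖ ≤ 1) {α : E} (hR : 0 < R)
    (h : ∀ᶠ l in 𝓝 (0 : ℂ), powerEval e R l α = 0) (n : ℕ) : e n α = 0 := by
  have hp : HasFPowerSeriesAt (fun _ : ℂ => (0 : ℂ))
      (FormalMultilinearSeries.ofScalars ℂ fun n => e n α / (R : ℂ) ^ n) 0 := by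
    rw [hasFPowerSeriesAt_iff]
    filter_upwards [h, ball_mem_nhds (0 : ℂ) hR] with l hl hlR
    have := hasSum_powerEval he hlR α
    rw [hl] at this
    refine this.congr_fun fun n => ?_
    rw [FormalMultilinearSeries.coeff_ofScalars, div_pow, smul_eq_mul]
    ring
  have h0 := hp.eq_zero
  have h1 : FormalMultilinearSeries.coeff (FormalMultilinearSeries.ofScalars ℂ
      fun n => e n α / (R : ℂ) ^ n) n = 0 := by
    rw [h0]
    rfl
  rw [FormalMultilinearSeries.coeff_ofScalars, div_eq_zero_iff] at h1
  exact h1.resolve_right (pow_ne_zero _ (by exact_mod_cast hR.ne'))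

end PowerSeries

/-- A Banach space of holomorphic functions on a disc, such as that of the power series with
summable coefficients: evaluations are functionals of norm at most one that depend holomorphically
on the point, and the constants are embedded isometrically. -/
theorem exists_banach_space_of_holomorphic {R : ℝ} (hR : 0 < R) :
    ∃ (E : Type) (_ : NormedAddCommGroup E) (_ : NormedSpace ℂ E) (_ : CompleteSpace E),
      ¬FiniteDimensional ℂ E ∧ ∃ (T : ℂ → E →L[ℂ] ℂ) (σ : ℂ → E),
        AnalyticOnNhd ℂ T (ball 0 R) ∧ (∀ l ∈ ball (0 : ℂ) R, ∀ α, ‖T l α‖ ≤ ‖α‖) ∧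
        (∀ y, ‖σ y‖ = ‖y‖) ∧ (∀ l ∈ ball (0 : ℂ) R, ∀ y, T l (σ y) = y) ∧
        ∀ α, (∀ᶠ l in 𝓝 (0 : ℂ), T l α = 0) → α = 0 := by
  -- `ℓ¹`, with the sequence `α` standing for the function `∑ α n * (l / R) ^ n`
  let E : Type := lp (fun _ : ℕ => ℂ) 1
  let e : ℕ → E →L[ℂ] ℂ := fun n => lp.evalCLM ℂ (fun _ : ℕ => ℂ) 1 n
  have hev : ∀ n (α : lp (fun _ : ℕ => ℂ) 1), e n α = α n := fun n α => rfl
  have he : ∀ n, ‖e n‖ ≤ 1 := fun n =>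
    ContinuousLinearMap.opNorm_le_bound _ zero_le_one fun α => by
      rw [one_mul]
      exact lp.norm_apply_le_norm one_ne_zero α n
  have hE : ∀ α : E, HasSum (fun n => ‖e n α‖) ‖α‖ := fun α => by
    have := lp.hasSum_norm (E := fun _ : ℕ => ℂ) (p := 1) (by simp) α
    simp only [ENNReal.toReal_one, Real.rpow_one] at this
    exact this
  have hsingle : ∀ (n j : ℕ) (y : ℂ), e j (lp.single (E := fun _ : ℕ => ℂ) 1 n y) =
      if j = n then y else 0 := by
    intro n j y
    rw [hev]
    split_ifs with h
    · subst h; simp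
    · simp [h]
  refine ⟨E, inferInstance, inferInstance, inferInstance, ?_, powerEval e R,
    fun y => lp.single (E := fun _ : ℕ => ℂ) 1 0 y, analyticOnNhd_powerEval he,
    fun l hl α => norm_powerEval_le he hE hl α, fun y => ?_, fun l hl y => ?_, fun α hα => ?_⟩
  · intro hfin
    have hli : LinearIndependent ℂ
        (fun n : ℕ => (lp.single (E := fun _ : ℕ => ℂ) 1 n (1 : ℂ) : E)) := by
      rw [linearIndependent_iff']
      intro s g hg i hi
      have h1 := congrArg (e i) hg
      rw [map_sum, map_zero, Finset.sum_eq_single i] at h1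
      · rw [map_smul, hsingle, if_pos rfl, smul_eq_mul, mul_one] at h1
        exact h1
      · intro j _ hj
        rw [map_smul, hsingle, if_neg hj.symm, smul_zero]
      · exact fun h => absurd hi h
    exact not_finite_iff_infinite.2 inferInstance hli.finite
  · exact lp.norm_single (E := fun _ : ℕ => ℂ) (p := 1) (by simp) 0 y
  · refine (hasSum_powerEval he hl _).unique ?_
    have := hasSum_single (f := fun n => (l / R) ^ n * e n (lp.single (E := fun _ : ℕ => ℂ) 1 0 y))
      0 fun n hn => by rw [hsingle, if_neg hn, mul_zero]
    simpa [hsingle] using this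
  · have := eq_zero_of_powerEval_eq_zero he hR hα
    exact lp.ext (funext this)

/-! ### The pinched family and its swept set -/

lemma isPreconnected_annulus (a b : ℝ) : IsPreconnected (annulus a b) := by
  rcases lt_or_ge a 0 with ha | ha
  · have : annulus a b = ball 0 b := by
      ext x
      rw [mem_ball_zero_iff]
      exact ⟨fun h => h.2, fun h => ⟨ha.trans_le (norm_nonneg _), h⟩⟩
    rw [this]
    exact (convex_ball _ _).isPreconnected
  · have : annulus a b = (fun p : ℝ × ℝ => (p.1 : ℂ) * Complex.exp (p.2 * Complex.I)) ''
        (Ioo a b ×ˢ univ) := by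
      ext x
      constructor
      · intro hx
        exact ⟨(‖x‖, x.arg), ⟨hx, mem_univ _⟩, Complex.norm_mul_exp_arg_mul_I x⟩
      · rintro ⟨⟨s, θ⟩, ⟨hs, -⟩, rfl⟩
        have : ‖(s : ℂ) * Complex.exp (θ * Complex.I)‖ = s := by
          rw [norm_mul, Complex.norm_exp_ofReal_mul_I, mul_one, Complex.norm_real,
            Real.norm_of_nonneg (ha.trans hs.1.le)]
        exact ⟨this.symm ▸ hs.1, this.symm ▸ hs.2⟩
    rw [this]
    refine IsPreconnected.image ((convex_Ioo a b).prod convex_univ).isPreconnected _ ?_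
    fun_prop

lemma isPreconnected_ball_sdiff_singleton (x : ℂ) (r : ℝ) : IsPreconnected (ball x r \ {x}) := by
  have : ball x r \ {x} = (fun y => x + y) '' annulus 0 r := by
    ext y
    constructor
    · rintro ⟨hy, hyx⟩
      rw [mem_ball, dist_eq_norm] at hy
      exact ⟨y - x, ⟨norm_pos_iff.2 (sub_ne_zero.2 hyx), hy⟩, by simp⟩
    · rintro ⟨z, ⟨hz1, hz2⟩, rfl⟩
      refine ⟨by simpa using hz2, ?_⟩
      simpa using norm_pos_iff.1 hz1
  rw [this]
  exact (isPreconnected_annulus 0 r).image _ (by fun_prop)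

/-- Removing a finite set does not disconnect a connected open subset of the plane. -/
lemma isPreconnected_sdiff_finset {U : Set ℂ} (hU : IsPreconnected U) (hUo : IsOpen U)
    (Λ : Finset ℂ) : IsPreconnected (U \ Λ) := by
  classical
  induction Λ using Finset.induction_on with
  | empty => simpa using hU
  | insert x Λ _ ih =>
    have hVo : IsOpen (U \ Λ) := hUo.sdiff Λ.finite_toSet.isClosed
    have e : U \ (insert x Λ : Finset ℂ) = (U \ Λ) \ {x} := by
      ext y
      simp only [Finset.coe_insert, Set.mem_sdiff, mem_insert_iff, mem_singleton_iff]
      tauto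
    rw [e]
    generalize U \ (Λ : Set ℂ) = V at ih hVo
    by_cases hx : x ∈ V
    swap
    · rwa [sdiff_singleton_eq_self hx]
    obtain ⟨r, hr, hrV⟩ := Metric.isOpen_iff.1 hVo x hx
    have key : ∀ u v : Set ℂ, IsOpen u → IsOpen v → V \ {x} ⊆ u ∪ v →
        V \ {x} ∩ (u ∩ v) = ∅ → ball x r \ {x} ⊆ u → V \ {x} ⊆ u := by
      intro u v hu hv huv hdis hD
      have h := isPreconnected_iff_subset_of_disjoint.1 ih (u ∪ ball x r) (v \ {x})
        (hu.union isOpen_ball) (hv.sdiff isClosed_singleton) (fun y hy => ?_) ?_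
      · rcases h with h | h
        · rintro y ⟨hy, hyx⟩
          rcases h hy with h' | h'
          · exact h'
          · exact hD ⟨h', hyx⟩
        · exact absurd rfl (h hx).2
      · by_cases hyx : y = x
        · exact Or.inl (Or.inr (hyx ▸ mem_ball_self hr))
        · rcases huv ⟨hy, hyx⟩ with h' | h'
          · exact Or.inl (Or.inl h')
          · exact Or.inr ⟨h', hyx⟩
      · rw [eq_empty_iff_forall_notMem]
        rintro y ⟨hyV, hyu, hyv, hyx⟩
        have hyu' : y ∈ u := hyu.elim id fun h => hD ⟨h, hyx⟩
        exact (eq_empty_iff_forall_notMem.1 hdis) y ⟨⟨hyV, hyx⟩, hyu', hyv⟩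
    rw [isPreconnected_iff_subset_of_disjoint]
    intro u v hu hv huv hdis
    have hDV : ball x r \ {x} ⊆ V \ {x} := sdiff_subset_sdiff_left hrV
    rcases isPreconnected_iff_subset_of_disjoint.1 (isPreconnected_ball_sdiff_singleton x r) u v hu
      hv (hDV.trans huv) (by
        rw [eq_empty_iff_forall_notMem] at hdis ⊢
        exact fun y hy => hdis y ⟨hDV hy.1, hy.2⟩) with h | h
    · exact Or.inl (key u v hu hv huv hdis h)
    · exact Or.inr (key v u hv hu (by rwa [union_comm]) (by rwa [inter_comm v u]) h)

lemma eventually_notMem_finset (Λ : Finset ℂ) (a : ℂ) : ∀ᶠ l in 𝓝[≠] a, l ∉ Λ := by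
  classical
  have h := (Λ.erase a).finite_toSet.isClosed.isOpen_compl.mem_nhds
    (by simp : a ∈ ((Λ.erase a : Finset ℂ) : Set ℂ)ᶜ)
  filter_upwards [mem_nhdsWithin_of_mem_nhds h, self_mem_nhdsWithin] with l hl hla hlΛ
  exact hl (Finset.mem_coe.2 (Finset.mem_erase.2 ⟨hla, hlΛ⟩))

/-- The graphs `z = φ₀ l + b l * (κ + T l α)`, all of which pass through the points of the graph of
`φ₀` over the zeros of `b`. -/
noncomputable def pinchFamily {E : Type*} [NormedAddCommGroup E] [NormedSpace ℂ E]
    (φ₀ b : ℂ → ℂ) (κ : ℂ)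
    (T : ℂ → E →L[ℂ] ℂ) (α : E) (l : ℂ) : ℂ :=
  φ₀ l + b l * (κ + T l α)

/-- The points over `W` that have a coordinate `y = (z - φ₀ l) / b l` with `|y - κ| < ρ`. -/
def pinchSet (φ₀ b : ℂ → ℂ) (W : Set ℂ) (κ : ℂ) (ρ : ℝ) : Set (ℂ × ℂ) :=
  {p | p.1 ∈ W ∧ b p.1 ≠ 0 ∧ ‖(p.2 - φ₀ p.1) / b p.1 - κ‖ < ρ}

section Family

variable {E : Type} [NormedAddCommGroup E] [NormedSpace ℂ E] {T : ℂ → E →L[ℂ] ℂ} {σ : ℂ → E}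
  {r ρ : ℝ} {φ₀ b : ℂ → ℂ} {Λ : Finset ℂ} {κ : ℂ} {W : Set ℂ}

lemma pinchFamily_mem (hσT : ∀ l ∈ ball (0 : ℂ) r, ∀ α, ‖T l α‖ ≤ ‖α‖) {α : E}
    (hα : α ∈ ball (0 : E) ρ) {l : ℂ} (hl : l ∈ ball (0 : ℂ) r) (hb : b l ≠ 0) :
    (l, pinchFamily φ₀ b κ T α l) ∈ pinchSet φ₀ b (ball 0 r) κ ρ := by
  refine ⟨hl, hb, ?_⟩
  simp only [pinchFamily]
  rw [add_sub_cancel_left, mul_div_cancel_left₀ _ hb, add_sub_cancel_left]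
  exact (hσT l hl α).trans_lt (mem_ball_zero_iff.1 hα)

lemma analyticOnNhd_pinchFamily (hφ₀ : AnalyticOnNhd ℂ φ₀ (ball 0 r))
    (hb : AnalyticOnNhd ℂ b (ball 0 r)) (hT : AnalyticOnNhd ℂ T (ball 0 r)) :
    AnalyticOnNhd ℂ (fun p : E × ℂ => pinchFamily φ₀ b κ T p.1 p.2) (univ ×ˢ ball 0 r) := by
  rintro ⟨α, l⟩ ⟨-, hl⟩
  have h1 : AnalyticAt ℂ (fun p : E × ℂ => T p.2) (α, l) :=
    (hT l hl).fun_comp (f := fun p : E × ℂ => p.2) analyticAt_snd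
  have h2 : AnalyticAt ℂ (fun p : E × ℂ => T p.2 p.1) (α, l) :=
    (ContinuousLinearMap.analyticAt_bilinear (ContinuousLinearMap.id ℂ (E →L[ℂ] ℂ))
      (T l, α)).fun_comp (f := fun p : E × ℂ => (T p.2, p.1)) (h1.prod analyticAt_fst)
  exact ((hφ₀ l hl).fun_comp (f := fun p : E × ℂ => p.2) analyticAt_snd).add
    (((hb l hl).fun_comp (f := fun p : E × ℂ => p.2) analyticAt_snd).mul (analyticAt_const.add h2))

lemma analyticOnNhd_pinchFamily_apply (hφ₀ : AnalyticOnNhd ℂ φ₀ (ball 0 r))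
    (hb : AnalyticOnNhd ℂ b (ball 0 r)) (hT : AnalyticOnNhd ℂ T (ball 0 r)) (α : E) :
    AnalyticOnNhd ℂ (pinchFamily φ₀ b κ T α) (ball 0 r) := fun l hl =>
  (analyticOnNhd_pinchFamily (κ := κ) hφ₀ hb hT (α, l) ⟨mem_univ _, hl⟩).fun_comp
    (f := fun l => (α, l)) (analyticAt_const.prod analyticAt_id)

/-- The pinched family is analytic of generic rank two: away from the pinches, the parameter moves
the graphs in the vertical direction. -/
theorem isAnalyticFamily_pinchFamily (hr : 0 < r) (hφ₀ : AnalyticOnNhd ℂ φ₀ (ball 0 r))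
    (hb : AnalyticOnNhd ℂ b (ball 0 r)) (hT : AnalyticOnNhd ℂ T (ball 0 r))
    (hbΛ : ∀ l ∈ ball (0 : ℂ) r, l ∉ Λ → b l ≠ 0)
    (hσ : ∀ l ∈ ball (0 : ℂ) r, ∀ y, T l (σ y) = y)
    (hinj : ∀ α, (∀ᶠ l in 𝓝 (0 : ℂ), T l α = 0) → α = 0)
    (hmaps : ∀ α ∈ ball (0 : E) ρ, MapsTo (pinchFamily φ₀ b κ T α) (ball 0 r) (ball 0 1)) :
    IsAnalyticFamily ρ r (pinchFamily φ₀ b κ T) where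
  analytic := (analyticOnNhd_pinchFamily hφ₀ hb hT).mono (prod_mono_left (subset_univ _))
  mapsTo := hmaps
  generic_rank := by
    rintro ⟨α, l⟩ ⟨hα, hl⟩
    have ht : Tendsto (fun l' : ℂ => (α, l')) (𝓝[≠] l) (𝓝 (α, l)) :=
      (continuousAt_const.prodMk continuousAt_id).mono_left nhdsWithin_le_nhds
    refine mem_closure_of_tendsto ht ?_
    filter_upwards [eventually_notMem_finset Λ l,
      mem_nhdsWithin_of_mem_nhds (isOpen_ball.mem_nhds hl)] with l' hl'Λ hl'
    refine ⟨⟨hα, hl'⟩, ?_⟩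
    have hb0 := hbΛ l' hl' hl'Λ
    have hd : HasFDerivAt (fun p : E × ℂ => pinchFamily φ₀ b κ T p.1 p.2)
        (fderiv ℂ (fun p : E × ℂ => pinchFamily φ₀ b κ T p.1 p.2) (α, l')) (α, l') :=
      (analyticOnNhd_pinchFamily hφ₀ hb hT (α, l') ⟨mem_univ _, hl'⟩).differentiableAt.hasFDerivAt
    have hG := (hasFDerivAt_snd (𝕜 := ℂ) (p := (α, l'))).prodMk hd
    rw [hG.fderiv]
    generalize fderiv ℂ (fun p : E × ℂ => pinchFamily φ₀ b κ T p.1 p.2) (α, l') = D at hd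
    -- the derivative in the direction of the parameter
    have hvert : ∀ β, D (β, 0) = b l' * T l' β := by
      intro β
      have hline : HasDerivAt (fun t : ℂ => (α + t • β, l')) (β, 0) 0 := by
        have h1 : HasDerivAt (fun t : ℂ => α + t • β) β 0 := by
          simpa using ((hasDerivAt_id (0 : ℂ)).smul_const β).const_add α
        exact h1.prodMk (hasDerivAt_const _ _)
      have h1 : HasDerivAt (fun t : ℂ => pinchFamily φ₀ b κ T (α + t • β) l') (D (β, 0)) 0 := by
        have := HasFDerivAt.comp_hasDerivAt (0 : ℂ) (f := fun t : ℂ => (α + t • β, l'))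
          (l := fun p : E × ℂ => pinchFamily φ₀ b κ T p.1 p.2) (by simpa using hd) hline
        exact this
      have h2 : HasDerivAt (fun t : ℂ => pinchFamily φ₀ b κ T (α + t • β) l')
          (b l' * T l' β) 0 := by
        have e : (fun t : ℂ => pinchFamily φ₀ b κ T (α + t • β) l') = fun t =>
            (φ₀ l' + b l' * (κ + T l' α)) + t * (b l' * T l' β) := by
          funext t
          simp only [pinchFamily, map_add, map_smul, smul_eq_mul]
          ring
        rw [e]
        simpa using ((hasDerivAt_id (0 : ℂ)).mul_const (b l' * T l' β)).const_add
          (φ₀ l' + b l' * (κ + T l' α))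
      exact h1.unique h2
    rintro ⟨u, v⟩
    refine ⟨(σ ((v - D (0, u)) / b l'), u), ?_⟩
    have e : (σ ((v - D (0, u)) / b l'), u) = (σ ((v - D (0, u)) / b l'), (0 : ℂ)) + (0, u) := by
      simp
    refine Prod.ext rfl ?_
    show D (σ ((v - D (0, u)) / b l'), u) = v
    rw [e, map_add, hvert, hσ l' hl', mul_div_cancel₀ _ hb0]
    ring
  injective := by
    intro α _ β _ hαβ
    refine sub_eq_zero.1 (hinj _ ?_)
    have h0 : (0 : ℂ) ∈ ball (0 : ℂ) r := mem_ball_self hr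
    have han : AnalyticAt ℂ (fun l => T l (α - β)) 0 :=
      (ContinuousLinearMap.apply ℂ ℂ (α - β)).analyticAt _ |>.fun_comp (hT 0 h0)
    refine eqOn_of_eventuallyEq_nhdsNE han analyticAt_const ?_
    filter_upwards [eventually_notMem_finset Λ 0,
      mem_nhdsWithin_of_mem_nhds (isOpen_ball.mem_nhds h0)] with l hlΛ hl
    have h1 := hαβ hl
    simp only [pinchFamily] at h1
    have h2 := add_left_cancel (mul_left_cancel₀ (hbΛ l hl hlΛ) (add_left_cancel h1))
    rw [map_sub, h2, sub_self]

lemma isOpen_pinchSet (hW : IsOpen W) (hφ₀ : ContinuousOn φ₀ W) (hb : ContinuousOn b W) :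
    IsOpen (pinchSet φ₀ b W κ ρ) := by
  rw [isOpen_iff_mem_nhds]
  rintro ⟨l, z⟩ ⟨hl, hbl, hz⟩
  have hf : ContinuousAt (fun p : ℂ × ℂ => p.1) (l, z) := continuousAt_fst
  have hbc : ContinuousAt (fun p : ℂ × ℂ => b p.1) (l, z) :=
    ContinuousAt.comp' (f := fun p : ℂ × ℂ => p.1) (hb.continuousAt (hW.mem_nhds hl)) hf
  have hφc : ContinuousAt (fun p : ℂ × ℂ => φ₀ p.1) (l, z) :=
    ContinuousAt.comp' (f := fun p : ℂ × ℂ => p.1) (hφ₀.continuousAt (hW.mem_nhds hl)) hf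
  have hq : ContinuousAt (fun p : ℂ × ℂ => ‖(p.2 - φ₀ p.1) / b p.1 - κ‖) (l, z) :=
    (((continuousAt_snd.sub hφc).div hbc hbl).sub continuousAt_const).norm
  filter_upwards [hf.preimage_mem_nhds (hW.mem_nhds hl), hbc.eventually_ne hbl,
    hq.eventually_lt continuousAt_const hz] with p h1 h2 h3 using ⟨h1, h2, h3⟩

lemma isPreconnected_pinchSet (hW : IsOpen W) (hWc : IsPreconnected W)
    (hφ₀ : ContinuousOn φ₀ W) (hb : ContinuousOn b W) (hbΛ : ∀ l ∈ W, b l = 0 ↔ l ∈ Λ) :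
    IsPreconnected (pinchSet φ₀ b W κ ρ) := by
  have e : pinchSet φ₀ b W κ ρ = (fun p : ℂ × ℂ => (p.1, φ₀ p.1 + b p.1 * p.2)) ''
      ((W \ Λ) ×ˢ ball κ ρ) := by
    ext ⟨l, z⟩
    constructor
    · rintro ⟨hl, hbl, hz⟩
      refine ⟨(l, (z - φ₀ l) / b l), ⟨⟨hl, fun h => hbl ((hbΛ l hl).2 h)⟩, ?_⟩, ?_⟩
      · rwa [mem_ball, dist_eq_norm]
      · refine Prod.ext rfl ?_
        simp only
        rw [mul_div_cancel₀ _ hbl, add_sub_cancel]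
    · rintro ⟨⟨l', y⟩, ⟨⟨hl, hlΛ⟩, hy⟩, heq⟩
      obtain ⟨rfl, rfl⟩ := Prod.mk.inj heq
      have hbl : b l' ≠ 0 := fun h => hlΛ ((hbΛ l' hl).1 h)
      refine ⟨hl, hbl, ?_⟩
      simp only
      rw [add_sub_cancel_left, mul_div_cancel_left₀ _ hbl]
      rwa [mem_ball, dist_eq_norm] at hy
  rw [e]
  refine ((isPreconnected_sdiff_finset hWc hW Λ).prod (convex_ball _ _).isPreconnected).image _ ?_
  have hf : MapsTo (fun p : ℂ × ℂ => p.1) ((W \ (Λ : Set ℂ)) ×ˢ ball κ ρ) W := fun p hp => hp.1.1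
  exact continuousOn_fst.prodMk ((hφ₀.comp continuousOn_fst hf).add
    ((hb.comp continuousOn_fst hf).mul continuousOn_snd))

theorem sweptSet_pinchFamily (hφ₀ : ContinuousOn φ₀ (ball 0 r)) (hb : ContinuousOn b (ball 0 r))
    (hT : ∀ l ∈ ball (0 : ℂ) r, ∀ α, ‖T l α‖ ≤ ‖α‖) (hσn : ∀ y, ‖σ y‖ = ‖y‖)
    (hσ : ∀ l ∈ ball (0 : ℂ) r, ∀ y, T l (σ y) = y) :
    sweptSet ρ r (pinchFamily φ₀ b κ T) = pinchSet φ₀ b (ball 0 r) κ ρ := by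
  refine Subset.antisymm ?_ ?_
  · rintro ⟨l, z⟩ hp
    obtain ⟨α, hα, hl, hz⟩ := mem_iUnion₂.1 (interior_subset hp)
    simp only at hl hz
    by_cases hbl : b l = 0
    · exfalso
      -- over a zero of `b` the graphs meet in a single point
      have ht : Tendsto (fun t : ℂ => (l, z + t)) (𝓝[≠] 0) (𝓝 (l, z)) := by
        have : ContinuousAt (fun t : ℂ => (l, z + t)) 0 := by fun_prop
        simpa [ContinuousAt] using this.mono_left (nhdsWithin_le_nhds (s := {0}ᶜ))
      obtain ⟨t, ht1, ht2⟩ := ((ht.eventually (mem_interior_iff_mem_nhds.1 hp)).and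
        (self_mem_nhdsWithin : ∀ᶠ t in 𝓝[≠] (0 : ℂ), t ∈ ({0}ᶜ : Set ℂ))).exists
      obtain ⟨β, -, -, hz'⟩ := mem_iUnion₂.1 ht1
      simp only [pinchFamily, hbl, zero_mul, add_zero] at hz hz'
      rw [hz] at hz'
      exact ht2 (by simpa using hz')
    · rw [hz]
      exact pinchFamily_mem hT hα hl hbl
  · refine interior_maximal ?_ (isOpen_pinchSet isOpen_ball hφ₀ hb)
    rintro ⟨l, z⟩ ⟨hl, hbl, hz⟩
    refine mem_iUnion₂.2 ⟨σ ((z - φ₀ l) / b l - κ), ?_, hl, ?_⟩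
    · rw [mem_ball_zero_iff, hσn]
      exact hz
    · simp only [pinchFamily]
      rw [hσ l hl, add_sub_cancel, mul_div_cancel₀ _ hbl, add_sub_cancel]

/-- The swept set of the family pinched by a power of `∏ (l - a)` is a pinched domain. -/
theorem isPinchedDomain_pinchSet {K : ℕ} (hr : 1 < r) (hρ : 0 < ρ) (hK : 1 ≤ K)
    (hφ₀ : ContinuousOn φ₀ (ball 0 r)) (hΛ : (Λ : Set ℂ) ⊆ ball 0 1)
    (hb : ∀ l, b l = (∏ a ∈ Λ, (l - a)) ^ K) :
    IsPinchedDomain r (fun l => φ₀ l + b l * κ) (pinchSet φ₀ b (ball 0 r) κ ρ) := by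
  classical
  have hbc : Continuous b := by
    rw [funext hb]
    fun_prop
  have hb0 : ∀ l, b l = 0 ↔ l ∈ Λ := by
    intro l
    rw [hb, pow_eq_zero_iff (by omega), Finset.prod_eq_zero_iff]
    exact ⟨fun ⟨a, ha, h⟩ => sub_eq_zero.1 h ▸ ha, fun h => ⟨l, h, sub_self l⟩⟩
  have hmem : ∀ l ∈ ball (0 : ℂ) r, l ∉ Λ →
      (l, φ₀ l + b l * κ) ∈ pinchSet φ₀ b (ball 0 r) κ ρ := by
    intro l hl hlΛ
    have hbl : b l ≠ 0 := fun h => hlΛ ((hb0 l).1 h)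
    refine ⟨hl, hbl, ?_⟩
    simp only
    rw [add_sub_cancel_left, mul_div_cancel_left₀ _ hbl, sub_self, norm_zero]
    exact hρ
  refine ⟨isOpen_pinchSet isOpen_ball hφ₀ hbc.continuousOn, ⟨?_, isPreconnected_pinchSet isOpen_ball
    (convex_ball _ _).isPreconnected hφ₀ hbc.continuousOn fun l _ => hb0 l⟩, Λ, hΛ, hmem,
    fun a ha => ⟨fun h => h.2.1 ((hb0 a).2 ha), K, hK, ?_⟩⟩
  · obtain ⟨l, hl1, hl2⟩ := ((eventually_notMem_finset Λ 0).and (mem_nhdsWithin_of_mem_nhds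
      (isOpen_ball.mem_nhds (mem_ball_self (by linarith : 0 < r))))).exists
    exact ⟨_, hmem l hl2 hl1⟩
  -- `b` is a unit times `(l - a) ^ K` near `a`
  set b' : ℂ → ℂ := fun l => (∏ x ∈ Λ.erase a, (l - x)) ^ K with hb'
  have hb'0 : b' a ≠ 0 := by
    refine pow_ne_zero _ (Finset.prod_ne_zero_iff.2 fun x hx => sub_ne_zero.2 ?_)
    exact (Finset.ne_of_mem_erase hx).symm
  have hb'c : Continuous b' := by fun_prop
  have hbb' : ∀ l, b l = (l - a) ^ K * b' l := fun l => by
    rw [hb, ← Finset.mul_prod_erase Λ _ ha, mul_pow]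
  have har : a ∈ ball (0 : ℂ) r := ball_subset_ball hr.le (hΛ ha)
  have hd : 0 < ‖b' a‖ / 2 := half_pos (norm_pos_iff.2 hb'0)
  have hev : ∀ᶠ l in 𝓝 a, l ∈ ball (0 : ℂ) r ∧ ‖b' a‖ / 2 < ‖b' l‖ :=
    (isOpen_ball.eventually_mem har).and
      ((hb'c.norm.tendsto a).eventually (lt_mem_nhds (half_lt_self (norm_pos_iff.2 hb'0))))
  obtain ⟨s, hs, hsb⟩ := Metric.eventually_nhds_iff_ball.1 hev
  refine ⟨ρ * (‖b' a‖ / 2), by positivity, s, hs, fun l z hl _ hz => ?_⟩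
  have hla : l ≠ a := by
    rintro rfl
    rw [sub_self, norm_zero, zero_pow (by omega), mul_zero] at hz
    exact absurd hz (not_lt.2 (norm_nonneg _))
  have hl' := hsb l (by rwa [mem_ball, dist_eq_norm])
  have hbl : b l ≠ 0 := by
    rw [hbb']
    exact mul_ne_zero (pow_ne_zero _ (sub_ne_zero.2 hla)) (norm_pos_iff.1 (hd.trans hl'.2))
  refine ⟨hl'.1, hbl, ?_⟩
  have e : (z - φ₀ l) / b l - κ = (z - (φ₀ l + b l * κ)) / b l := by
    field_simp
    ring
  simp only
  rw [e, norm_div, div_lt_iff₀ (norm_pos_iff.2 hbl), hbb', norm_mul, norm_pow, ← hbb']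
  refine hz.trans_le ?_
  calc ρ * (‖b' a‖ / 2) * ‖l - a‖ ^ K = ρ * (‖l - a‖ ^ K * (‖b' a‖ / 2)) := by ring
    _ ≤ _ := by
      gcongr
      exact hl'.2.le

end Family

/-! ### Poles along the limit graph -/

/-- Near `(l₀, 0)`, the poles of `f` along the axis `w = 0` have order at most `m`: up to the factor
`w ^ m`, `f` has a denominator that does not vanish identically on the axis. -/
def HasAxisPole (f : ℂ × ℂ → ℂ) (m : ℕ) (l₀ : ℂ) : Prop :=
  ∃ g h : ℂ × ℂ → ℂ, AnalyticAt ℂ g (l₀, 0) ∧ AnalyticAt ℂ h (l₀, 0) ∧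
    (∃ᶠ l in 𝓝 l₀, h (l, 0) ≠ 0) ∧
    ∀ᶠ p : ℂ × ℂ in 𝓝 (l₀, 0), p.2 ^ m * h p ≠ 0 → f p = g p / (p.2 ^ m * h p)

lemma tendsto_axis (l₀ : ℂ) : Tendsto (fun l : ℂ => (l, (0 : ℂ))) (𝓝 l₀) (𝓝 (l₀, 0)) :=
  continuousAt_id.prodMk continuousAt_const

lemma analyticAt_axis {h : ℂ × ℂ → ℂ} {l₀ : ℂ} (hh : AnalyticAt ℂ h (l₀, 0)) :
    AnalyticAt ℂ (fun l => h (l, 0)) l₀ :=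
  hh.fun_comp (f := fun l => (l, (0 : ℂ))) (analyticAt_id.prod analyticAt_const)

lemma eventually_ne_zero_axis {h : ℂ × ℂ → ℂ} {l₀ : ℂ} (hh : AnalyticAt ℂ h (l₀, 0))
    (hne : ∃ᶠ l in 𝓝 l₀, h (l, 0) ≠ 0) : ∀ᶠ l in 𝓝[≠] l₀, h (l, 0) ≠ 0 :=
  (analyticAt_axis hh).eventually_eq_zero_or_eventually_ne_zero.resolve_left fun h0 =>
    hne (h0.mono fun _ hx => not_not.2 hx)

lemma HasAxisPole.mono {f : ℂ × ℂ → ℂ} {m m' : ℕ} {l₀ : ℂ} (H : HasAxisPole f m l₀)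
    (hm : m ≤ m') : HasAxisPole f m' l₀ := by
  obtain ⟨g, h, hg, hh, hne, heq⟩ := H
  refine ⟨fun p => p.2 ^ (m' - m) * g p, h, (analyticAt_snd.pow _).mul hg, hh, hne, ?_⟩
  filter_upwards [heq] with p hp hp0
  have h1 : p.2 ^ m' = p.2 ^ (m' - m) * p.2 ^ m := by rw [← pow_add, Nat.sub_add_cancel hm]
  rw [h1, mul_assoc] at hp0 ⊢
  rw [hp (right_ne_zero_of_mul hp0), mul_div_mul_left _ _ (left_ne_zero_of_mul hp0)]

lemma HasAxisPole.eventually {f : ℂ × ℂ → ℂ} {m : ℕ} {l₀ : ℂ} (H : HasAxisPole f m l₀) :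
    ∀ᶠ l in 𝓝 l₀, HasAxisPole f m l := by
  obtain ⟨g, h, hg, hh, hne, heq⟩ := H
  have h1 : ∀ᶠ l in 𝓝 l₀, ∃ᶠ l' in 𝓝 l, h (l', 0) ≠ 0 := by
    have h2 := eventually_nhdsWithin_iff.1 (eventually_ne_zero_axis hh hne)
    have han := (analyticAt_axis hh).eventually_analyticAt
    filter_upwards [eventually_eventually_nhds.2 h2] with l hl
    have h3 : ∀ᶠ l' in 𝓝[≠] l, l' ∉ ({l₀} : Finset ℂ) := eventually_notMem_finset _ _
    have h4 : ∀ᶠ l' in 𝓝[≠] l, h (l', 0) ≠ 0 := by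
      filter_upwards [hl.filter_mono nhdsWithin_le_nhds, h3] with l' h5 h6
      exact h5 (by simpa using h6)
    exact h4.frequently.filter_mono nhdsWithin_le_nhds
  filter_upwards [(tendsto_axis l₀).eventually (hg.eventually_analyticAt.and
    (hh.eventually_analyticAt.and (eventually_eventually_nhds.2 heq))), h1] with l h2 h3
  exact ⟨g, h, h2.1, h2.2.1, h3, h2.2.2⟩

lemma IsQuotientAt.hasAxisPole {f g h : ℂ × ℂ → ℂ} {l₀ : ℂ} (H : IsQuotientAt f g h (l₀, 0)) :
    ∃ m, HasAxisPole f m l₀ := by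
  obtain ⟨m, h', hh', heq, hne⟩ := exists_eq_snd_pow_mul H.2.1 H.2.2.1
  refine ⟨m, g, h', H.1, hh', hne, ?_⟩
  filter_upwards [heq, H.2.2.2] with p h1 h2 h3
  rw [← h1] at h3 ⊢
  exact h2 h3

/-- Bounds for the order of the pole along the axis are uniform over compact sets. -/
lemma exists_hasAxisPole_of_isCompact {f : ℂ × ℂ → ℂ} {K : Set ℂ} (hK : IsCompact K)
    (h : ∀ l ∈ K, ∃ m, HasAxisPole f m l) : ∃ m, ∀ l ∈ K, HasAxisPole f m l := by
  refine hK.induction_on (p := fun S => ∃ m, ∀ l ∈ S, HasAxisPole f m l) ⟨0, by simp⟩ ?_ ?_ ?_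
  · rintro S T hST ⟨m, hm⟩
    exact ⟨m, fun l hl => hm l (hST hl)⟩
  · rintro S T ⟨m, hm⟩ ⟨m', hm'⟩
    exact ⟨max m m', fun l hl => hl.elim (fun hl => (hm l hl).mono (le_max_left _ _))
      fun hl => (hm' l hl).mono (le_max_right _ _)⟩
  · intro l hl
    obtain ⟨m, hm⟩ := h l hl
    exact ⟨_, mem_nhdsWithin_of_mem_nhds hm.eventually, m, fun l' hl' => hl'⟩

/-- Over a suitable annulus, `w ^ m * f` is holomorphic near the axis. -/
theorem exists_annulus_analyticOnNhd {f : ℂ × ℂ → ℂ} {m : ℕ} {r₁ r₂ : ℝ} (hr : r₁ < r₂)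
    (hf : ∀ l : ℂ, r₁ ≤ ‖l‖ → ‖l‖ ≤ r₂ → HasAxisPole f m l) :
    ∃ (s₁ s₂ δ C : ℝ) (F : ℂ × ℂ → ℂ), r₁ < s₁ ∧ s₁ < s₂ ∧ s₂ < r₂ ∧ 0 < δ ∧
      AnalyticOnNhd ℂ F (annulus s₁ s₂ ×ˢ ball 0 δ) ∧
      (∀ p ∈ annulus s₁ s₂ ×ˢ ball (0 : ℂ) δ, ‖F p‖ ≤ C) ∧
      ∀ p ∈ annulus s₁ s₂ ×ˢ ball (0 : ℂ) δ, p.2 ^ m ≠ 0 → F p = p.2 ^ m * f p := by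
  classical
  -- the points of the axis near which `w ^ m * f` extends holomorphically: all but isolated ones
  let good : ℂ → Prop := fun l => ∃ G : ℂ × ℂ → ℂ, AnalyticAt ℂ G (l, 0) ∧
    ∀ᶠ p : ℂ × ℂ in 𝓝 (l, 0), p.2 ^ m ≠ 0 → G p = p.2 ^ m * f p
  have hgood : ∀ l, HasAxisPole f m l → ∀ᶠ l' in 𝓝[≠] l, good l' := by
    rintro l ⟨g, h, hg, hh, hne, heq⟩
    filter_upwards [eventually_ne_zero_axis hh hne, ((tendsto_axis l).eventually
      (hg.eventually_analyticAt.and (hh.eventually_analyticAt.and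
        (eventually_eventually_nhds.2 heq)))).filter_mono nhdsWithin_le_nhds] with l' h1 h2
    refine ⟨fun p => g p / h p, h2.1.div h2.2.1 h1, ?_⟩
    filter_upwards [h2.2.2, h2.2.1.continuousAt.eventually_ne h1] with p h3 h4 h5
    rw [h3 (mul_ne_zero h5 h4)]
    field_simp
  have hfin : {l : ℂ | (r₁ ≤ ‖l‖ ∧ ‖l‖ ≤ r₂) ∧ ¬good l}.Finite := by
    by_contra hinf
    obtain ⟨l, hl, hacc⟩ := Set.Infinite.exists_accPt_of_subset_isCompact hinf
      (isCompact_closedAnnulus r₁ r₂) fun l hl => hl.1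
    rw [accPt_iff_frequently_nhdsNE] at hacc
    obtain ⟨l', h1, h2⟩ := (hacc.and_eventually (hgood l (hf l hl.1 hl.2))).exists
    exact h1.2 h2
  obtain ⟨s₁, s₂, h1, h12, h2, havoid⟩ := exists_annulus_avoiding hr (hfin.image fun l => ‖l‖)
  have hgood' : ∀ l : ℂ, s₁ ≤ ‖l‖ → ‖l‖ ≤ s₂ → good l := by
    intro l hl1 hl2
    by_contra hcon
    exact havoid ‖l‖ ⟨l, ⟨⟨h1.le.trans hl1, hl2.trans h2.le⟩, hcon⟩, rfl⟩ ⟨hl1, hl2⟩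
  -- the values on the axis `w = 0` are limits, as those of `f` carry no information
  let F : ℂ × ℂ → ℂ := fun p => if p.2 ^ m ≠ 0 then p.2 ^ m * f p else
    limUnder (𝓝[≠] p.2) fun w => w ^ m * f (p.1, w)
  have hFG : ∀ l, good l → AnalyticAt ℂ F (l, 0) := by
    rintro l ⟨G, hG, hGeq⟩
    refine hG.congr ?_
    filter_upwards [eventually_eventually_nhds.2 hGeq, hG.eventually_analyticAt] with p h3 h4
    by_cases hp : p.2 ^ m ≠ 0
    · simp only [F, if_pos hp]
      exact h3.self_of_nhds hp
    · simp only [F, if_neg hp]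
      have hp0 : p.2 = 0 := eq_zero_of_pow_eq_zero (not_not.1 hp)
      have hline : Tendsto (fun w : ℂ => (p.1, w)) (𝓝 p.2) (𝓝 p) :=
        (continuousAt_const.prodMk continuousAt_id)
      refine (Tendsto.limUnder_eq ?_).symm
      have ht : Tendsto (fun w : ℂ => G (p.1, w)) (𝓝[≠] p.2) (𝓝 (G p)) :=
        (h4.continuousAt.tendsto.comp hline).mono_left nhdsWithin_le_nhds
      refine ht.congr' ?_
      filter_upwards [(hline.eventually h3).filter_mono nhdsWithin_le_nhds, self_mem_nhdsWithin]
        with w hw hw0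
      rw [hp0] at hw0
      exact hw (pow_ne_zero _ hw0)
  set C₀ : Set ℂ := {l | s₁ ≤ ‖l‖ ∧ ‖l‖ ≤ s₂}
  have hC₀ : IsCompact C₀ := isCompact_closedAnnulus s₁ s₂
  have hcont : ContinuousOn (fun l : ℂ => F (l, 0)) C₀ := fun l hl =>
    (analyticAt_axis (hFG l (hgood' l hl.1 hl.2))).continuousAt.continuousWithinAt
  obtain ⟨C, hC⟩ := hC₀.exists_bound_of_continuousOn hcont
  have hnhds : C₀ ×ˢ ({0} : Set ℂ) ⊆ interior {p | AnalyticAt ℂ F p ∧ ‖F p‖ ≤ C + 1} := by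
    rintro ⟨l, w⟩ ⟨hl, hw⟩
    obtain rfl : w = 0 := hw
    have han := hFG l (hgood' l hl.1 hl.2)
    rw [mem_interior_iff_mem_nhds]
    exact han.eventually_analyticAt.and ((han.continuousAt.norm.eventually_lt continuousAt_const
      ((hC l hl).trans_lt (lt_add_one C))).mono fun p hp => hp.le)
  obtain ⟨U, V, -, hV, hCU, h0V, hUV⟩ :=
    generalized_tube_lemma hC₀ isCompact_singleton isOpen_interior hnhds
  obtain ⟨δ, hδ, hδV⟩ := Metric.isOpen_iff.1 hV 0 (h0V rfl)
  have hsub : ∀ p ∈ annulus s₁ s₂ ×ˢ ball (0 : ℂ) δ, AnalyticAt ℂ F p ∧ ‖F p‖ ≤ C + 1 :=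
    fun p hp => (interior_subset (hUV ⟨hCU ⟨hp.1.1.le, hp.1.2.le⟩, hδV hp.2⟩) :
      p ∈ {p | AnalyticAt ℂ F p ∧ ‖F p‖ ≤ C + 1})
  exact ⟨s₁, s₂, δ, C + 1, F, h1, h12, h2, hδ, fun p hp => (hsub p hp).1, fun p hp => (hsub p hp).2,
    fun p _ hp => if_pos hp⟩

/-! ### The problem of one variable that belongs to a test sequence -/

lemma IsTestSequence.analyticOnNhd {ε : ℝ} {φ : ℕ → ℂ → ℂ} {φ₀ : ℂ → ℂ}
    (h : IsTestSequence ε φ φ₀) (k : ℕ) : AnalyticOnNhd ℂ (φ k) (ball 0 (1 + ε)) :=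
  (h.holomorphic k).analyticOnNhd isOpen_ball

lemma IsTestSequence.analyticOnNhd_limit {ε : ℝ} {φ : ℕ → ℂ → ℂ} {φ₀ : ℂ → ℂ}
    (h : IsTestSequence ε φ φ₀) : AnalyticOnNhd ℂ φ₀ (ball 0 (1 + ε)) :=
  (h.tendsto.tendstoLocallyUniformlyOn.differentiableOn (Eventually.of_forall h.holomorphic)
    isOpen_ball).analyticOnNhd isOpen_ball

lemma poleOrder_mul_le {F ψ : ℂ → ℂ} {x : ℂ} (hF : MeromorphicAt F x) (hψ : AnalyticAt ℂ ψ x) :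
    poleOrder (fun l => F l * ψ l) x ≤ poleOrder F x := by
  have h1 : meromorphicOrderAt (fun l => F l * ψ l) x =
      meromorphicOrderAt F x + meromorphicOrderAt ψ x := meromorphicOrderAt_mul hF hψ.meromorphicAt
  have h2 := hψ.meromorphicOrderAt_nonneg
  unfold poleOrder
  rw [h1]
  generalize meromorphicOrderAt F x = a
  generalize meromorphicOrderAt ψ x = b at h2
  cases a with
  | top => simp
  | coe a =>
    cases b with
    | top => simp
    | coe b =>
      have h3 : 0 ≤ b := WithTop.coe_nonneg.1 h2
      rw [← WithTop.coe_add, WithTop.untop₀_coe, WithTop.untop₀_coe]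
      omega

lemma PolesAtMost.mul_analytic {F ψ : ℂ → ℂ} {U V : Set ℂ} {N : ℕ} (h : PolesAtMost F V N)
    (hUV : U ⊆ V) (hF : MeromorphicOn F V) (hψ : AnalyticOnNhd ℂ ψ V) :
    PolesAtMost (fun l => F l * ψ l) U N := fun S hS =>
  (Finset.sum_le_sum fun l hl => poleOrder_mul_le (hF l (hUV (hS hl))) (hψ l (hUV (hS hl)))).trans
    (h S (hS.trans hUV))

/-- The argument principle, in the form of a factorization into a polynomial of bounded degree and
a zero-free function. -/
lemma exists_factorization_of_varArg_le {ψ : ℂ → ℂ} {R V : ℝ} {Z : ℕ} (hR : 1 < R)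
    (hψ : AnalyticOnNhd ℂ ψ (ball 0 R)) (h0 : ∀ x ∈ sphere (0 : ℂ) 1, ψ x ≠ 0)
    (hV : |varArg ψ| ≤ V) (hVZ : V ≤ Z) :
    ∃ (c : Fin Z → ℂ) (v : ℂ → ℂ), (∀ i, ‖c i‖ ≤ 5) ∧ AnalyticOnNhd ℂ v (ball 0 1) ∧
      (∀ x ∈ ball (0 : ℂ) 1, v x ≠ 0) ∧ ∀ x ∈ ball (0 : ℂ) 1, ψ x = (∏ i, (x - c i)) * v x := by
  obtain ⟨T, o, v, hT, hv, hv0, hψv, hvar⟩ := exists_factorization_varArg hR hψ h0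
  have hsum : ∑ l ∈ T, o l ≤ Z := by
    have h1 : 2 * Real.pi * (∑ l ∈ T, o l : ℕ) ≤ V := by
      have := (le_abs_self _).trans hV
      rw [hvar] at this
      exact_mod_cast this
    have h2 : (1 : ℝ) ≤ 2 * Real.pi := by linarith [Real.pi_gt_three]
    have h3 : ((∑ l ∈ T, o l : ℕ) : ℝ) ≤ Z := by
      refine le_trans ?_ (h1.trans hVZ)
      exact le_mul_of_one_le_left (Nat.cast_nonneg _) h2
    exact_mod_cast h3
  obtain ⟨c, hc, hprod⟩ := exists_fin_prod_eq T o hsum 5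
  -- the roots are padded by the point `5`, which lies outside the unit disc
  have hne : ∀ x ∈ ball (0 : ℂ) 1, x - 5 ≠ 0 := by
    intro x hx h
    rw [sub_eq_zero.1 h, mem_ball_zero_iff] at hx
    norm_num at hx
  have hsub : ball (0 : ℂ) 1 ⊆ ball 0 R := ball_subset_ball hR.le
  refine ⟨c, fun x => v x / (x - 5) ^ (Z - ∑ l ∈ T, o l), fun i => ?_, fun x hx => ?_,
    fun x hx => ?_, fun x hx => ?_⟩
  · rcases hc i with h | h
    · have := mem_ball_zero_iff.1 (hT h)
      linarith
    · rw [h]; norm_num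
  · exact (hv x (hsub hx)).div ((analyticAt_id.sub analyticAt_const).pow _)
      (pow_ne_zero _ (hne x hx))
  · exact div_ne_zero (hv0 x (ball_subset_closedBall hx)) (pow_ne_zero _ (hne x hx))
  · have := pow_ne_zero (Z - ∑ l ∈ T, o l) (hne x hx)
    rw [hprod, hψv x (hsub hx)]
    field_simp

/-- A test sequence along which `f` extends with a bounded number of poles gives rise to the
situation of one complex variable that governs the growth of the Taylor coefficients. -/
theorem exists_isExpansion {ε δ C s₁ s₂ : ℝ} {m M : ℕ} {f F : ℂ × ℂ → ℂ} {φ : ℕ → ℂ → ℂ}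
    {φ₀ : ℂ → ℂ} (hε : 0 < ε) (htest : IsTestSequence ε φ φ₀)
    (hext : ∀ k, ExtendsAlongGraph ε (1 + ε) f (φ k) M) (hs₁ : 1 - ε ≤ s₁)
    (hs₂ : s₂ ≤ 1) (hδ : 0 < δ) (hF : AnalyticOnNhd ℂ F (annulus s₁ s₂ ×ˢ ball 0 δ))
    (hFC : ∀ p ∈ annulus s₁ s₂ ×ˢ ball (0 : ℂ) δ, ‖F p‖ ≤ C)
    (hFf : ∀ p ∈ annulus s₁ s₂ ×ˢ ball (0 : ℂ) δ, p.2 ^ m ≠ 0 →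
      F p = p.2 ^ m * f (p.1, p.2 + φ₀ p.1)) :
    ∃ (Z : ℕ) (b : ℕ → Fin M → ℂ) (c : ℕ → Fin Z → ℂ) (H v : ℕ → ℂ → ℂ),
      IsExpansion (hyperfilter ℕ : Filter ℕ) s₁ s₂ b c H v (taylorCoef F) := by
  obtain ⟨V, hV⟩ := htest.varArg_bounded
  have hsmall : ∀ δ > 0, ∀ᶠ k in atTop, ∀ x ∈ ball (0 : ℂ) (1 + ε), ‖φ k x - φ₀ x‖ < δ := by
    intro δ hδ
    filter_upwards [Metric.tendstoUniformlyOn_iff.1 htest.tendsto δ hδ] with k hk x hx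
    have := hk x hx
    rwa [dist_comm, dist_eq_norm] at this
  obtain ⟨k₀, hk₀⟩ := eventually_atTop.1 ((htest.ne_zero.and hV).and (hsmall δ hδ))
  have hball : ball (0 : ℂ) 1 ⊆ ball 0 (1 + ε) := ball_subset_ball (by linarith)
  have hann : annulus s₁ s₂ ⊆ ball 0 1 := fun x hx =>
    ball_subset_ball hs₂ (annulus_subset_ball _ _ hx)
  have hψan : ∀ k, AnalyticOnNhd ℂ (fun l => φ k l - φ₀ l) (ball 0 (1 + ε)) := fun k =>
    (htest.analyticOnNhd k).sub htest.analyticOnNhd_limit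
  choose c v hc hv hv0 hψ using fun k => exists_factorization_of_varArg_le (Z := ⌈V⌉₊)
    (by linarith : 1 < 1 + ε) (hψan (k + k₀)) (hk₀ (k + k₀) (by omega)).1.1
    (hk₀ (k + k₀) (by omega)).1.2 (Nat.le_ceil V)
  choose Fk hFk hrest hpoles using hext
  have hψm : ∀ k, AnalyticOnNhd ℂ (fun l => (φ k l - φ₀ l) ^ m) (ball 0 (1 + ε)) := fun k =>
    (hψan k).pow m
  choose b H hb hH hHF using fun k => exists_clear_poles (d := 5)
    (((hFk (k + k₀)).mul (hψm (k + k₀)).meromorphicOn).mono_set hball)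
    ((hpoles (k + k₀)).mul_analytic hball (hFk (k + k₀)) (hψm (k + k₀)))
  -- only the indices `k + k₀` are used, for which all the bounds hold
  have hle : (hyperfilter ℕ : Filter ℕ) ≤ atTop := Nat.hyperfilter_le_atTop
  have hev : ∀ {p : ℕ → Prop}, (∀ᶠ k in atTop, p k) → ∀ᶠ k in (hyperfilter ℕ : Filter ℕ),
      p (k + k₀) := fun h => ((tendsto_add_atTop_nat k₀).eventually h).filter_mono hle
  have hψδ : ∀ k, ∀ x ∈ annulus s₁ s₂, ‖(∏ i, (x - c k i)) * v k x‖ < δ := fun k x hx => by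
    rw [← hψ k x (hann hx)]
    exact (hk₀ (k + k₀) (by omega)).2 x (hball (hann hx))
  -- on the annulus the cleared extensions are given by `F`
  have hHeq : ∀ k, ∀ x ∈ annulus s₁ s₂,
      H k x = (∏ i, (x - b k i)) * F (x, (∏ i, (x - c k i)) * v k x) := by
    intro k x hx
    have hx1 := hann hx
    have hψx : AnalyticAt ℂ (fun l => φ (k + k₀) l - φ₀ l) x := hψan _ x (hball hx1)
    have hprod : AnalyticAt ℂ (fun l => ∏ i, (l - b k i)) x :=
      Finset.analyticAt_fun_prod _ fun i _ => analyticAt_id.sub analyticAt_const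
    have hFx : AnalyticAt ℂ (fun l => F (l, φ (k + k₀) l - φ₀ l)) x := by
      refine (hF (x, φ (k + k₀) x - φ₀ x) ⟨hx, ?_⟩).fun_comp
        (f := fun l => (l, φ (k + k₀) l - φ₀ l)) (analyticAt_id.prod hψx)
      rw [mem_ball_zero_iff]
      exact (hk₀ (k + k₀) (by omega)).2 x (hball hx1)
    have hψne : ∀ᶠ l in 𝓝[≠] x, φ (k + k₀) l - φ₀ l ≠ 0 := by
      refine hψx.eventually_eq_zero_or_eventually_ne_zero.resolve_left fun h0 => ?_
      have h1 := (hψan (k + k₀)).eqOn_zero_of_preconnected_of_eventuallyEq_zero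
        (convex_ball _ _).isPreconnected (hball hx1) h0
      exact (hk₀ (k + k₀) (by omega)).1.1 1 (by simp) (h1 (by simp [hε]))
    have hxA : x ∈ annulus (1 - ε) (1 + ε) ∩ ball 0 (1 + ε) :=
      ⟨⟨hs₁.trans_lt hx.1, by linarith [hx.2]⟩, hball hx1⟩
    obtain ⟨g, h, hgh, hne, heq⟩ := hrest (k + k₀) x hxA
    have hφx := htest.analyticOnNhd (k + k₀) x (hball hx1)
    have hkey : ∀ᶠ l in 𝓝[≠] x,
        H k l = (∏ i, (l - b k i)) * F (l, φ (k + k₀) l - φ₀ l) := by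
      filter_upwards [hHF k x hx1, hψne, heq, eventually_ne_zero_along_graph hgh.2.1 hφx hne,
        ((tendsto_graph hφx.continuousAt).eventually hgh.2.2.2).filter_mono nhdsWithin_le_nhds,
        mem_nhdsWithin_of_mem_nhds ((isOpen_annulus s₁ s₂).mem_nhds hx)] with l h1 h2 h3 h4 h5 h6
      rw [h1, hFf (l, φ (k + k₀) l - φ₀ l) ⟨h6, ?_⟩ (pow_ne_zero _ h2)]
      · simp only [Pi.mul_apply]
        rw [sub_add_cancel, h5 h4, ← h3, mul_div_cancel_right₀ _ h4]
        ring
      · rw [mem_ball_zero_iff]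
        exact (hk₀ (k + k₀) (by omega)).2 l (hball (hann h6))
    rw [← hψ k x hx1]
    exact (eqOn_of_eventuallyEq_nhdsNE (hH k x hx1) (hprod.mul hFx) hkey).self_of_nhds
  have hsub : ball (0 : ℂ) s₂ ⊆ ball 0 1 := ball_subset_ball hs₂
  refine ⟨⌈V⌉₊, b, c, H, v, fun k i => ?_, hc, fun k => (hH k).mono hsub, fun k => (hv k).mono hsub,
    fun k x hx => hv0 k x (hsub hx), fun n => analyticOnNhd_taylorCoef (isOpen_annulus _ _) hδ hF n,
    fun n => ⟨C * (3 / δ) ^ n, fun x hx => norm_taylorCoef_le (isOpen_annulus _ _) hδ hF hFC n hx⟩,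
    fun η hη => ?_, fun n => ?_⟩
  · rcases hb k i with h | h
    · have := mem_ball_zero_iff.1 h
      linarith
    · rw [h]; norm_num
  · filter_upwards [hev (hsmall η hη)] with k hk x hx
    rw [← hψ k x (hann hx)]
    exact (hk x (hball (hann hx))).le
  · refine ⟨6 ^ M * (C * (3 / δ) ^ n), Eventually.of_forall fun k x hx => ?_⟩
    have hmem : (x, (∏ i, (x - c k i)) * v k x) ∈ annulus s₁ s₂ ×ˢ ball (0 : ℂ) δ :=
      ⟨hx, mem_ball_zero_iff.2 (hψδ k x hx)⟩
    rw [hHeq k x hx, eq_sum_taylorCoef_add F n, mul_add, add_sub_cancel_left, norm_mul, norm_mul,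
      norm_pow]
    have h1 : ‖∏ i, (x - b k i)‖ ≤ 6 ^ M := by
      refine norm_prod_sub_le fun i => (norm_sub_le _ _).trans ?_
      have h2 := mem_ball_zero_iff.1 (hann hx)
      rcases hb k i with h | h
      · have := mem_ball_zero_iff.1 h
        linarith
      · rw [h]; norm_num; linarith
    have h2 := norm_taylorTail_le (isOpen_annulus _ _) hδ hF hFC n _ hmem
    calc _ ≤ 6 ^ M * (‖(∏ i, (x - c k i)) * v k x‖ ^ n * (C * (3 / δ) ^ n)) := by gcongr
      _ = _ := by ring

/-! ### Blowing up the pinches -/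

/-- If the Taylor coefficients of `F` along the axis have poles of order at most `K * (n + 1)` at
the zeros of `B`, then `B ^ K * F` is holomorphic in the coordinates `l` and `y = w / B ^ K`, over
the whole disc. -/
theorem exists_blowup {s₁ s₂ δ C : ℝ} {F : ℂ × ℂ → ℂ} {B : ℂ → ℂ} {β : ℝ} {K : ℕ} (hs : s₁ < s₂)
    (hδ : 0 < δ) (hF : AnalyticOnNhd ℂ F (annulus s₁ s₂ ×ˢ ball 0 δ))
    (hFC : ∀ p ∈ annulus s₁ s₂ ×ˢ ball (0 : ℂ) δ, ‖F p‖ ≤ C) (hβ : 0 < β)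
    (hBβ : ∀ l ∈ annulus s₁ s₂, ‖B l‖ ≤ β)
    (hcoef : ∀ n, ∃ g, AnalyticOnNhd ℂ g (ball 0 s₂) ∧ ∀ l ∈ annulus s₁ s₂,
      g l = B l ^ (K * (n + 1)) * taylorCoef F n l) :
    ∃ (c : ℝ) (Φ : ℂ × ℂ → ℂ), 0 < c ∧ AnalyticOnNhd ℂ Φ (ball 0 s₂ ×ˢ ball 0 c) ∧
      ∀ l ∈ annulus s₁ s₂, ∀ y ∈ ball (0 : ℂ) c,
        B l ^ K * y ∈ ball 0 δ ∧ Φ (l, y) = B l ^ K * F (l, B l ^ K * y) := by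
  choose g hg hgF using hcoef
  set b := β ^ K with hb
  have hb0 : 0 < b := by positivity
  have hBb : ∀ l ∈ annulus s₁ s₂, ‖B l ^ K‖ ≤ b := fun l hl => by
    rw [norm_pow]
    exact pow_le_pow_left₀ (norm_nonneg _) (hBβ l hl) K
  set q := 3 * b / δ with hq
  have hq0 : 0 < q := by positivity
  set c := 1 / (2 * q) with hc
  have hc0 : 0 < c := by positivity
  have hqc : q * c = 1 / 2 := by rw [hc]; field_simp
  -- Cauchy's estimates on the annulus and the maximum principle
  have hgle : ∀ n, ∀ l ∈ ball (0 : ℂ) s₂, ‖g n l‖ ≤ b * |C| * q ^ n := by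
    intro n
    refine norm_le_of_forall_mem_annulus hs (hg n) fun l hl => ?_
    have h1 := norm_taylorCoef_le (isOpen_annulus _ _) hδ hF hFC n hl
    rw [hgF n l hl, norm_mul, pow_mul, norm_pow]
    calc _ ≤ b ^ (n + 1) * (|C| * (3 / δ) ^ n) := by
          refine mul_le_mul (pow_le_pow_left₀ (norm_nonneg _) (hBb l hl) _) (h1.trans ?_)
            (norm_nonneg _) (by positivity)
          gcongr
          exact le_abs_self C
      _ = b * |C| * q ^ n := by rw [hq, pow_succ, mul_div_right_comm, mul_pow]; ring
  set u : ℕ → ℝ := fun n => b * |C| * (1 / 2) ^ n with hu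
  have hus : Summable u := summable_geometric_two.mul_left _
  have hterm : ∀ n, ∀ l ∈ ball (0 : ℂ) s₂, ∀ y ∈ ball (0 : ℂ) c, ‖g n l * y ^ n‖ ≤ u n := by
    intro n l hl y hy
    rw [mem_ball_zero_iff] at hy
    rw [norm_mul, norm_pow]
    calc _ ≤ b * |C| * q ^ n * c ^ n := by
          gcongr
          exact hgle n l hl
      _ = u n := by rw [hu]; simp only; rw [← hqc, mul_pow]; ring
  refine ⟨c, fun p => ∑' n, g n p.1 * p.2 ^ n, hc0, ?_, fun l hl y hy => ?_⟩
  · refine analyticOnNhd_of_continuousOn_of_separately isOpen_ball isOpen_ball ?_ ?_ ?_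
    · refine continuousOn_tsum (fun n => ?_) hus fun n p hp => hterm n p.1 hp.1 p.2 hp.2
      exact ((hg n).continuousOn.comp continuousOn_fst fun p hp => hp.1).mul
        (continuousOn_snd.pow n)
    · intro y hy
      exact Complex.differentiableOn_tsum_of_summable_norm hus
        (fun n => (hg n).differentiableOn.mul_const (y ^ n)) isOpen_ball
        fun n l hl => hterm n l hl y hy
    · intro l hl
      exact Complex.differentiableOn_tsum_of_summable_norm hus
        (fun n => (differentiableOn_pow n).const_mul (g n l)) isOpen_ball
        fun n y hy => hterm n l hl y hy
  -- over the annulus the series is the rescaled Taylor series of `F`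
  · have hlb := annulus_subset_ball _ _ hl
    have hyn := mem_ball_zero_iff.1 hy
    set w := B l ^ K * y with hw
    have hwq : ‖w‖ * (3 / δ) ≤ 1 / 2 := by
      rw [hw, norm_mul, ← hqc, hq]
      calc ‖B l ^ K‖ * ‖y‖ * (3 / δ) ≤ b * c * (3 / δ) := by
            gcongr
            exact hBb l hl
        _ = _ := by ring
    have hwδ : w ∈ ball (0 : ℂ) δ := by
      rw [mem_ball_zero_iff]
      rw [mul_div_assoc', div_le_iff₀ hδ] at hwq
      linarith
    refine ⟨hwδ, ?_⟩
    have hsum : Summable fun n => g n l * y ^ n :=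
      Summable.of_norm_bounded hus fun n => hterm n l hlb y hy
    refine tendsto_nhds_unique hsum.hasSum.tendsto_sum_nat ?_
    have hpart : ∀ n, ∑ j ∈ Finset.range n, g j l * y ^ j =
        B l ^ K * F (l, w) - B l ^ K * (w ^ n * taylorTail F n (l, w)) := by
      intro n
      rw [eq_sum_taylorCoef_add F n l w, mul_add, add_sub_cancel_right, Finset.mul_sum]
      refine Finset.sum_congr rfl fun j _ => ?_
      rw [hgF j l hl, hw, mul_pow, pow_mul, pow_succ]
      ring
    have hlim : Tendsto (fun n => B l ^ K * (w ^ n * taylorTail F n (l, w))) atTop (𝓝 0) := by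
      refine squeeze_zero_norm (a := u) (fun n => ?_) hus.tendsto_atTop_zero
      have h1 := norm_taylorTail_le (isOpen_annulus _ _) hδ hF hFC n (l, w) ⟨hl, hwδ⟩
      rw [norm_mul, norm_mul, norm_pow w]
      calc _ ≤ b * (‖w‖ ^ n * (|C| * (3 / δ) ^ n)) := by
            refine mul_le_mul (hBb l hl) (mul_le_mul_of_nonneg_left (h1.trans ?_) (by positivity))
              (by positivity) hb0.le
            gcongr
            exact le_abs_self C
        _ = b * |C| * (‖w‖ * (3 / δ)) ^ n := by rw [mul_pow]; ring
        _ ≤ u n := by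
            rw [hu]
            simp only
            gcongr
    have := hlim.const_sub (B l ^ K * F (l, w))
    rw [sub_zero] at this
    exact this.congr fun n => (hpart n).symm

/-! ### Uniform bounds for the number of poles -/

/-- A bound for the number of zeros of `h (·, χ)`, uniform in the function `χ`, near a point of the
axis. The numbers `o l` are lower bounds for the orders of the zeros. -/
lemma exists_zero_bound {f : ℂ × ℂ → ℂ} {m : ℕ} {l₀ : ℂ} {U : Set ℂ} (H : HasAxisPole f m l₀)
    (hU : U ∈ 𝓝 l₀) :
    ∃ (N : ℕ) (δ : ℝ), 0 < δ ∧ ∃ V, IsOpen V ∧ l₀ ∈ V ∧ V ⊆ U ∧ ∃ g h : ℂ × ℂ → ℂ,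
      AnalyticOnNhd ℂ g (V ×ˢ ball 0 δ) ∧ AnalyticOnNhd ℂ h (V ×ˢ ball 0 δ) ∧
      (∀ p ∈ V ×ˢ ball (0 : ℂ) δ, p.2 ^ m * h p ≠ 0 → f p = g p / (p.2 ^ m * h p)) ∧
      ∀ χ : ℂ → ℂ, AnalyticOnNhd ℂ χ U → (∀ l ∈ U, ‖χ l‖ < δ) →
        (∀ l ∈ V, ∀ᶠ l' in 𝓝[≠] l, h (l', χ l') ≠ 0) ∧
        ∀ S : Finset ℂ, (S : Set ℂ) ⊆ V → ∀ o : ℂ → ℕ,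
          (∀ l ∈ S, (o l : ℕ∞) ≤ analyticOrderAt (fun l => h (l, χ l)) l) → ∑ l ∈ S, o l ≤ N := by
  obtain ⟨g, h, hg, hh, hne, heq⟩ := H
  obtain ⟨ρ₁, hρ₁, hgan, hsub₁, -⟩ := exists_polydisc_of_analyticAt hg
    ((continuousAt_fst.preimage_mem_nhds hU : (fun p : ℂ × ℂ => p.1) ⁻¹' U ∈ 𝓝 (l₀, (0 : ℂ))))
  obtain ⟨ρ, hρ, hhan, hsub, C, hC⟩ := exists_polydisc_of_analyticAt hh
    (inter_mem heq (prod_mem_nhds (ball_mem_nhds l₀ hρ₁) (ball_mem_nhds (0 : ℂ) hρ₁)))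
  -- a centre `l₁` close to `l₀` where `h` does not vanish on the axis
  obtain ⟨l₁, hl₁, hl₁b⟩ :=
    (hne.and_eventually (ball_mem_nhds l₀ (by positivity : 0 < ρ / 8))).exists
  rw [dist_eq_norm] at hl₁b
  have hb1 : ball l₁ (7 * ρ / 8) ⊆ ball l₀ ρ := ball_subset_ball' (by
    rw [dist_eq_norm]; linarith)
  have hb2 : ball l₁ (ρ / 4) ⊆ ball l₁ (7 * ρ / 8) := ball_subset_ball (by linarith)
  have hl₁mem : l₁ ∈ ball l₀ ρ := hb1 (mem_ball_self (by positivity))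
  set d := ‖h (l₁, 0)‖ / 2 with hd
  have hd0 : 0 < d := half_pos (norm_pos_iff.2 hl₁)
  have hcont : ContinuousAt (fun w => ‖h (l₁, w)‖) 0 :=
    ((hhan (l₁, 0) ⟨hl₁mem, mem_ball_self hρ⟩).continuousAt.comp'
      (f := fun w : ℂ => (l₁, w)) (continuousAt_const.prodMk continuousAt_id)).norm
  obtain ⟨δ₁, hδ₁, hδ₁d⟩ := Metric.eventually_nhds_iff_ball.1
    (hcont.eventually (lt_mem_nhds (half_lt_self (norm_pos_iff.2 hl₁))))
  set δ := min δ₁ ρ with hδ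
  have hδ0 : 0 < δ := lt_min hδ₁ hρ
  have hVU : ball l₀ ρ ⊆ U := fun l hl =>
    (hsub₁ (hsub (mk_mem_prod hl (mem_ball_self hρ))).2 :
      (l, (0 : ℂ)) ∈ (fun p : ℂ × ℂ => p.1) ⁻¹' U)
  obtain ⟨N, hN⟩ : ∃ N : ℕ, C / d < 2 ^ N := pow_unbounded_of_one_lt _ one_lt_two
  have hδρ : ball (0 : ℂ) δ ⊆ ball 0 ρ := ball_subset_ball (min_le_right _ _)
  have hprod : ball l₁ (ρ / 4) ×ˢ ball (0 : ℂ) δ ⊆ ball l₀ ρ ×ˢ ball 0 ρ :=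
    prod_mono (hb2.trans hb1) hδρ
  refine ⟨N, δ, hδ0, ball l₁ (ρ / 4), isOpen_ball, ?_, (hb2.trans hb1).trans hVU, g, h,
    fun p hp => hgan p (hsub (hprod hp)).2, hhan.mono hprod, fun p hp => (hsub (hprod hp)).1,
    fun χ hχ hχδ => ?_⟩
  · rw [mem_ball, dist_eq_norm, norm_sub_rev]
    linarith
  have hχmem : ∀ l ∈ ball l₀ ρ, (l, χ l) ∈ ball l₀ ρ ×ˢ ball (0 : ℂ) ρ := fun l hl =>
    ⟨hl, hδρ (mem_ball_zero_iff.2 (hχδ l (hVU hl)))⟩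
  have han : AnalyticOnNhd ℂ (fun l => h (l, χ l)) (ball l₀ ρ) := fun l hl =>
    analyticAt_along_graph (hhan _ (hχmem l hl)) (hχ l (hVU hl))
  -- the function `h (·, χ)` is not small at the centre, uniformly in `χ`
  have hdl : d < ‖h (l₁, χ l₁)‖ :=
    hδ₁d _ (mem_ball_zero_iff.2 ((hχδ l₁ (hVU hl₁mem)).trans_le (min_le_left _ _)))
  refine ⟨fun l hl => ?_, fun S hS o ho => ?_⟩
  · refine (han l (hb1 (hb2 hl))).eventually_eq_zero_or_eventually_ne_zero.resolve_left fun h0 => ?_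
    have := han.eqOn_zero_of_preconnected_of_eventuallyEq_zero (convex_ball _ _).isPreconnected
      (hb1 (hb2 hl)) h0 hl₁mem
    simp only [Pi.zero_apply] at this
    rw [this, norm_zero] at hdl
    exact absurd hdl (not_lt.2 hd0.le)
  · have h1 := two_pow_sum_order_mul_le (by positivity : 0 < ρ / 4) (by linarith) (han.mono hb1)
      (fun x hx => hC _ (hχmem x (hb1 hx))) hdl.le S hS o ho
    have h2 : (2 : ℝ) ^ (∑ l ∈ S, o l) < 2 ^ N := ((le_div_iff₀ hd0).2 h1).trans_lt hN
    exact ((pow_lt_pow_iff_right₀ one_lt_two).1 h2).le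

/-- The order of the pole of a quotient is at most the order of the zero of its denominator. -/
lemma poleOrder_le_analyticOrderAt {G h a : ℂ → ℂ} {l : ℂ} (hG : MeromorphicAt G l)
    (hh : AnalyticAt ℂ h l) (ha : AnalyticAt ℂ a l) (heq : ∀ᶠ x in 𝓝[≠] l, G x * h x = a x) :
    (poleOrder G l : ℕ∞) ≤ analyticOrderAt h l := by
  have h1 : meromorphicOrderAt G l + meromorphicOrderAt h l = meromorphicOrderAt a l := by
    rw [← meromorphicOrderAt_mul hG hh.meromorphicAt]
    exact meromorphicOrderAt_congr heq
  have h2 := ha.meromorphicOrderAt_nonneg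
  rw [← h1, AnalyticAt.meromorphicOrderAt_eq hh] at h2
  unfold poleOrder
  generalize meromorphicOrderAt G l = x at h2
  generalize analyticOrderAt h l = y at h2
  cases x with
  | top => simp
  | coe x =>
    cases y with
    | top => simp
    | coe y =>
      have h3 : (0 : ℤ) ≤ x + y := by
        have : (0 : WithTop ℤ) ≤ ((x + (y : ℤ) : ℤ) : WithTop ℤ) := h2
        exact WithTop.coe_nonneg.1 this
      rw [WithTop.untop₀_coe]
      have h4 : (-x).toNat ≤ y := by omega
      exact_mod_cast h4

/-- Over a compact part of the axis, the number of poles of the restriction of `f` to a graph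
`w = χ l` close to the axis is bounded, uniformly in `χ`. -/
theorem exists_pole_bound_of_isCompact {f : ℂ × ℂ → ℂ} {m : ℕ} {K U : Set ℂ} (hK : IsCompact K)
    (hU : IsOpen U) (hKU : K ⊆ U) (H : ∀ l ∈ K, HasAxisPole f m l) :
    ∃ (N : ℕ) (δ : ℝ), 0 < δ ∧ ∀ χ : ℂ → ℂ, AnalyticOnNhd ℂ χ U → (∀ l ∈ U, ‖χ l‖ < δ) →
      (∀ l ∈ K, χ l ^ m ≠ 0) → MeromorphicOn (fun l => f (l, χ l)) K ∧
        PolesAtMost (fun l => f (l, χ l)) K N := by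
  classical
  suffices h : ∃ (N : ℕ) (δ : ℝ), 0 < δ ∧ ∀ χ : ℂ → ℂ, AnalyticOnNhd ℂ χ U →
      (∀ l ∈ U, ‖χ l‖ < δ) → (∀ l ∈ K, χ l ^ m ≠ 0 → MeromorphicAt (fun l => f (l, χ l)) l) ∧
        ∀ T : Finset ℂ, (T : Set ℂ) ⊆ K → (∀ l ∈ T, χ l ^ m ≠ 0) →
          ∑ l ∈ T, poleOrder (fun l => f (l, χ l)) l ≤ N by
    obtain ⟨N, δ, hδ, h⟩ := h
    refine ⟨N, δ, hδ, fun χ h1 h2 h3 => ⟨fun l hl => (h χ h1 h2).1 l hl (h3 l hl), fun T hT => ?_⟩⟩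
    exact (h χ h1 h2).2 T hT fun l hl => h3 l (hT hl)
  refine hK.induction_on (p := fun S => ∃ (N : ℕ) (δ : ℝ), 0 < δ ∧ ∀ χ : ℂ → ℂ,
    AnalyticOnNhd ℂ χ U → (∀ l ∈ U, ‖χ l‖ < δ) →
      (∀ l ∈ S, χ l ^ m ≠ 0 → MeromorphicAt (fun l => f (l, χ l)) l) ∧
        ∀ T : Finset ℂ, (T : Set ℂ) ⊆ S → (∀ l ∈ T, χ l ^ m ≠ 0) →
          ∑ l ∈ T, poleOrder (fun l => f (l, χ l)) l ≤ N) ?_ ?_ ?_ ?_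
  · refine ⟨0, 1, one_pos, fun χ _ _ => ⟨by simp, fun T hT _ => ?_⟩⟩
    rw [Finset.coe_eq_empty.1 (subset_empty_iff.1 hT), Finset.sum_empty]
  · rintro S S' hS ⟨N, δ, hδ, h⟩
    exact ⟨N, δ, hδ, fun χ h1 h2 => ⟨fun l hl => (h χ h1 h2).1 l (hS hl),
      fun T hT => (h χ h1 h2).2 T (hT.trans hS)⟩⟩
  · rintro S S' ⟨N, δ, hδ, h⟩ ⟨N', δ', hδ', h'⟩
    refine ⟨N + N', min δ δ', lt_min hδ hδ', fun χ h1 h2 => ?_⟩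
    have k := h χ h1 fun l hl => (h2 l hl).trans_le (min_le_left _ _)
    have k' := h' χ h1 fun l hl => (h2 l hl).trans_le (min_le_right _ _)
    refine ⟨fun l hl => hl.elim (k.1 l) (k'.1 l), fun T hT hTm => ?_⟩
    rw [← Finset.sum_filter_add_sum_filter_not T (· ∈ S)]
    refine add_le_add (k.2 _ (fun l hl => (Finset.mem_filter.1 hl).2)
      fun l hl => hTm l (Finset.mem_filter.1 hl).1) (k'.2 _ (fun l hl => ?_)
        fun l hl => hTm l (Finset.mem_filter.1 hl).1)
    have hl' := Finset.mem_filter.1 hl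
    exact (hT hl'.1).resolve_left hl'.2
  · intro l₀ hl₀
    obtain ⟨N, δ, hδ, V, hV, hl₀V, hVU, g, h, hg, hh, heq, hχ⟩ :=
      exists_zero_bound (H l₀ hl₀) (hU.mem_nhds (hKU hl₀))
    refine ⟨V, mem_nhdsWithin_of_mem_nhds (hV.mem_nhds hl₀V), N, δ, hδ, fun χ h1 h2 => ?_⟩
    obtain ⟨k1, k2⟩ := hχ χ h1 h2
    have hmem : ∀ l ∈ V, (l, χ l) ∈ V ×ˢ ball (0 : ℂ) δ := fun l hl =>
      ⟨hl, mem_ball_zero_iff.2 (h2 l (hVU hl))⟩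
    have hga : ∀ l ∈ V, AnalyticAt ℂ (fun l => g (l, χ l)) l := fun l hl =>
      analyticAt_along_graph (hg _ (hmem l hl)) (h1 l (hVU hl))
    have hha : ∀ l ∈ V, AnalyticAt ℂ (fun l => h (l, χ l)) l := fun l hl =>
      analyticAt_along_graph (hh _ (hmem l hl)) (h1 l (hVU hl))
    have hloc : ∀ l ∈ V, χ l ^ m ≠ 0 → ∀ᶠ x in 𝓝[≠] l,
        f (x, χ x) = g (x, χ x) / (χ x ^ m * h (x, χ x)) ∧ χ x ^ m ≠ 0 ∧ h (x, χ x) ≠ 0 := by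
      intro l hl hm
      filter_upwards [k1 l hl, mem_nhdsWithin_of_mem_nhds (hV.mem_nhds hl),
        (((h1 l (hVU hl)).pow m).continuousAt.eventually_ne hm).filter_mono nhdsWithin_le_nhds]
        with x h3 h4 h5
      exact ⟨heq _ (hmem x h4) (mul_ne_zero h5 h3), h5, h3⟩
    have hmer : ∀ l ∈ V, χ l ^ m ≠ 0 → MeromorphicAt (fun l => f (l, χ l)) l := by
      intro l hl hm
      have h3 : MeromorphicAt (fun x => g (x, χ x) / (χ x ^ m * h (x, χ x))) l :=
        (hga l hl).meromorphicAt.div (((h1 l (hVU hl)).pow m).mul (hha l hl)).meromorphicAt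
      exact h3.congr ((hloc l hl hm).mono fun x hx => hx.1.symm)
    refine ⟨hmer, fun T hT hTm => k2 T hT _ fun l hl => ?_⟩
    have hlm := hTm l hl
    refine poleOrder_le_analyticOrderAt (hmer l (hT hl) hlm) (hha l (hT hl))
      ((hga l (hT hl)).div ((h1 l (hVU (hT hl))).pow m) hlm) ?_
    filter_upwards [hloc l (hT hl) hlm] with x hx
    rw [hx.1]
    simp only [Pi.div_apply, Pi.pow_apply]
    have := hx.2.1
    have := hx.2.2
    field_simp

/-! ### The extension to the pinched domain -/

/-- The function given by `(z - φ₀ l) ^ (-m) * Φ (l, y) / b l`, where `y = (z - φ₀ l) / b l`, over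
the disc of radius `t`, and by `f` elsewhere. -/
noncomputable def pinchExtension (t : ℝ) (m : ℕ) (φ₀ b : ℂ → ℂ) (Φ f : ℂ × ℂ → ℂ) (p : ℂ × ℂ) : ℂ :=
  open Classical in
  if ‖p.1‖ < t then ((p.2 - φ₀ p.1) ^ m)⁻¹ * (b p.1)⁻¹ * Φ (p.1, (p.2 - φ₀ p.1) / b p.1) else f p

/-- The situation in which the two definitions of `pinchExtension` match over the annulus
`t₁ < |l| < t₂`: there `Φ (l, y)` is `b l * w ^ m * f (l, w + φ₀ l)` with `w = b l * y`. -/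
structure IsPinchData (ε r : ℝ) (f Φ : ℂ × ℂ → ℂ) (φ₀ b : ℂ → ℂ) (Λ : Finset ℂ) (t₁ t₂ c : ℝ)
    (m : ℕ) (κ : ℂ) (ρ : ℝ) : Prop where
  meromorphic : IsMeromorphicOnTwo f (ringDomain ε)
  analytic_φ₀ : AnalyticOnNhd ℂ φ₀ (ball 0 r)
  analytic_b : AnalyticOnNhd ℂ b (ball 0 r)
  b_eq_zero_iff : ∀ l ∈ ball (0 : ℂ) r, b l = 0 ↔ l ∈ Λ
  Λ_subset : (Λ : Set ℂ) ⊆ ball 0 t₁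
  le_t₁ : 1 - ε ≤ t₁
  t₁_pos : 0 < t₁
  t₁_lt_t₂ : t₁ < t₂
  t₂_le : t₂ ≤ r
  r_le : r ≤ 1 + ε
  ρ_pos : 0 < ρ
  analytic_Φ : AnalyticOnNhd ℂ Φ (ball 0 t₂ ×ˢ ball 0 c)
  Φ_eq : ∀ l ∈ annulus t₁ t₂, ∀ y ∈ ball (0 : ℂ) c, (b l * y) ^ m ≠ 0 →
    Φ (l, y) = b l * ((b l * y) ^ m * f (l, b l * y + φ₀ l))
  mem_of_norm_sub_lt : ∀ y, ‖y - κ‖ < ρ → y ∈ ball (0 : ℂ) c ∧ y ^ m ≠ 0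
  snd_mem : ∀ p ∈ pinchSet φ₀ b (ball 0 r) κ ρ, p.2 ∈ ball (0 : ℂ) 1

namespace IsPinchData

variable {ε r t t₁ t₂ c ρ : ℝ} {f Φ : ℂ × ℂ → ℂ} {φ₀ b : ℂ → ℂ} {Λ : Finset ℂ} {m : ℕ} {κ : ℂ}

lemma isOpen (h : IsPinchData ε r f Φ φ₀ b Λ t₁ t₂ c m κ ρ) :
    IsOpen (pinchSet φ₀ b (ball 0 r) κ ρ) :=
  isOpen_pinchSet isOpen_ball h.analytic_φ₀.continuousOn h.analytic_b.continuousOn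

lemma mem_ringDomain (h : IsPinchData ε r f Φ φ₀ b Λ t₁ t₂ c m κ ρ) {p : ℂ × ℂ}
    (hp : p ∈ pinchSet φ₀ b (ball 0 r) κ ρ) (hp1 : 1 - ε < ‖p.1‖) : p ∈ ringDomain ε :=
  ⟨⟨hp1, (mem_ball_zero_iff.1 hp.1).trans_le h.r_le⟩, h.snd_mem p hp⟩

lemma sub_pow_ne_zero (h : IsPinchData ε r f Φ φ₀ b Λ t₁ t₂ c m κ ρ) {p : ℂ × ℂ}
    (hp : p ∈ pinchSet φ₀ b (ball 0 r) κ ρ) : (p.2 - φ₀ p.1) ^ m ≠ 0 := by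
  have h1 := (h.mem_of_norm_sub_lt _ hp.2.2).2
  rw [div_pow] at h1
  exact fun h0 => h1 (by rw [h0, zero_div])

lemma extension_eq (h : IsPinchData ε r f Φ φ₀ b Λ t₁ t₂ c m κ ρ) {p : ℂ × ℂ}
    (hp : p ∈ pinchSet φ₀ b (ball 0 r) κ ρ) (hp1 : t₁ < ‖p.1‖) (ht : t ≤ t₂) :
    pinchExtension t m φ₀ b Φ f p = f p := by
  unfold pinchExtension
  split_ifs with hpt
  · have hy := h.mem_of_norm_sub_lt _ hp.2.2
    have hby : b p.1 * ((p.2 - φ₀ p.1) / b p.1) = p.2 - φ₀ p.1 := mul_div_cancel₀ _ hp.2.1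
    have hw := h.sub_pow_ne_zero hp
    rw [h.Φ_eq p.1 ⟨hp1, hpt.trans_le ht⟩ _ hy.1 (by rwa [hby]), hby, sub_add_cancel]
    have := hp.2.1
    field_simp
  · rfl

lemma extension_eventuallyEq (h : IsPinchData ε r f Φ φ₀ b Λ t₁ t₂ c m κ ρ) {p : ℂ × ℂ}
    (hp : p ∈ pinchSet φ₀ b (ball 0 r) κ ρ) (hp1 : t₁ < ‖p.1‖) (ht : t ≤ t₂) :
    pinchExtension t m φ₀ b Φ f =ᶠ[𝓝 p] f := by
  filter_upwards [h.isOpen.mem_nhds hp,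
    continuous_fst.norm.continuousAt.eventually (lt_mem_nhds hp1)] with q hq hq1
  exact h.extension_eq hq hq1 ht

lemma analyticAt_extension (h : IsPinchData ε r f Φ φ₀ b Λ t₁ t₂ c m κ ρ) {p : ℂ × ℂ}
    (hp : p ∈ pinchSet φ₀ b (ball 0 r) κ ρ) (hp1 : ‖p.1‖ < t) (ht : t ≤ t₂) :
    AnalyticAt ℂ (pinchExtension t m φ₀ b Φ f) p := by
  have hφ : AnalyticAt ℂ (fun p : ℂ × ℂ => φ₀ p.1) p :=
    (h.analytic_φ₀ p.1 hp.1).fun_comp (f := fun p : ℂ × ℂ => p.1) analyticAt_fst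
  have hb : AnalyticAt ℂ (fun p : ℂ × ℂ => b p.1) p :=
    (h.analytic_b p.1 hp.1).fun_comp (f := fun p : ℂ × ℂ => p.1) analyticAt_fst
  have hy := h.mem_of_norm_sub_lt _ hp.2.2
  have hΦ : AnalyticAt ℂ (fun p : ℂ × ℂ => Φ (p.1, (p.2 - φ₀ p.1) / b p.1)) p :=
    (h.analytic_Φ (p.1, (p.2 - φ₀ p.1) / b p.1)
      ⟨mem_ball_zero_iff.2 (hp1.trans_le ht), hy.1⟩).fun_comp
      (f := fun p : ℂ × ℂ => (p.1, (p.2 - φ₀ p.1) / b p.1))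
      (analyticAt_fst.prod ((analyticAt_snd.sub hφ).div hb hp.2.1))
  refine AnalyticAt.congr (((((analyticAt_snd.sub hφ).pow m).inv (h.sub_pow_ne_zero hp)).mul
    (hb.inv hp.2.1)).mul hΦ) ?_
  filter_upwards [continuous_fst.norm.continuousAt.eventually (gt_mem_nhds hp1)] with q hq
  unfold pinchExtension
  rw [if_pos hq]
  rfl

lemma isMeromorphicOnTwo_extension (h : IsPinchData ε r f Φ φ₀ b Λ t₁ t₂ c m κ ρ) (h1t : t₁ < t)
    (ht : t ≤ t₂) :
    IsMeromorphicOnTwo (pinchExtension t m φ₀ b Φ f) (pinchSet φ₀ b (ball 0 r) κ ρ) := by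
  intro p hp
  rcases lt_or_ge ‖p.1‖ t with hpt | hpt
  · exact ⟨_, _, isQuotientAt_of_analyticAt (h.analyticAt_extension hp hpt ht)⟩
  · obtain ⟨g, k, hgk⟩ := h.meromorphic p
      (h.mem_ringDomain hp (h.le_t₁.trans_lt (h1t.trans_le hpt)))
    exact ⟨g, k, hgk.congr (h.extension_eventuallyEq hp (h1t.trans_le hpt) ht).symm⟩

/-- The extension and `f` are equal as germs, by the identity theorem on the part of the pinched
domain over `1 - ε < |l| < t₂`. -/
lemma frequently_eventuallyEq (h : IsPinchData ε r f Φ φ₀ b Λ t₁ t₂ c m κ ρ) (h1t : t₁ < t)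
    (ht : t ≤ t₂) {p : ℂ × ℂ} (hp : p ∈ pinchSet φ₀ b (ball 0 r) κ ρ) (hpr : 1 - ε < ‖p.1‖) :
    ∃ᶠ q in 𝓝 p, pinchExtension t m φ₀ b Φ f =ᶠ[𝓝 q] f := by
  rcases lt_or_ge t₁ ‖p.1‖ with hp1 | hp1
  · exact (eventually_eventually_nhds.2 (h.extension_eventuallyEq hp hp1 ht)).frequently
  have hsub : annulus (1 - ε) t₂ ⊆ ball 0 r := fun l hl =>
    ball_subset_ball h.t₂_le (annulus_subset_ball _ _ hl)
  have hΩ : IsPreconnected (pinchSet φ₀ b (annulus (1 - ε) t₂) κ ρ) :=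
    isPreconnected_pinchSet (isOpen_annulus _ _) (isPreconnected_annulus _ _)
      (h.analytic_φ₀.continuousOn.mono hsub) (h.analytic_b.continuousOn.mono hsub)
      fun l hl => h.b_eq_zero_iff l (hsub hl)
  have hΩP : pinchSet φ₀ b (annulus (1 - ε) t₂) κ ρ ⊆ pinchSet φ₀ b (ball 0 r) κ ρ :=
    fun q hq => ⟨hsub hq.1, hq.2⟩
  obtain ⟨x, hx1, hx2⟩ := exists_between h.t₁_lt_t₂
  have hxn : ‖(x : ℂ)‖ = x := by
    rw [Complex.norm_real, Real.norm_of_nonneg (h.t₁_pos.trans hx1).le]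
  have hxA : (x : ℂ) ∈ annulus (1 - ε) t₂ := ⟨by rw [hxn]; exact h.le_t₁.trans_lt hx1, by rwa [hxn]⟩
  have hbx : b x ≠ 0 := fun h0 => by
    have := mem_ball_zero_iff.1 (h.Λ_subset ((h.b_eq_zero_iff _ (hsub hxA)).1 h0))
    rw [hxn] at this
    exact absurd this (not_lt.2 hx1.le)
  have hx : ((x : ℂ), φ₀ x + b x * κ) ∈ pinchSet φ₀ b (annulus (1 - ε) t₂) κ ρ := by
    refine ⟨hxA, hbx, ?_⟩
    simp only
    rw [add_sub_cancel_left, mul_div_cancel_left₀ _ hbx, sub_self, norm_zero]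
    exact h.ρ_pos
  refine frequently_eventuallyEq_of_isPreconnected hΩ
    (fun q hq => h.isMeromorphicOnTwo_extension h1t ht q (hΩP hq))
    (fun q hq => h.meromorphic q (h.mem_ringDomain (hΩP hq) hq.1.1)) hx
    (h.extension_eventuallyEq (hΩP hx) (by simp only; rwa [hxn]) ht) p ⟨⟨hpr, ?_⟩, hp.2⟩
  exact hp1.trans_lt h.t₁_lt_t₂

lemma sameMeromorphicOn (h : IsPinchData ε r f Φ φ₀ b Λ t₁ t₂ c m κ ρ) (h1t : t₁ < t)
    (ht : t ≤ t₂) : SameMeromorphicOn (pinchExtension t m φ₀ b Φ f) f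
      (pinchSet φ₀ b (ball 0 r) κ ρ ∩ ringDomain ε) := by
  rintro p ⟨hp, hpr⟩
  obtain ⟨g, k, hgk⟩ := h.isMeromorphicOnTwo_extension h1t ht p hp
  obtain ⟨g', k', hgk'⟩ := h.meromorphic p hpr
  exact hgk.exists_common hgk' (h.frequently_eventuallyEq h1t ht hp hpr.1.1)

lemma isRestriction (h : IsPinchData ε r f Φ φ₀ b Λ t₁ t₂ c m κ ρ) (h1t : t₁ < t) (ht : t ≤ t₂)
    {γ : ℂ → ℂ} (hγ : AnalyticOnNhd ℂ γ (ball 0 r))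
    (hγP : ∀ l ∈ ball (0 : ℂ) r, l ∉ Λ → (l, γ l) ∈ pinchSet φ₀ b (ball 0 r) κ ρ)
    (hwd : RestrictionWellDefined f γ (annulus (1 - ε) (1 + ε) ∩ ball 0 r)) :
    IsRestriction f γ (annulus (1 - ε) (1 + ε) ∩ ball 0 r)
      (fun l => pinchExtension t m φ₀ b Φ f (l, γ l)) := by
  intro l₀ hl₀
  obtain ⟨g, k, hgk, hne⟩ := hwd l₀ hl₀
  refine ⟨g, k, hgk, hne, ?_⟩
  have hγ₀ := hγ l₀ hl₀.2
  filter_upwards [eventually_ne_zero_along_graph hgk.2.1 hγ₀ hne, eventually_notMem_finset Λ l₀,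
    mem_nhdsWithin_of_mem_nhds (((isOpen_annulus _ _).inter isOpen_ball).mem_nhds hl₀),
    ((tendsto_graph hγ₀.continuousAt).eventually hgk.eventually).filter_mono nhdsWithin_le_nhds]
    with l hl hlΛ hlA hq
  have hP := hγP l hlA.2 hlΛ
  rcases lt_or_ge ‖l‖ t with hlt | hlt
  · have := (isQuotientAt_of_analyticAt (h.analyticAt_extension hP hlt ht)).cross_mul hq
      (h.frequently_eventuallyEq h1t ht hP hlA.1.1)
    simpa using this.self_of_nhds
  · rw [h.extension_eq hP (h1t.trans_le hlt) ht, hq.2.2.2.self_of_nhds hl, div_mul_cancel₀ _ hl]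

/-- The poles of the extension along a graph: over the small disc they lie at the pinches, and have
at most the order of the zeros of `b ^ (m + 1)`; elsewhere they are the poles of `f`. -/
lemma meromorphicOn_and_polesAtMost (h : IsPinchData ε r f Φ φ₀ b Λ t₁ t₂ c m κ ρ) (h1t : t₁ < t)
    (ht : t ≤ t₂) {y : ℂ → ℂ} (hy : AnalyticOnNhd ℂ y (ball 0 r))
    (hyκ : ∀ l ∈ ball (0 : ℂ) r, ‖y l - κ‖ < ρ) {N : ℕ}
    (hmer : MeromorphicOn (fun l => f (l, b l * y l + φ₀ l)) {l | t ≤ ‖l‖ ∧ ‖l‖ < r})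
    (hpoles : PolesAtMost (fun l => f (l, b l * y l + φ₀ l)) {l | t ≤ ‖l‖ ∧ ‖l‖ < r} N) :
    MeromorphicOn (fun l => pinchExtension t m φ₀ b Φ f (l, φ₀ l + b l * y l)) (ball 0 r) ∧
      PolesAtMost (fun l => pinchExtension t m φ₀ b Φ f (l, φ₀ l + b l * y l)) (ball 0 r)
        (∑ l ∈ Λ, (analyticOrderAt (fun x => b x ^ (m + 1)) l).toNat + N) := by
  classical
  set G : ℂ → ℂ := fun l => pinchExtension t m φ₀ b Φ f (l, φ₀ l + b l * y l) with hG
  have hmem : ∀ l ∈ ball (0 : ℂ) r, l ∉ Λ →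
      (l, φ₀ l + b l * y l) ∈ pinchSet φ₀ b (ball 0 r) κ ρ := fun l hl hlΛ => by
    have hbl : b l ≠ 0 := fun h0 => hlΛ ((h.b_eq_zero_iff l hl).1 h0)
    refine ⟨hl, hbl, ?_⟩
    simp only
    rw [add_sub_cancel_left, mul_div_cancel_left₀ _ hbl]
    exact hyκ l hl
  have hyc : ∀ l ∈ ball (0 : ℂ) r, y l ∈ ball (0 : ℂ) c ∧ y l ^ m ≠ 0 := fun l hl =>
    h.mem_of_norm_sub_lt _ (hyκ l hl)
  -- the outer part
  have houter : ∀ l ∈ ball (0 : ℂ) r, t ≤ ‖l‖ →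
      (fun l => f (l, b l * y l + φ₀ l)) =ᶠ[𝓝[≠] l] G := by
    intro l hl hlt
    have h2 : ∀ᶠ x in 𝓝 l, t₁ < ‖x‖ :=
      continuous_norm.continuousAt.eventually (lt_mem_nhds (h1t.trans_le hlt))
    filter_upwards [mem_nhdsWithin_of_mem_nhds (isOpen_ball.mem_nhds hl),
      h2.filter_mono nhdsWithin_le_nhds, eventually_notMem_finset Λ l] with x hx hx1 hxΛ
    simp only [hG]
    rw [h.extension_eq (hmem x hx hxΛ) hx1 ht, add_comm (φ₀ x)]
  -- the inner part
  have hbm : ∀ l ∈ ball (0 : ℂ) r, AnalyticAt ℂ (fun x => b x ^ (m + 1)) l := fun l hl =>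
    (h.analytic_b l hl).pow (m + 1)
  have ha : ∀ l ∈ ball (0 : ℂ) t, AnalyticAt ℂ (fun x => (y x ^ m)⁻¹ * Φ (x, y x)) l := by
    intro l hl
    have hlr := ball_subset_ball (ht.trans h.t₂_le) hl
    refine (((hy l hlr).pow m).inv (hyc l hlr).2).mul ?_
    exact analyticAt_along_graph (h.analytic_Φ (l, y l) ⟨ball_subset_ball ht hl, (hyc l hlr).1⟩)
      (hy l hlr)
  have hinner : ∀ l ∈ ball (0 : ℂ) t, ∀ᶠ x in 𝓝[≠] l, b x ^ (m + 1) ≠ 0 ∧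
      G x * b x ^ (m + 1) = (y x ^ m)⁻¹ * Φ (x, y x) := by
    intro l hl
    filter_upwards [mem_nhdsWithin_of_mem_nhds (isOpen_ball.mem_nhds hl),
      eventually_notMem_finset Λ l] with x hx hxΛ
    have hxr := ball_subset_ball (ht.trans h.t₂_le) hx
    have hbx : b x ≠ 0 := fun h0 => hxΛ ((h.b_eq_zero_iff x hxr).1 h0)
    refine ⟨pow_ne_zero _ hbx, ?_⟩
    simp only [hG, pinchExtension]
    rw [if_pos (mem_ball_zero_iff.1 hx), add_sub_cancel_left, mul_div_cancel_left₀ _ hbx, mul_pow]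
    have := (hyc x hxr).2
    field_simp
    ring
  have hGmer : MeromorphicOn G (ball 0 r) := by
    intro l hl
    rcases lt_or_ge ‖l‖ t with hlt | hlt
    · have hlt' := mem_ball_zero_iff.2 hlt
      refine ((ha l hlt').meromorphicAt.div (hbm l hl).meromorphicAt).congr ?_
      filter_upwards [hinner l hlt'] with x hx
      simp only [Pi.div_apply]
      rw [div_eq_iff hx.1]
      exact hx.2.symm
    · exact (hmer l ⟨hlt, mem_ball_zero_iff.1 hl⟩).congr (houter l hl hlt)
  refine ⟨hGmer, fun S hS => ?_⟩
  rw [← Finset.sum_filter_add_sum_filter_not S fun l => ‖l‖ < t]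
  refine add_le_add ?_ ?_
  · have hle : ∀ l ∈ S.filter fun l => ‖l‖ < t, poleOrder G l ≤
        (analyticOrderAt (fun x => b x ^ (m + 1)) l).toNat := by
      intro l hl
      obtain ⟨hlS, hlt⟩ := Finset.mem_filter.1 hl
      have hlt' := mem_ball_zero_iff.2 hlt
      have h1 := poleOrder_le_analyticOrderAt (hGmer l (hS hlS)) (hbm l (hS hlS)) (ha l hlt')
        ((hinner l hlt').mono fun x hx => hx.2)
      have h2 : analyticOrderAt (fun x => b x ^ (m + 1)) l ≠ ⊤ := fun htop => by
        have h3 := (analyticOrderAt_eq_top.1 htop).filter_mono (nhdsWithin_le_nhds (s := {l}ᶜ))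
        obtain ⟨x, hx1, hx2⟩ := (h3.and (hinner l hlt')).exists
        exact hx2.1 hx1
      rw [← ENat.natCast_toNat h2] at h1
      exact_mod_cast h1
    refine (Finset.sum_le_sum hle).trans (Finset.sum_le_sum_of_ne_zero fun l hl hne => ?_)
    by_contra hlΛ
    have hlr := hS (Finset.mem_filter.1 hl).1
    have hbl : b l ≠ 0 := fun h0 => hlΛ ((h.b_eq_zero_iff l hlr).1 h0)
    rw [(hbm l hlr).analyticOrderAt_eq_zero.2 (pow_ne_zero _ hbl)] at hne
    exact hne rfl
  · have hcongr : ∀ l ∈ S.filter fun l => ¬‖l‖ < t, poleOrder G l =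
        poleOrder (fun l => f (l, b l * y l + φ₀ l)) l := by
      intro l hl
      obtain ⟨hlS, hlt⟩ := Finset.mem_filter.1 hl
      unfold poleOrder
      rw [meromorphicOrderAt_congr (houter l (hS hlS) (not_lt.1 hlt))]
    rw [Finset.sum_congr rfl hcongr]
    refine hpoles _ fun l hl => ?_
    obtain ⟨hlS, hlt⟩ := Finset.mem_filter.1 hl
    exact ⟨not_lt.1 hlt, mem_ball_zero_iff.1 (hS hlS)⟩

end IsPinchData

/-! ### Construction of the pinches -/

lemma norm_prod_sub_le_of_subset_ball {Λ : Finset ℂ} {R : ℝ} (hΛ : (Λ : Set ℂ) ⊆ ball 0 R) {l : ℂ}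
    (hl : ‖l‖ < R) : ‖∏ a ∈ Λ, (l - a)‖ ≤ (2 * R) ^ Λ.card := by
  rw [norm_prod, ← Finset.prod_const]
  refine Finset.prod_le_prod (fun _ _ => norm_nonneg _) fun a ha => ?_
  have := mem_ball_zero_iff.1 (hΛ ha)
  linarith [norm_sub_le l a]

/-- Along the graph of `φ₀`, in the coordinate `w = z - φ₀ l`, the function `f` has a pole of
bounded order along `w = 0`, and no pole when its restriction to the graph is well defined. -/
lemma exists_hasAxisPole_shear {ε : ℝ} {f : ℂ × ℂ → ℂ} (hf : IsMeromorphicOnTwo f (ringDomain ε))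
    {φ₀ : ℂ → ℂ} (hφ₀ : AnalyticOnNhd ℂ φ₀ (ball 0 (1 + ε)))
    (hmaps : MapsTo φ₀ (ball 0 (1 + ε)) (ball 0 1)) {r₁ R : ℝ} (hr₁ : 1 - ε < r₁)
    (hR : R < 1 + ε) :
    ∃ m : ℕ, (∀ l, r₁ ≤ ‖l‖ → ‖l‖ ≤ R → HasAxisPole (fun p => f (p.1, p.2 + φ₀ p.1)) m l) ∧
      (RestrictionWellDefined f φ₀ (annulus (1 - ε) (1 + ε)) → m = 0) := by
  by_cases hwd : RestrictionWellDefined f φ₀ (annulus (1 - ε) (1 + ε))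
  · refine ⟨0, fun l h1 h2 => ?_, fun _ => rfl⟩
    have hl : l ∈ ball (0 : ℂ) (1 + ε) := mem_ball_zero_iff.2 (h2.trans_lt hR)
    obtain ⟨g, h, hgh, hne⟩ := hwd l ⟨hr₁.trans_le h1, h2.trans_lt hR⟩
    have hq := IsQuotientAt.shear (w := 0) (hφ₀ l hl) (by rwa [zero_add])
    refine ⟨_, _, hq.1, hq.2.1, by simpa using hne, ?_⟩
    filter_upwards [hq.2.2.2] with p hp
    simpa using hp
  · suffices h : ∃ m, ∀ l ∈ {l : ℂ | r₁ ≤ ‖l‖ ∧ ‖l‖ ≤ R},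
        HasAxisPole (fun p => f (p.1, p.2 + φ₀ p.1)) m l by
      obtain ⟨m, hm⟩ := h
      exact ⟨m, fun l h1 h2 => hm l ⟨h1, h2⟩, fun h => absurd h hwd⟩
    refine exists_hasAxisPole_of_isCompact (isCompact_closedAnnulus _ _) fun l hl => ?_
    have hlb : l ∈ ball (0 : ℂ) (1 + ε) := mem_ball_zero_iff.2 (hl.2.trans_lt hR)
    obtain ⟨g, h, hgh⟩ := hf (l, φ₀ l) ⟨⟨hr₁.trans_le hl.1, hl.2.trans_lt hR⟩, hmaps hlb⟩
    exact (IsQuotientAt.shear (w := 0) (hφ₀ l hlb) (by rwa [zero_add])).hasAxisPole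

/-- After the substitution `z = φ₀ l + b l * y`, with `b` a power of a polynomial with zeros inside
the disc of radius `t₁`, the function `f`, multiplied by powers that remove its poles along the
graph of `φ₀`, extends holomorphically from an annulus to a bidisc. One of the zeros of `b` is the
separating point `p`, at which all graphs of the family meet the graph of `φ₀`. -/
theorem exists_pinch_extension {ε : ℝ} (hε : 0 < ε) {f : ℂ × ℂ → ℂ}
    (hf : IsMeromorphicOnTwo f (ringDomain ε)) {φ : ℕ → ℂ → ℂ} {φ₀ : ℂ → ℂ}
    (htest : IsTestSequence ε φ φ₀) {M : ℕ} (hext : ∀ k, ExtendsAlongGraph ε (1 + ε) f (φ k) M)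
    {r r₁ : ℝ} (hr : 1 < r) (hrε : r ≤ 1 + ε) (hr₁0 : 0 ≤ r₁) (hr₁ε : 1 - ε ≤ r₁) (hr₁ : r₁ < 1)
    {m : ℕ} (hm : ∀ l, r₁ ≤ ‖l‖ → ‖l‖ ≤ 1 → HasAxisPole (fun p => f (p.1, p.2 + φ₀ p.1)) m l) :
    ∃ (t₁ t₂ c : ℝ) (Λ : Finset ℂ) (K : ℕ) (Φ : ℂ × ℂ → ℂ) (p : ℂ),
      r₁ < t₁ ∧ t₁ < t₂ ∧ t₂ < 1 ∧ 0 < c ∧ (Λ : Set ℂ) ⊆ ball 0 t₁ ∧ 1 ≤ K ∧ p ∈ Λ ∧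
      AnalyticOnNhd ℂ Φ (ball 0 t₂ ×ˢ ball 0 c) ∧
      (∀ l ∈ annulus t₁ t₂, ∀ y ∈ ball (0 : ℂ) c, ((∏ a ∈ Λ, (l - a)) ^ K * y) ^ m ≠ 0 →
        Φ (l, y) = (∏ a ∈ Λ, (l - a)) ^ K * (((∏ a ∈ Λ, (l - a)) ^ K * y) ^ m *
          f (l, (∏ a ∈ Λ, (l - a)) ^ K * y + φ₀ l))) ∧
      ∀ γ, AnalyticOnNhd ℂ γ (ball 0 r) →
        (∀ l ∈ annulus (1 - ε) (1 + ε) ∩ ball 0 r, (l, γ l) ∈ ringDomain ε) →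
        ¬RestrictionWellDefined f γ (annulus (1 - ε) (1 + ε) ∩ ball 0 r) → γ p = φ₀ p →
        EqOn γ φ₀ (ball 0 r) := by
  classical
  obtain ⟨s₁, s₂, δ, C, F, h1, h2, h3, hδ, hF, hFC, hFf⟩ := exists_annulus_analyticOnNhd hr₁ hm
  obtain ⟨Z, b, c, H, v, hexp⟩ := exists_isExpansion hε htest hext (hr₁ε.trans h1.le) h3.le hδ hF
    hFC hFf
  obtain ⟨t₁, t₂, h4, h5, h6, Λ₀, K, hΛ₀, hK, hcoef⟩ := hexp.exists_pole_bound h2 h3.le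
  have ht₁ : 0 < t₁ := by linarith
  have ht₁r : t₁ < r := by linarith
  obtain ⟨p, hp, hsep⟩ := exists_separating_point hf
    ((htest.analyticOnNhd_limit).mono (ball_subset_ball hrε)) ht₁ ht₁r
    (A := annulus (1 - ε) (1 + ε) ∩ ball 0 r) inter_subset_right
  have hsub : annulus t₁ t₂ ⊆ annulus s₁ s₂ := fun l hl => ⟨h4.trans hl.1, hl.2.trans h6⟩
  -- the separating point becomes a pinch, though the coefficients have no poles there in general
  have hΛ : ((insert p Λ₀ : Finset ℂ) : Set ℂ) ⊆ ball 0 t₁ := by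
    rw [Finset.coe_insert]
    exact insert_subset hp hΛ₀
  have hsub' : annulus t₁ t₂ ×ˢ ball (0 : ℂ) δ ⊆ annulus s₁ s₂ ×ˢ ball 0 δ :=
    prod_mono hsub subset_rfl
  obtain ⟨c', Φ, hc', hΦ, hΦF⟩ := exists_blowup (B := fun l => ∏ a ∈ insert p Λ₀, (l - a))
    (β := (2 * t₂) ^ (insert p Λ₀).card) (K := K) h5 hδ (hF.mono hsub')
    (fun q hq => hFC q (hsub' hq)) (by have : 0 < t₂ := ht₁.trans h5
                                       positivity)
    (fun l hl => norm_prod_sub_le_of_subset_ball (hΛ.trans (ball_subset_ball h5.le)) hl.2)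
    (fun n => by
      obtain ⟨g, hg, hgA⟩ := hcoef n
      by_cases hpΛ : p ∈ Λ₀
      · rw [Finset.insert_eq_of_mem hpΛ]
        exact ⟨g, hg, hgA⟩
      · refine ⟨fun l => (l - p) ^ (K * (n + 1)) * g l, fun l hl => ?_, fun l hl => ?_⟩
        · exact ((analyticAt_id.sub analyticAt_const).pow _).mul (hg l hl)
        · simp only
          rw [hgA l hl, Finset.prod_insert hpΛ, mul_pow]
          ring)
  refine ⟨t₁, t₂, c', insert p Λ₀, K, Φ, p, h1.trans h4, h5, h6.trans h3, hc', hΛ, hK,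
    Finset.mem_insert_self _ _, hΦ, fun l hl y hy hne => ?_, hsep⟩
  obtain ⟨hw, hΦl⟩ := hΦF l hl y hy
  rw [hΦl, hFf (l, _) ⟨hsub hl, hw⟩ hne]

end LeviPinch

theorem mainTheorem1 (ε : ℝ) (hε : 0 < ε) (f : ℂ × ℂ → ℂ)
    (hf : LeviPinch.IsMeromorphicOnTwo f (LeviPinch.ringDomain ε))
    (φ : ℕ → ℂ → ℂ) (φ₀ : ℂ → ℂ) (htest : LeviPinch.IsTestSequence ε φ φ₀)
    (hext : ∃ M : ℕ, ∀ k, LeviPinch.ExtendsAlongGraph ε (1 + ε) f (φ k) M)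
    (ε' : ℝ) (hε' : 0 < ε') (hε'ε : ε' < ε) (η : ℝ) (hη : 0 < η) :
    ∃ (E : Type) (_ : NormedAddCommGroup E) (_ : NormedSpace ℂ E) (_ : CompleteSpace E),
      ¬ FiniteDimensional ℂ E ∧
      ∃ (ρ : ℝ) (φA : E → ℂ → ℂ), 0 < ρ ∧
        LeviPinch.IsAnalyticFamily ρ (1 + ε') φA ∧
        (∀ α ∈ Metric.ball (0 : E) ρ, ∀ l ∈ Metric.ball (0 : ℂ) (1 + ε'),
          ‖φA α l - φ₀ l‖ < η) ∧
        (LeviPinch.RestrictionWellDefined f φ₀ (LeviPinch.annulus (1 - ε) (1 + ε)) →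
          Set.EqOn (φA 0) φ₀ (Metric.ball 0 (1 + ε'))) ∧
        (∃ N : ℕ, ∀ α ∈ Metric.ball (0 : E) ρ,
          LeviPinch.ExtendsAlongGraph ε (1 + ε') f (φA α) N) ∧
        LeviPinch.IsPinchedDomain (1 + ε') (φA 0) (LeviPinch.sweptSet ρ (1 + ε') φA) ∧
        ∃ F : ℂ × ℂ → ℂ,
          LeviPinch.IsMeromorphicOnTwo F (LeviPinch.sweptSet ρ (1 + ε') φA) ∧
          LeviPinch.SameMeromorphicOn F f
            (LeviPinch.sweptSet ρ (1 + ε') φA ∩ LeviPinch.ringDomain ε) := by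
  open LeviPinch in
  obtain ⟨M, hext⟩ := hext
  obtain ⟨r, hr⟩ : ∃ r, r = 1 + ε' := ⟨_, rfl⟩
  rw [← hr]
  obtain ⟨R, hrR, hRε⟩ : ∃ R, r < R ∧ R < 1 + ε := exists_between (by linarith)
  obtain ⟨r₁, hr₁, hr₁1⟩ : ∃ r₁, max 0 (1 - ε) < r₁ ∧ r₁ < 1 :=
    exists_between (max_lt one_pos (by linarith))
  obtain ⟨hr₁0, hr₁ε⟩ := max_lt_iff.1 hr₁
  have hr1 : 1 < r := by linarith
  have hφ₀ : AnalyticOnNhd ℂ φ₀ (ball 0 (1 + ε)) := htest.analyticOnNhd_limit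
  have hballR : ball (0 : ℂ) R ⊆ ball 0 (1 + ε) := ball_subset_ball hRε.le
  have hballr : ball (0 : ℂ) r ⊆ ball 0 R := ball_subset_ball hrR.le
  have hφ₀r : AnalyticOnNhd ℂ φ₀ (ball 0 r) := hφ₀.mono (hballr.trans hballR)
  obtain ⟨m, hm, hm0⟩ := exists_hasAxisPole_shear hf hφ₀ htest.mapsTo_limit hr₁ε hRε
  obtain ⟨t₁, t₂, c, Λ, K, Φ, p, hrt₁, ht₁₂, ht₂, hc, hΛ, hK, hpΛ, hΦ, hΦf, hsep⟩ :=
    exists_pinch_extension hε hf htest hext hr1 (by linarith) hr₁0.le hr₁ε.le hr₁1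
      fun l h1 h2 => hm l h1 (h2.trans (hr1.trans hrR).le)
  obtain ⟨b, hb⟩ : ∃ b : ℂ → ℂ, ∀ l, b l = (∏ a ∈ Λ, (l - a)) ^ K := ⟨_, fun _ => rfl⟩
  simp only [← hb] at hΦf
  have hban : ∀ l, AnalyticAt ℂ b l := fun l => by
    rw [funext hb]
    exact (Differentiable.analyticAt (by fun_prop) l)
  have hb0 : ∀ l, b l = 0 ↔ l ∈ Λ := fun l => by
    rw [hb, pow_eq_zero_iff (by lia), Finset.prod_eq_zero_iff]
    simp [sub_eq_zero]
  obtain ⟨t, h1t, ht⟩ := exists_between ht₁₂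
  -- the poles over the closed annulus, where `b` has no zeros
  obtain ⟨N, δ, hδ, hpoles⟩ := exists_pole_bound_of_isCompact (isCompact_closedAnnulus t r)
    (isOpen_ball : IsOpen (ball (0 : ℂ) R))
    (fun l hl => mem_ball_zero_iff.2 (hl.2.trans_lt hrR))
    fun l hl => hm l (by linarith [hl.1]) (hl.2.trans hrR.le)
  -- the distance of the limit graph to the boundary of the unit disc
  obtain ⟨d, hd, hdφ₀⟩ : ∃ d > 0, ∀ l ∈ ball (0 : ℂ) r, ‖φ₀ l‖ + d ≤ 1 := by
    have hsub : closedBall (0 : ℂ) r ⊆ ball 0 (1 + ε) := closedBall_subset_ball (by linarith)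
    obtain ⟨x, hx, hmax⟩ := (isCompact_closedBall (0 : ℂ) r).exists_isMaxOn
      ⟨0, mem_closedBall_self (by linarith)⟩ (hφ₀.continuousOn.mono hsub).norm
    refine ⟨1 - ‖φ₀ x‖, ?_, fun l hl => ?_⟩
    · linarith [mem_ball_zero_iff.1 (htest.mapsTo_limit (hsub hx))]
    · have : ‖φ₀ l‖ ≤ ‖φ₀ x‖ := hmax (ball_subset_closedBall hl)
      linarith
  obtain ⟨β, hβ, hbβ⟩ : ∃ β > 0, ∀ l ∈ ball (0 : ℂ) R, ‖b l‖ ≤ β := by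
    have hR : 0 < R := by linarith
    refine ⟨((2 * R) ^ Λ.card) ^ K, by positivity, fun l hl => ?_⟩
    rw [hb, norm_pow]
    gcongr
    exact norm_prod_sub_le_of_subset_ball (hΛ.trans (ball_subset_ball (by linarith)))
      (mem_ball_zero_iff.1 hl)
  obtain ⟨μ, hμ, hμδ, hμd, hμη⟩ : ∃ μ > 0, μ ≤ δ ∧ μ ≤ d ∧ μ ≤ η :=
    ⟨min δ (min d η), by positivity, min_le_left _ _, (min_le_right _ _).trans (min_le_left _ _),
      (min_le_right _ _).trans (min_le_right _ _)⟩
  obtain ⟨ρ, hρ, hρc, hρμ⟩ : ∃ ρ > 0, 3 * ρ ≤ c ∧ β * (3 * ρ) ≤ μ := by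
    refine ⟨min (c / 3) (μ / (3 * β)), by positivity, ?_, ?_⟩
    · linarith [min_le_left (c / 3) (μ / (3 * β))]
    · calc β * (3 * min (c / 3) (μ / (3 * β))) ≤ β * (3 * (μ / (3 * β))) := by
            gcongr
            exact min_le_right _ _
        _ = μ := by field_simp
  -- the centre of the discs of values of `y` must be off the pole `y = 0`, if there is one
  obtain ⟨κ, hκ, hκwd, hκne⟩ : ∃ κ : ℂ, ‖κ‖ ≤ 2 * ρ ∧
      (RestrictionWellDefined f φ₀ (annulus (1 - ε) (1 + ε)) → κ = 0) ∧
      (¬RestrictionWellDefined f φ₀ (annulus (1 - ε) (1 + ε)) → ∀ y, ‖y - κ‖ < ρ → y ≠ 0) := by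
    by_cases hwd : RestrictionWellDefined f φ₀ (annulus (1 - ε) (1 + ε))
    · exact ⟨0, by simpa using hρ.le, fun _ => rfl, fun h => absurd hwd h⟩
    · have hn : ‖((2 * ρ : ℝ) : ℂ)‖ = 2 * ρ := by
        rw [Complex.norm_real, Real.norm_of_nonneg (by positivity)]
      refine ⟨((2 * ρ : ℝ) : ℂ), hn.le, fun h => absurd h hwd, fun _ y hy h0 => ?_⟩
      rw [h0, zero_sub, norm_neg, hn] at hy
      linarith
  have hy3 : ∀ y, ‖y - κ‖ < ρ → ‖y‖ < 3 * ρ := fun y hy => by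
    linarith [norm_le_norm_add_norm_sub' y κ]
  have hym : ∀ y, ‖y - κ‖ < ρ → y ^ m ≠ 0 := fun y hy => by
    by_cases hwd : RestrictionWellDefined f φ₀ (annulus (1 - ε) (1 + ε))
    · simp [hm0 hwd]
    · exact pow_ne_zero _ (hκne hwd y hy)
  have hbyμ : ∀ l ∈ ball (0 : ℂ) R, ∀ y, ‖y - κ‖ < ρ → ‖b l * y‖ < μ := fun l hl y hy => by
    rw [norm_mul]
    calc ‖b l‖ * ‖y‖ ≤ β * ‖y‖ := by gcongr; exact hbβ l hl
      _ < β * (3 * ρ) := by gcongr; exact hy3 y hy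
      _ ≤ μ := hρμ
  have hmem1 : ∀ l ∈ ball (0 : ℂ) r, ∀ y, ‖y - κ‖ < ρ → φ₀ l + b l * y ∈ ball (0 : ℂ) 1 :=
    fun l hl y hy => mem_ball_zero_iff.2 <| by
      linarith [norm_add_le (φ₀ l) (b l * y), hbyμ l (hballr hl) y hy, hdφ₀ l hl]
  have hdata : IsPinchData ε r f Φ φ₀ b Λ t₁ t₂ c m κ ρ :=
    { meromorphic := hf
      analytic_φ₀ := hφ₀r
      analytic_b := fun l _ => hban l
      b_eq_zero_iff := fun l _ => hb0 l
      Λ_subset := hΛ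
      le_t₁ := by linarith
      t₁_pos := by linarith
      t₁_lt_t₂ := ht₁₂
      t₂_le := by linarith
      r_le := by linarith
      ρ_pos := hρ
      analytic_Φ := hΦ
      Φ_eq := hΦf
      mem_of_norm_sub_lt := fun y hy => ⟨mem_ball_zero_iff.2 ((hy3 y hy).trans_le hρc), hym y hy⟩
      snd_mem := fun q hq => by
        have := hmem1 q.1 hq.1 _ hq.2.2
        rwa [mul_div_cancel₀ _ hq.2.1, add_sub_cancel] at this }
  obtain ⟨E, _, _, _, hE, T, σ, hT, hTle, hσn, hTσ, hinj⟩ :=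
    exists_banach_space_of_holomorphic (R := R) (by linarith)
  have hTα : ∀ α ∈ ball (0 : E) ρ, ∀ l ∈ ball (0 : ℂ) R, ‖(κ + T l α) - κ‖ < ρ :=
    fun α hα l hl => by
      rw [add_sub_cancel_left]
      exact (hTle l hl α).trans_lt (mem_ball_zero_iff.1 hα)
  have hTler := fun l (hl : l ∈ ball (0 : ℂ) r) => hTle l (hballr hl)
  have hTσr := fun l (hl : l ∈ ball (0 : ℂ) r) => hTσ l (hballr hl)
  have hswept : sweptSet ρ r (pinchFamily φ₀ b κ T) = pinchSet φ₀ b (ball 0 r) κ ρ :=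
    sweptSet_pinchFamily hφ₀r.continuousOn (fun l _ => (hban l).continuousAt.continuousWithinAt)
      hTler hσn hTσr
  have hfam0 : pinchFamily φ₀ b κ T 0 = fun l => φ₀ l + b l * κ := by
    funext l
    simp [pinchFamily]
  refine ⟨E, _, _, ‹_›, hE, ρ, pinchFamily φ₀ b κ T, hρ, ?_, fun α hα l hl => ?_, fun hwd l _ => ?_,
    ⟨∑ l ∈ Λ, (analyticOrderAt (fun x => b x ^ (m + 1)) l).toNat + N, fun α hα => ?_⟩, ?_,
    pinchExtension t m φ₀ b Φ f, ?_, ?_⟩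
  · exact isAnalyticFamily_pinchFamily (Λ := Λ) (by linarith) hφ₀r (fun l _ => hban l)
      (hT.mono hballr) (fun l _ hl h0 => hl ((hb0 l).1 h0)) hTσr hinj
      fun α hα l hl => hmem1 l hl _ (hTα α hα l (hballr hl))
  · rw [pinchFamily, add_sub_cancel_left]
    exact (hbyμ l (hballr hl) _ (hTα α hα l (hballr hl))).trans_le hμη
  · rw [hfam0, hκwd hwd]
    simp
  · have hγ : AnalyticOnNhd ℂ (pinchFamily φ₀ b κ T α) (ball 0 r) :=
      analyticOnNhd_pinchFamily_apply hφ₀r (fun l _ => hban l) (hT.mono hballr) α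
    have hγP : ∀ l ∈ ball (0 : ℂ) r, l ∉ Λ →
        (l, pinchFamily φ₀ b κ T α l) ∈ pinchSet φ₀ b (ball 0 r) κ ρ := fun l hl hlΛ =>
      pinchFamily_mem hTler hα hl fun h0 => hlΛ ((hb0 l).1 h0)
    -- the graph passes through the separating point `p`
    have hγp : pinchFamily φ₀ b κ T α p = φ₀ p := by
      rw [pinchFamily, (hb0 p).2 hpΛ, zero_mul, add_zero]
    have hwdγ : RestrictionWellDefined f (pinchFamily φ₀ b κ T α)
        (annulus (1 - ε) (1 + ε) ∩ ball 0 r) := by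
      by_contra hnot
      have heq := hsep _ hγ (fun l hl => ⟨hl.1, hmem1 l hl.2 _ (hTα α hα l (hballr hl.2))⟩) hnot hγp
      by_cases hwd : RestrictionWellDefined f φ₀ (annulus (1 - ε) (1 + ε))
      · refine hnot fun l hl => ?_
        obtain ⟨g, h, hgh, hne⟩ := hwd l hl.1
        refine ⟨g, h, by rwa [heq hl.2], hne.mp ?_⟩
        filter_upwards [isOpen_ball.mem_nhds hl.2] with x hx hx0
        rwa [heq hx]
      · obtain ⟨l, hlr, hlΛ⟩ := ((Ioo_infinite (zero_lt_one' ℝ)).image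
          (Complex.ofReal_injective.injOn)).exists_notMem_finset Λ
        obtain ⟨x, hx, rfl⟩ := hlr
        have hxr : (x : ℂ) ∈ ball (0 : ℂ) r := mem_ball_zero_iff.2 <| by
          rw [Complex.norm_real, Real.norm_of_nonneg hx.1.le]
          exact hx.2.trans hr1
        have h1 := heq hxr
        rw [pinchFamily, add_eq_left, mul_eq_zero] at h1
        exact h1.elim (fun h0 => hlΛ ((hb0 _).1 h0))
          (hκne hwd _ (hTα α hα _ (hballr hxr)))
    have hyan : AnalyticOnNhd ℂ (fun l => κ + T l α) (ball 0 R) := fun l hl =>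
      analyticAt_const.add (((ContinuousLinearMap.apply ℂ ℂ α).analyticAt (T l)).comp (hT l hl))
    obtain ⟨hmer, hpol⟩ := hpoles (fun l => b l * (κ + T l α))
      (fun l hl => (hban l).mul (hyan l hl))
      (fun l hl => (hbyμ l hl _ (hTα α hα l hl)).trans_le hμδ)
      (fun l hl => by
        have hlR : l ∈ ball (0 : ℂ) R := mem_ball_zero_iff.2 (hl.2.trans_lt hrR)
        rw [mul_pow]
        refine mul_ne_zero (pow_ne_zero _ fun h0 => ?_) (hym _ (hTα α hα l hlR))
        have := mem_ball_zero_iff.1 (hΛ ((hb0 l).1 h0))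
        linarith [hl.1])
    have hsub : {l : ℂ | t ≤ ‖l‖ ∧ ‖l‖ < r} ⊆ {l | t ≤ ‖l‖ ∧ ‖l‖ ≤ r} := fun l hl =>
      ⟨hl.1, hl.2.le⟩
    obtain ⟨h1, h2⟩ := hdata.meromorphicOn_and_polesAtMost h1t ht.le (hyan.mono hballr)
      (fun l hl => hTα α hα l (hballr hl)) (fun l hl => hmer l (hsub hl))
      (fun S hS => hpol S (hS.trans hsub))
    exact ⟨_, h1, hdata.isRestriction h1t ht.le hγ hγP hwdγ, h2⟩
  · rw [hswept, hfam0]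
    exact isPinchedDomain_pinchSet hr1 hρ hK hφ₀r.continuousOn
      (hΛ.trans (ball_subset_ball (by linarith))) hb
  · rw [hswept]
    exact hdata.isMeromorphicOnTwo_extension h1t ht.le
  · rw [hswept]
    exact hdata.sameMeromorphicOn h1t ht.le
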